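/- Let $\Lambda_N$ be the exterior $\mathbb C$-algebra on $N\ge 0$ odd generators (the algebra of constants; $\Lambda_0=\mathbb C$), and let $M$ be an analytic supermanifold over $\Lambda_N$, possibly formal in some of its even directions. That is, $M$ is a topological space with a sheaf $\mathcal O_M$ of supercommutative $\Lambda_N$-superalgebras that is locally isomorphic to $\mathcal O_U[[t_1,\dots,t_k]]\otimes\Lambda(\xi_1,\dots,\xi_q)\otimes\Lambda_N$, with $U\subseteq\mathbb C^p$ open and $\mathcal O_U$ the sheaf of holomorphic functions ($k=0$: analytic supermanifolds; $k>0$: formal completions along a submanifold). Let $\mathcal T_M$ be the tangent sheaf, whose sections are the $\Lambda_N$-linear superderivations of $\mathcal O_M$, with superbracket $[\,,]$. Write $(-1)^{XY}$ for $(-1)^{|X||Y|}$; formulas with signs are for homogeneous arguments. Let $\nabla_0$ be a connection on $\mathcal T_M$, and let $A$ be an odd global section of $\Omega^1_M\otimes \mathrm{End}(\mathcal T_M)$, where $|df|=|f|+1$. With the contraction $i_X(df\otimes G)=Xf\cdot G$, put $$X\circ^A Y:=i_X(A)(Y),\qquad \nabla^A_\lambda:=\nabla_0+\lambda A,\quad\text{i.e.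 } \nabla^A_{\lambda,X}Y=\nabla_{0,X}Y+\lambda\, X\circ^A Y,$$ for every even constant $\lambda\in\Lambda_N$. For an even $\mathcal O_M$-bilinear multiplication $\circ$ on $\mathcal T_M$ and a connection $\nabla$, call $(M,\circ,\nabla)$ an *$F$-manifold with compatible flat structure* if 1. $\circ$ is supercommutative and associative; 2. $P_{X\circ Y}(Z,W)=X\circ P_Y(Z,W)+(-1)^{XY}\,Y\circ P_X(Z,W)$ for all local vector fields, where $P_X(Z,W)=[X,Z\circ W]-[X,Z]\circ W-(-1)^{XZ}Z\circ[X,W]$; 3. $\nabla$ is torsionless, $\nabla_XY-(-1)^{XY}\nabla_YX=[X,Y]$, and flat, $\nabla_X\nabla_YZ-(-1)^{XY}\nabla_Y\nabla_XZ=\nabla_{[X,Y]}Z$; 4. every point has a neighbourhood with a vector field $C$ on it such that $X\circ Y=[X,[Y,C]]$ for all local $\nabla$-flat vector fields $X,Y$ in that neighbourhood. **Corollary 2.7.** (i) $(M,\circ^A,\nabla_0)$ is an $F$-manifold with compatible flat structure if and only if $\nabla^A_\lambda$ is torsionless and flat for every even constant $\lambda$. (ii) In this case $(M,\circ^A,\nabla^A_\lambda)$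 is an $F$-manifold with compatible flat structure for every even constant $\lambda$. -/

import Mathlib

open CategoryTheory TopologicalSpace Opposite Topology

universe u v

noncomputable section

namespace SuperGeom

/-! ### Local models

The structure sheaf of an analytic supermanifold over `ℂ`, over a Grassmann algebra of odd constants,
or of a formal completion of such an object, is locally
`𝒪_U[[t₁,…,t_k]] ⊗ Λ(ξ₁,…,ξ_q) ⊗ Λ(θ₁,…,θ_N)` with `U ⊆ ℂ^p` open: `t` are the formal even
coordinates, `ξ` the odd coordinates and `θ` the odd constants. It is realised as the sheaf of
holomorphic functions on `U` with values in `Λ(ξ,θ)[[t]]`. -/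

/-- The exterior `ℂ`-algebra of constants, on `N` odd generators (`N = 0` gives `ℂ`). -/
abbrev Constants (N : ℕ) : Type := ExteriorAlgebra ℂ (Fin N → ℂ)

/-- `λ` is an even constant. -/
def IsEvenConstant {N : ℕ} (c : Constants N) : Prop := CliffordAlgebra.involute c = c

/-- The exterior algebra on the odd coordinates `ξ` and the odd constants `θ`. -/
abbrev Grassmann (N q : ℕ) : Type := ExteriorAlgebra ℂ ((Fin q → ℂ) × (Fin N → ℂ))

/-- `Λ(ξ,θ)[[t₁,…,t_k]]`. -/
abbrev ModelAlg (N q k : ℕ) : Type := MvPowerSeries (Fin k) (Grassmann N q)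

/-- The parity involution of the model algebra: `1` on even elements and `-1` on odd ones. -/
def ModelAlg.parity (N q k : ℕ) : ModelAlg N q k →+* ModelAlg N q k :=
  MvPowerSeries.map (CliffordAlgebra.involute : Grassmann N q →ₐ[ℂ] Grassmann N q).toRingHom

/-- The inclusion of the constants in the model algebra. -/
def ModelAlg.const (N q k : ℕ) : Constants N →+* ModelAlg N q k :=
  MvPowerSeries.C.comp (ExteriorAlgebra.map (LinearMap.inr ℂ (Fin q → ℂ) (Fin N → ℂ))).toRingHom

/-- Holomorphy of a function with values in a (finite-dimensional) complex vector space. -/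
def IsHol {p : ℕ} {E : Type} [AddCommGroup E] [Module ℂ E] {V : Opens (Fin p → ℂ)} (f : V → E) :
    Prop :=
  ∀ x : V, ∃ (ι : Type) (_ : Fintype ι) (g : ι → (Fin p → ℂ) → ℂ) (c : ι → E),
    (∀ i, AnalyticAt ℂ (g i) x) ∧ ∀ᶠ y : V in 𝓝 x, f y = ∑ i, g i y • c i

lemma IsHol.const {p : ℕ} {E : Type} [AddCommGroup E] [Module ℂ E] {V : Opens (Fin p → ℂ)}
    (c : E) : IsHol (fun _ : V => c) :=
  fun _ => ⟨Unit, inferInstance, fun _ _ => 1, fun _ => c, fun _ => analyticAt_const, by simp⟩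

lemma IsHol.add {p : ℕ} {E : Type} [AddCommGroup E] [Module ℂ E] {V : Opens (Fin p → ℂ)}
    {f f' : V → E} (hf : IsHol f) (hf' : IsHol f') : IsHol (fun x => f x + f' x) := by
  intro x
  obtain ⟨ι, _, g, c, hg, h⟩ := hf x
  obtain ⟨ι', _, g', c', hg', h'⟩ := hf' x
  refine ⟨ι ⊕ ι', inferInstance, Sum.elim g g', Sum.elim c c', ?_, ?_⟩
  · rintro (i | i)
    · exact hg i
    · exact hg' i
  · filter_upwards [h, h'] with y hy hy'
    simp [hy, hy']

lemma IsHol.mul {p : ℕ} {E : Type} [Ring E] [Algebra ℂ E] {V : Opens (Fin p → ℂ)}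
    {f f' : V → E} (hf : IsHol f) (hf' : IsHol f') : IsHol (fun x => f x * f' x) := by
  intro x
  obtain ⟨ι, _, g, c, hg, h⟩ := hf x
  obtain ⟨ι', _, g', c', hg', h'⟩ := hf' x
  refine ⟨ι × ι', inferInstance, fun i y => g i.1 y * g' i.2 y, fun i => c i.1 * c' i.2,
    fun i => (hg i.1).mul (hg' i.2), ?_⟩
  filter_upwards [h, h'] with y hy hy'
  rw [hy, hy', Finset.sum_mul_sum, Fintype.sum_prod_type]
  simp [mul_smul_mul_comm]

lemma IsHol.sum {p : ℕ} {E : Type} [AddCommGroup E] [Module ℂ E] {V : Opens (Fin p → ℂ)}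
    {J : Type} (s : Finset J) {f : J → V → E} (hf : ∀ j ∈ s, IsHol (f j)) :
    IsHol (fun x => ∑ j ∈ s, f j x) := by
  classical
  induction s using Finset.induction_on with
  | empty => simpa using IsHol.const (0 : E)
  | insert a s ha ih =>
    simp only [Finset.sum_insert ha]
    exact (hf a (by simp)).add (ih fun j hj => hf j (by simp [hj]))

/-- The sections over `V ⊆ ℂ^p` of the structure sheaf of the model: functions
`V → Λ(ξ,θ)[[t]]` all of whose `t`-coefficients are holomorphic. -/
def modelSections (N q k : ℕ) {p : ℕ} (V : Opens (Fin p → ℂ)) :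
    Subalgebra ℂ (V → ModelAlg N q k) where
  carrier := {f | ∀ m : Fin k →₀ ℕ, IsHol (fun x => MvPowerSeries.coeff m (f x))}
  mul_mem' {f f'} hf hf' m := by
    classical
    simp only [Pi.mul_apply, MvPowerSeries.coeff_mul]
    exact IsHol.sum _ fun j _ => (hf j.1).mul (hf' j.2)
  add_mem' {f f'} hf hf' m := by
    simpa using (hf m).add (hf' m)
  algebraMap_mem' r m := IsHol.const (MvPowerSeries.coeff m (algebraMap ℂ (ModelAlg N q k) r))

/-! ### Supermanifolds -/

/-- The sign `(-1)^{ab}` attached to two parities. -/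
def sgn (a b : ZMod 2) : ℤ := (-1) ^ (a.val * b.val)

lemma zmod_two_cases : ∀ a : ZMod 2, a = 0 ∨ a = 1 := by decide

lemma sgn_zero_left : ∀ b, sgn 0 b = 1 := by decide

lemma sgn_mul_self : ∀ a b, sgn a b * sgn a b = 1 := by decide

lemma sgn_comm : ∀ a b, sgn a b = sgn b a := by decide

lemma sgn_add_left : ∀ a b c, sgn (a + b) c = sgn a c * sgn b c := by decide

lemma sgn_add_right : ∀ a b c, sgn a (b + c) = sgn a b * sgn a c := by decide

lemma sgn_one_add (a b : ZMod 2) : sgn 1 (a + b) = sgn 1 a * sgn 1 b := sgn_add_right 1 a b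

/-- A space with a sheaf of supercommutative superalgebras over the Grassmann algebra of constants.
The `ℤ/2`-grading is given through its parity involution (`f ↦ f` on even, `f ↦ -f` on odd `f`). -/
structure SuperSpace (N : ℕ) (M : Type u) [TopologicalSpace M] where
  presheaf : TopCat.Presheaf (AlgCat.{v} ℂ) (TopCat.of M)
  isSheaf : presheaf.IsSheafUniqueGluing
  parityHom : presheaf ⟶ presheaf
  parityHom_comp : parityHom ≫ parityHom = 𝟙 presheaf
  const : ∀ U : Opens M, Constants N →ₐ[ℂ] presheaf.obj (op U)
  const_res : ∀ {U V : Opens M} (h : V ≤ U) (c : Constants N),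
    (presheaf.map (homOfLE h).op).hom (const U c) = const V c
  const_parity : ∀ (U : Opens M) (c : Constants N),
    (parityHom.app (op U)).hom (const U c) = const U (CliffordAlgebra.involute c)
  supercomm : ∀ (U : Opens M) (a b : ZMod 2) (f g : presheaf.obj (op U)),
    (parityHom.app (op U)).hom f = sgn 1 a • f → (parityHom.app (op U)).hom g = sgn 1 b • g →
      f * g = sgn a b • (g * f)

namespace SuperSpace

variable {N : ℕ} {M : Type u} [TopologicalSpace M] (S : SuperSpace.{u, v} N M)

/-- Sections of the structure sheaf. -/
abbrev O (U : Opens M) : Type v := S.presheaf.obj (op U)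

/-- Restriction of functions. -/
def res {U V : Opens M} (h : V ≤ U) : S.O U →ₐ[ℂ] S.O V := (S.presheaf.map (homOfLE h).op).hom

/-- The parity involution. -/
def par (U : Opens M) : S.O U →ₐ[ℂ] S.O U := (S.parityHom.app (op U)).hom

/-- `f` is homogeneous of parity `a`. -/
def IsHom {U : Opens M} (a : ZMod 2) (f : S.O U) : Prop := S.par U f = sgn 1 a • f

lemma IsHom.eq {S : SuperSpace.{u, v} N M} {U : Opens M} {a : ZMod 2} {f : S.O U}
    (h : S.IsHom a f) : S.par U f = sgn 1 a • f := h

lemma res_res {U V W : Opens M} (h : V ≤ U) (h' : W ≤ V) (f : S.O U) :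
    S.res h' (S.res h f) = S.res (h'.trans h) f := by
  simp only [res, ← AlgCat.comp_apply, ← Functor.map_comp]
  rfl

lemma res_self {U : Opens M} (f : S.O U) : S.res le_rfl f = f :=
  ConcreteCategory.congr_hom (S.presheaf.map_id (op U)) f

lemma par_par {U : Opens M} (f : S.O U) : S.par U (S.par U f) = f :=
  ConcreteCategory.congr_hom (congrArg (fun t => t.app (op U)) S.parityHom_comp) f

lemma res_par {U V : Opens M} (h : V ≤ U) (f : S.O U) :
    S.res h (S.par U f) = S.par V (S.res h f) :=
  (ConcreteCategory.congr_hom (S.parityHom.naturality (homOfLE h).op) f).symm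

/-- A chart with `p` even (convergent), `k` formal even and `q` odd coordinates: a homeomorphism from
an open subset of `M` to an open subset of `ℂ^p` with an isomorphism of the structure sheaves,
respecting restrictions, parity and constants. -/
structure Chart (p k q : ℕ) where
  e : OpenPartialHomeomorph M (Fin p → ℂ)
  iso : ∀ (V : Opens M) (hV : (V : Set M) ⊆ e.source),
    S.O V ≃ₐ[ℂ] modelSections N q k ⟨e '' V, e.isOpen_image_of_subset_source V.isOpen hV⟩
  iso_res : ∀ (V W : Opens M) (hV : (V : Set M) ⊆ e.source) (h : W ≤ V) (f : S.O V) (x : M)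
    (hx : x ∈ W),
    (iso W (fun _ hy => hV (h hy)) (S.res h f)).1 ⟨e x, x, hx, rfl⟩ =
      (iso V hV f).1 ⟨e x, x, h hx, rfl⟩
  iso_par : ∀ (V : Opens M) (hV : (V : Set M) ⊆ e.source) (f : S.O V) (x : M) (hx : x ∈ V),
    (iso V hV (S.par V f)).1 ⟨e x, x, hx, rfl⟩ =
      ModelAlg.parity N q k ((iso V hV f).1 ⟨e x, x, hx, rfl⟩)
  iso_const : ∀ (V : Opens M) (hV : (V : Set M) ⊆ e.source) (c : Constants N) (x : M)
    (hx : x ∈ V), (iso V hV (S.const V c)).1 ⟨e x, x, hx, rfl⟩ = ModelAlg.const N q k c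

/-- Every point lies in a chart. -/
def IsSupermanifold : Prop :=
  ∀ x : M, ∃ (p k q : ℕ) (φ : S.Chart p k q), x ∈ φ.e.source

/-! ### The tangent sheaf -/

/-- The algebra of endomorphisms of the sheaf of `ℂ`-vector spaces `𝒪|_U`. -/
def sheafEndAlg (U : Opens M) : Subalgebra ℂ (∀ V : {V : Opens M // V ≤ U}, Module.End ℂ (S.O V.1)) where
  carrier := {D | ∀ (V W : {V : Opens M // V ≤ U}) (h : W.1 ≤ V.1) (f : S.O V.1),
    S.res h (D V f) = D W (S.res h f)}
  mul_mem' {D D'} hD hD' V W h f := by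
    simp [hD V W h, hD' V W h]
  add_mem' {D D'} hD hD' V W h f := by
    simp [hD V W h, hD' V W h]
  algebraMap_mem' r V W h f := by
    simp [Module.algebraMap_end_apply]

/-- Endomorphisms of the sheaf of `ℂ`-vector spaces `𝒪|_U`. -/
def SheafEnd (U : Opens M) : Type (max u v) := S.sheafEndAlg U

instance (U : Opens M) : Ring (S.SheafEnd U) := inferInstanceAs (Ring (S.sheafEndAlg U))

instance (U : Opens M) : Algebra ℂ (S.SheafEnd U) := inferInstanceAs (Algebra ℂ (S.sheafEndAlg U))

variable {S}

/-- The action of an endomorphism of `𝒪|_U` on the sections over `V ≤ U`. -/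
def SheafEnd.app {U : Opens M} (D : S.SheafEnd U) (V : Opens M) (h : V ≤ U) : Module.End ℂ (S.O V) :=
  D.1 ⟨V, h⟩

namespace SheafEnd

variable {U : Opens M}

lemma ext {D D' : S.SheafEnd U} (h : ∀ V hV f, D.app V hV f = D'.app V hV f) : D = D' :=
  Subtype.ext (funext fun V => LinearMap.ext fun f => h V.1 V.2 f)

lemma add_app (D D' : S.SheafEnd U) (V : Opens M) (h : V ≤ U) (f : S.O V) :
    (D + D').app V h f = D.app V h f + D'.app V h f := rfl

lemma sub_app (D D' : S.SheafEnd U) (V : Opens M) (h : V ≤ U) (f : S.O V) :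
    (D - D').app V h f = D.app V h f - D'.app V h f := rfl

lemma zero_app (V : Opens M) (h : V ≤ U) (f : S.O V) : (0 : S.SheafEnd U).app V h f = 0 := rfl

lemma mul_app (D D' : S.SheafEnd U) (V : Opens M) (h : V ≤ U) (f : S.O V) :
    (D * D').app V h f = D.app V h (D'.app V h f) := rfl

lemma zsmul_app (n : ℤ) (D : S.SheafEnd U) (V : Opens M) (h : V ≤ U) (f : S.O V) :
    (n • D).app V h f = n • D.app V h f := rfl

/-- Restriction of endomorphisms of `𝒪|_U`. -/
def restrict {V : Opens M} (h : V ≤ U) (D : S.SheafEnd U) : S.SheafEnd V :=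
  ⟨fun W => D.app W.1 (W.2.trans h),
    fun W W' hW f => D.2 ⟨W.1, W.2.trans h⟩ ⟨W'.1, W'.2.trans h⟩ hW f⟩

end SheafEnd

variable (S)

/-- Left multiplication by functions. -/
def lmul (U : Opens M) : S.O U →+* S.SheafEnd U where
  toFun f := ⟨fun V => LinearMap.mulLeft ℂ (S.res V.2 f), fun V W h g => by
    simp only [LinearMap.mulLeft_apply, map_mul]
    rw [res_res]⟩
  map_one' := SheafEnd.ext fun V h g => (congrArg (· * g) (map_one (S.res h))).trans (one_mul g)
  map_zero' := SheafEnd.ext fun V h g => (congrArg (· * g) (map_zero (S.res h))).trans (zero_mul g)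
  map_mul' f f' := SheafEnd.ext fun V h g =>
    (congrArg (· * g) (map_mul (S.res h) f f')).trans (mul_assoc _ _ g)
  map_add' f f' := SheafEnd.ext fun V h g =>
    (congrArg (· * g) (map_add (S.res h) f f')).trans (add_mul _ _ g)

/-- `𝒪(U)` acts on endomorphisms of `𝒪|_U` by left multiplication: `(f D)(g) = f · D(g)`. -/
instance (U : Opens M) : Module (S.O U) (S.SheafEnd U) := Module.compHom _ (S.lmul U)

/-- `D` is a derivation of `𝒪|_U` over the constants, homogeneous of parity `a`. -/
structure IsDer {U : Opens M} (a : ZMod 2) (D : S.SheafEnd U) : Prop where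
  parity : ∀ (V : Opens M) (h : V ≤ U) (f : S.O V),
    S.par V (D.app V h f) = sgn 1 a • D.app V h (S.par V f)
  leibniz : ∀ (V : Opens M) (h : V ≤ U) (c : ZMod 2) (f g : S.O V), S.IsHom c f →
    D.app V h (f * g) = D.app V h f * g + sgn a c • (f * D.app V h g)
  const : ∀ (V : Opens M) (h : V ≤ U) (c : Constants N), D.app V h (S.const V c) = 0

variable {S}

lemma smul_app {U : Opens M} (f : S.O U) (D : S.SheafEnd U) (V : Opens M) (h : V ≤ U) (g : S.O V) :
    (f • D).app V h g = S.res h f * D.app V h g := rfl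

lemma IsDer.zero {U : Opens M} (a : ZMod 2) : S.IsDer a (0 : S.SheafEnd U) :=
  ⟨fun V h f => by simp [SheafEnd.zero_app], fun V h c f g _ => by simp [SheafEnd.zero_app],
    fun V h c => rfl⟩

lemma IsDer.add {U : Opens M} {a : ZMod 2} {D D' : S.SheafEnd U} (h : S.IsDer a D)
    (h' : S.IsDer a D') : S.IsDer a (D + D') where
  parity V hV f := by simp only [SheafEnd.add_app, map_add, h.parity, h'.parity, smul_add]
  leibniz V hV c f g hf := by
    simp only [SheafEnd.add_app, h.leibniz V hV c f g hf, h'.leibniz V hV c f g hf, add_mul,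
      mul_add, smul_add]
    abel
  const V hV c := by simp only [SheafEnd.add_app, h.const, h'.const, add_zero]

lemma IsHom.res {U V : Opens M} {a : ZMod 2} {f : S.O U} (hf : S.IsHom a f) (h : V ≤ U) :
    S.IsHom a (S.res h f) := by
  rw [IsHom, ← S.res_par, hf.eq, map_zsmul]

lemma IsDer.isHom {U : Opens M} {a c : ZMod 2} {D : S.SheafEnd U} (h : S.IsDer a D)
    {V : Opens M} (hV : V ≤ U) {f : S.O V} (hf : S.IsHom c f) : S.IsHom (a + c) (D.app V hV f) := by
  rw [IsHom, h.parity, hf.eq, map_zsmul, smul_smul, sgn_one_add]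

lemma IsDer.smul {U : Opens M} {a b : ZMod 2} {f : S.O U} {D : S.SheafEnd U} (hf : S.IsHom b f)
    (h : S.IsDer a D) : S.IsDer (b + a) (f • D) where
  parity V hV g := by
    rw [smul_app, smul_app, map_mul, (hf.res hV).eq, h.parity, smul_mul_smul_comm, sgn_one_add]
  leibniz V hV c g g' hg := by
    rw [smul_app, smul_app, smul_app, h.leibniz V hV c g g' hg, mul_add, mul_assoc, mul_smul_comm,
      ← mul_assoc, ← mul_assoc, ← mul_assoc, S.supercomm V b c _ g (hf.res hV) hg,
      smul_mul_assoc, smul_smul, sgn_add_left, mul_comm (sgn b c)]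
  const V hV c := by rw [smul_app, h.const, mul_zero]

lemma IsDer.restrict {U V : Opens M} (h : V ≤ U) {a : ZMod 2} {D : S.SheafEnd U}
    (hD : S.IsDer a D) : S.IsDer a (D.restrict h) :=
  ⟨fun W hW => hD.parity W (hW.trans h), fun W hW => hD.leibniz W (hW.trans h),
    fun W hW => hD.const W (hW.trans h)⟩

variable (S)

/-- The homogeneous components of a function. -/
def homPart {U : Opens M} (a : ZMod 2) (f : S.O U) : S.O U :=
  (1 / 2 : ℂ) • (f + sgn 1 a • S.par U f)

lemma isHom_homPart {U : Opens M} (a : ZMod 2) (f : S.O U) : S.IsHom a (S.homPart a f) := by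
  rw [IsHom, homPart, map_smul, map_add, map_zsmul, par_par, smul_comm (sgn 1 a) (1 / 2 : ℂ),
    smul_add (sgn 1 a), smul_smul (sgn 1 a), sgn_mul_self, one_smul, add_comm]

lemma homPart_add {U : Opens M} (f : S.O U) : S.homPart 0 f + S.homPart 1 f = f := by
  rw [homPart, homPart, ← smul_add]
  have h0 : sgn 1 0 = 1 := by decide
  have h1 : sgn 1 1 = -1 := by decide
  rw [h0, h1]
  have : (f + (1 : ℤ) • S.par U f) + (f + (-1 : ℤ) • S.par U f) = (2 : ℂ) • f := by
    rw [two_smul]; simp only [one_smul, neg_smul]; abel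
  rw [this, smul_smul]
  norm_num

/-- The module of vector fields on `U`: sums of an even and an odd derivation of `𝒪|_U` over the
constants. -/
def vectorFields (U : Opens M) : Submodule (S.O U) (S.SheafEnd U) where
  carrier := {D | ∃ D₀ D₁, S.IsDer 0 D₀ ∧ S.IsDer 1 D₁ ∧ D = D₀ + D₁}
  add_mem' := by
    rintro _ _ ⟨D₀, D₁, h₀, h₁, rfl⟩ ⟨E₀, E₁, k₀, k₁, rfl⟩
    exact ⟨D₀ + E₀, D₁ + E₁, h₀.add k₀, h₁.add k₁, add_add_add_comm _ _ _ _⟩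
  zero_mem' := ⟨0, 0, IsDer.zero 0, IsDer.zero 1, (add_zero _).symm⟩
  smul_mem' := by
    rintro f _ ⟨D₀, D₁, h₀, h₁, rfl⟩
    have k₀₀ := h₀.smul (S.isHom_homPart 0 f)
    have k₁₁ := h₁.smul (S.isHom_homPart 1 f)
    have k₀₁ := h₁.smul (S.isHom_homPart 0 f)
    have k₁₀ := h₀.smul (S.isHom_homPart 1 f)
    rw [show (0 : ZMod 2) + 0 = 0 by decide] at k₀₀
    rw [show (1 : ZMod 2) + 1 = 0 by decide] at k₁₁
    rw [show (0 : ZMod 2) + 1 = 1 by decide] at k₀₁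
    rw [show (1 : ZMod 2) + 0 = 1 by decide] at k₁₀
    refine ⟨_, _, k₀₀.add k₁₁, k₀₁.add k₁₀, ?_⟩
    rw [smul_add, add_add_add_comm, add_comm (S.homPart 1 f • D₁), add_add_add_comm,
      ← add_smul, ← add_smul, S.homPart_add f]

/-- Sections over `U` of the tangent sheaf. -/
def T (U : Opens M) : Type (max u v) := S.vectorFields U

instance (U : Opens M) : AddCommGroup (S.T U) := inferInstanceAs (AddCommGroup (S.vectorFields U))

instance (U : Opens M) : Module (S.O U) (S.T U) := inferInstanceAs (Module (S.O U) (S.vectorFields U))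

variable {S}

/-- A vector field as an endomorphism of `𝒪|_U`. -/
def T.toEnd {U : Opens M} (X : S.T U) : S.SheafEnd U := X.1

/-- A vector field is homogeneous of parity `a`. -/
def T.IsHom {U : Opens M} (a : ZMod 2) (X : S.T U) : Prop := S.IsDer a X.toEnd

/-- The derivative `X f`. -/
def T.deriv {U : Opens M} (X : S.T U) (f : S.O U) : S.O U := X.toEnd.app U le_rfl f

/-- Restriction of vector fields. -/
def T.restrict {U V : Opens M} (h : V ≤ U) (X : S.T U) : S.T V :=
  ⟨X.toEnd.restrict h, by
    obtain ⟨_, D₀, D₁, h₀, h₁, rfl⟩ := X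
    exact ⟨_, _, h₀.restrict h, h₁.restrict h, rfl⟩⟩

/-- A homogeneous derivation as a vector field. -/
def T.ofDer {U : Opens M} {a : ZMod 2} (D : S.SheafEnd U) (h : S.IsDer a D) : S.T U :=
  ⟨D, by
    obtain rfl | rfl := zmod_two_cases a
    · exact ⟨D, 0, h, IsDer.zero 1, (add_zero _).symm⟩
    · exact ⟨0, D, IsDer.zero 0, h, (zero_add _).symm⟩⟩

variable (S) in
/-- The parity involution as an endomorphism of `𝒪|_U`. -/
def parEnd (U : Opens M) : S.SheafEnd U :=
  ⟨fun V => (S.par V.1).toLinearMap, fun _ _ h f => S.res_par h f⟩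

/-- The homogeneous components of an endomorphism of `𝒪|_U`. -/
def SheafEnd.homPart {U : Opens M} (a : ZMod 2) (D : S.SheafEnd U) : S.SheafEnd U :=
  (1 / 2 : ℂ) • (D + sgn 1 a • (S.parEnd U * D * S.parEnd U))

lemma IsDer.conj {U : Opens M} {a : ZMod 2} {D : S.SheafEnd U} (h : S.IsDer a D) :
    S.parEnd U * D * S.parEnd U = sgn 1 a • D := by
  refine SheafEnd.ext fun V hV f => ?_
  change S.par V (D.app V hV (S.par V f)) = sgn 1 a • D.app V hV f
  rw [h.parity, par_par]

lemma homPart_zero {U : Opens M} {D₀ D₁ : S.SheafEnd U} (h₀ : S.IsDer 0 D₀) (h₁ : S.IsDer 1 D₁) :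
    (D₀ + D₁).homPart 0 = D₀ := by
  have e0 : sgn 1 0 = 1 := by decide
  have e1 : sgn 1 1 = -1 := by decide
  rw [SheafEnd.homPart, mul_add, add_mul, h₀.conj, h₁.conj, e0, e1]
  have : D₀ + D₁ + (1 : ℤ) • ((1 : ℤ) • D₀ + (-1 : ℤ) • D₁) = (2 : ℂ) • D₀ := by
    rw [two_smul]; simp only [one_smul, neg_smul]; abel
  rw [this, smul_smul]
  norm_num

lemma homPart_one {U : Opens M} {D₀ D₁ : S.SheafEnd U} (h₀ : S.IsDer 0 D₀) (h₁ : S.IsDer 1 D₁) :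
    (D₀ + D₁).homPart 1 = D₁ := by
  have e0 : sgn 1 0 = 1 := by decide
  have e1 : sgn 1 1 = -1 := by decide
  rw [SheafEnd.homPart, mul_add, add_mul, h₀.conj, h₁.conj, e0, e1]
  have : D₀ + D₁ + (-1 : ℤ) • ((1 : ℤ) • D₀ + (-1 : ℤ) • D₁) = (2 : ℂ) • D₁ := by
    rw [two_smul]; simp only [one_smul, neg_smul]; abel
  rw [this, smul_smul]
  norm_num

lemma isDer_homPart {U : Opens M} (a : ZMod 2) (X : S.T U) : S.IsDer a (X.toEnd.homPart a) := by
  obtain ⟨_, D₀, D₁, h₀, h₁, rfl⟩ := X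
  obtain rfl | rfl := zmod_two_cases a
  · exact (homPart_zero h₀ h₁).symm ▸ h₀
  · exact (homPart_one h₀ h₁).symm ▸ h₁

/-- The supercommutator `D D' - (-1)^{ab} D' D` of endomorphisms of parities `a` and `b`. -/
def scomm {U : Opens M} (a b : ZMod 2) (D D' : S.SheafEnd U) : S.SheafEnd U :=
  D * D' - sgn a b • (D' * D)

lemma scomm_app {U : Opens M} (a b : ZMod 2) (D D' : S.SheafEnd U) (V : Opens M) (h : V ≤ U)
    (f : S.O V) : (scomm a b D D').app V h f =
      D.app V h (D'.app V h f) - sgn a b • D'.app V h (D.app V h f) := rfl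

lemma IsDer.scomm {U : Opens M} {a b : ZMod 2} {D D' : S.SheafEnd U} (h : S.IsDer a D)
    (h' : S.IsDer b D') : S.IsDer (a + b) (scomm a b D D') where
  parity V hV f := by
    simp only [scomm_app, map_sub, map_zsmul, h.parity, h'.parity, sgn_one_add, smul_sub, smul_smul]
    congr 2; ring
  leibniz V hV c f g hf := by
    simp only [scomm_app]
    rw [h'.leibniz V hV c f g hf, h.leibniz V hV c f g hf, map_add, map_add, map_zsmul, map_zsmul,
      h.leibniz V hV _ _ g (h'.isHom hV hf), h.leibniz V hV c f _ hf,
      h'.leibniz V hV _ _ g (h.isHom hV hf), h'.leibniz V hV c f _ hf]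
    simp only [sub_mul, mul_sub, smul_add, smul_sub, smul_mul_assoc, mul_smul_comm, smul_smul]
    have e1 : sgn a (b + c) = sgn a b * sgn a c := sgn_add_right a b c
    have e2 : sgn b (a + c) = sgn a b * sgn b c := by rw [sgn_add_right, sgn_comm b a]
    have e3 : sgn (a + b) c = sgn a c * sgn b c := sgn_add_left a b c
    have e4 : sgn a b * (sgn a b * sgn b c) = sgn b c := by
      rw [← mul_assoc, sgn_mul_self, one_mul]
    rw [e1, e2, e3, e4, mul_comm (sgn b c) (sgn a c),
      show sgn a c * sgn b c * sgn a b = sgn a b * (sgn a c * sgn b c) by ring]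
    abel
  const V hV c := by simp only [scomm_app, h.const, h'.const, map_zero, smul_zero, sub_zero]

/-- The Lie superbracket of vector fields: the biadditive extension of
`[X, Y] = X Y - (-1)^{ab} Y X` for homogeneous `X`, `Y` of parities `a`, `b`. -/
def bracket {U : Opens M} (X Y : S.T U) : S.T U :=
  ∑ a : ZMod 2, ∑ b : ZMod 2, T.ofDer (scomm a b (X.toEnd.homPart a) (Y.toEnd.homPart b))
    ((isDer_homPart a X).scomm (isDer_homPart b Y))

/-! ### Multiplications, Higgs fields, connections -/

variable (S)

/-- An even `𝒪`-bilinear multiplication on the tangent sheaf. -/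
structure TangentMul where
  mul : ∀ U : Opens M, S.T U → S.T U → S.T U
  add_mul : ∀ (U : Opens M) (X X' Y : S.T U), mul U (X + X') Y = mul U X Y + mul U X' Y
  mul_add : ∀ (U : Opens M) (X Y Y' : S.T U), mul U X (Y + Y') = mul U X Y + mul U X Y'
  smul_mul : ∀ (U : Opens M) (f : S.O U) (X Y : S.T U), mul U (f • X) Y = f • mul U X Y
  mul_smul : ∀ (U : Opens M) (a c : ZMod 2) (X : S.T U) (f : S.O U) (Y : S.T U),
    X.IsHom a → S.IsHom c f → mul U X (f • Y) = sgn a c • (f • mul U X Y)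
  mul_hom : ∀ (U : Opens M) (a b : ZMod 2) (X Y : S.T U), X.IsHom a → Y.IsHom b →
    (mul U X Y).IsHom (a + b)
  mul_res : ∀ (U V : Opens M) (h : V ≤ U) (X Y : S.T U),
    (mul U X Y).restrict h = mul V (X.restrict h) (Y.restrict h)

/-- An odd global section `A` of `Ω¹ ⊗ End(T)`, where `df` has parity `1 + |f|`, given through the
corresponding even `𝒪`-linear map `X ↦ i_X(A)` from `T` to `End(T)`, `i_X(df ⊗ G) = Xf · G`:
`ins U X Y` is `i_X(A)(Y)`. (`T` is locally free of finite rank, with dual `Ω¹`.) -/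
structure HiggsField where
  ins : ∀ U : Opens M, S.T U → S.T U → S.T U
  ins_add_left : ∀ (U : Opens M) (X X' Y : S.T U), ins U (X + X') Y = ins U X Y + ins U X' Y
  ins_smul_left : ∀ (U : Opens M) (f : S.O U) (X Y : S.T U), ins U (f • X) Y = f • ins U X Y
  ins_add_right : ∀ (U : Opens M) (X Y Y' : S.T U), ins U X (Y + Y') = ins U X Y + ins U X Y'
  ins_smul_right : ∀ (U : Opens M) (a c : ZMod 2) (X : S.T U) (f : S.O U) (Y : S.T U),
    X.IsHom a → S.IsHom c f → ins U X (f • Y) = sgn a c • (f • ins U X Y)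
  ins_hom : ∀ (U : Opens M) (a b : ZMod 2) (X Y : S.T U), X.IsHom a → Y.IsHom b →
    (ins U X Y).IsHom (a + b)
  ins_res : ∀ (U V : Opens M) (h : V ≤ U) (X Y : S.T U),
    (ins U X Y).restrict h = ins V (X.restrict h) (Y.restrict h)

/-- A connection on the tangent sheaf, given through its covariant derivatives
`cov U X Y = ∇_X Y`. -/
structure Connection where
  cov : ∀ U : Opens M, S.T U → S.T U → S.T U
  cov_add_left : ∀ (U : Opens M) (X X' Y : S.T U), cov U (X + X') Y = cov U X Y + cov U X' Y
  cov_smul_left : ∀ (U : Opens M) (f : S.O U) (X Y : S.T U), cov U (f • X) Y = f • cov U X Y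
  cov_add_right : ∀ (U : Opens M) (X Y Y' : S.T U), cov U X (Y + Y') = cov U X Y + cov U X Y'
  cov_leibniz : ∀ (U : Opens M) (a c : ZMod 2) (X : S.T U) (f : S.O U) (Y : S.T U),
    X.IsHom a → S.IsHom c f → cov U X (f • Y) = X.deriv f • Y + sgn a c • (f • cov U X Y)
  cov_hom : ∀ (U : Opens M) (a b : ZMod 2) (X Y : S.T U), X.IsHom a → Y.IsHom b →
    (cov U X Y).IsHom (a + b)
  cov_res : ∀ (U V : Opens M) (h : V ≤ U) (X Y : S.T U),
    (cov U X Y).restrict h = cov V (X.restrict h) (Y.restrict h)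

variable {S}

/-- The multiplication `X ∘ Y = i_X(A)(Y)` defined by `A`. -/
def HiggsField.circ (A : S.HiggsField) : S.TangentMul where
  mul := A.ins
  add_mul := A.ins_add_left
  mul_add := A.ins_add_right
  smul_mul := A.ins_smul_left
  mul_smul := A.ins_smul_right
  mul_hom := A.ins_hom
  mul_res := A.ins_res

lemma isHom_const {c : Constants N} (hc : IsEvenConstant c) (U : Opens M) :
    S.IsHom 0 (S.const U c) := by
  have h : S.par U (S.const U c) = S.const U (CliffordAlgebra.involute c) := S.const_parity U c
  rw [IsHom, h, hc, show sgn 1 0 = 1 by decide, one_smul]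

lemma const_comm {c : Constants N} (hc : IsEvenConstant c) {U : Opens M} (f : S.O U) :
    S.const U c * f = f * S.const U c := by
  have key : ∀ (b : ZMod 2) (g : S.O U), S.IsHom b g → S.const U c * g = g * S.const U c := by
    intro b g hg
    have := S.supercomm U 0 b _ g (isHom_const hc U) hg
    rwa [sgn_zero_left, one_smul] at this
  rw [← S.homPart_add f, _root_.mul_add, _root_.add_mul, key 0 _ (S.isHom_homPart 0 f),
    key 1 _ (S.isHom_homPart 1 f)]

lemma T.IsHom.add {U : Opens M} {a : ZMod 2} {X Y : S.T U} (hX : X.IsHom a) (hY : Y.IsHom a) :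
    (X + Y).IsHom a := IsDer.add hX hY

lemma T.IsHom.smul {U : Opens M} {a c : ZMod 2} {f : S.O U} {X : S.T U} (hf : S.IsHom c f)
    (hX : X.IsHom a) : (f • X).IsHom (c + a) := IsDer.smul hf hX

lemma T.restrict_add {U V : Opens M} (h : V ≤ U) (X Y : S.T U) :
    (X + Y).restrict h = X.restrict h + Y.restrict h := rfl

lemma T.restrict_smul {U V : Opens M} (h : V ≤ U) (f : S.O U) (X : S.T U) :
    (f • X).restrict h = S.res h f • X.restrict h := by
  refine Subtype.ext (SheafEnd.ext fun W hW g => ?_)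
  change S.res (hW.trans h) f * _ = S.res hW (S.res h f) * _
  rw [res_res]
  rfl

/-- The pencil `∇_λ = ∇ + λ A`, for `λ` an even constant. -/
def Connection.pencil (nabla : S.Connection) (A : S.HiggsField) (c : Constants N)
    (hc : IsEvenConstant c) : S.Connection where
  cov U X Y := nabla.cov U X Y + S.const U c • A.ins U X Y
  cov_add_left U X X' Y := by
    rw [nabla.cov_add_left, A.ins_add_left, smul_add, add_add_add_comm]
  cov_smul_left U f X Y := by
    rw [nabla.cov_smul_left, A.ins_smul_left, smul_add, smul_smul, smul_smul, const_comm hc]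
  cov_add_right U X Y Y' := by
    rw [nabla.cov_add_right, A.ins_add_right, smul_add, add_add_add_comm]
  cov_leibniz U a b X f Y hX hf := by
    rw [nabla.cov_leibniz U a b X f Y hX hf, A.ins_smul_right U a b X f Y hX hf, smul_add, smul_add,
      smul_comm (S.const U c) (sgn a b), smul_smul, smul_smul, const_comm hc, add_assoc]
  cov_hom U a b X Y hX hY := by
    have h := T.IsHom.smul (isHom_const hc U) (A.ins_hom U a b X Y hX hY)
    rw [zero_add] at h
    exact (nabla.cov_hom U a b X Y hX hY).add h
  cov_res U V h X Y := by
    rw [T.restrict_add, T.restrict_smul, nabla.cov_res, A.ins_res]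
    exact congrArg (fun t => _ + t • _) (S.const_res h c)

/-- Vanishing torsion: `∇_X Y - (-1)^{XY} ∇_Y X = [X, Y]`. -/
def Connection.IsTorsionless (nabla : S.Connection) : Prop :=
  ∀ (U : Opens M) (a b : ZMod 2) (X Y : S.T U), X.IsHom a → Y.IsHom b →
    nabla.cov U X Y - sgn a b • nabla.cov U Y X = bracket X Y

/-- Vanishing curvature: `∇_X ∇_Y Z - (-1)^{XY} ∇_Y ∇_X Z = ∇_{[X, Y]} Z`. -/
def Connection.IsFlat (nabla : S.Connection) : Prop :=
  ∀ (U : Opens M) (a b : ZMod 2) (X Y Z : S.T U), X.IsHom a → Y.IsHom b →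
    nabla.cov U X (nabla.cov U Y Z) - sgn a b • nabla.cov U Y (nabla.cov U X Z) =
      nabla.cov U (bracket X Y) Z

/-- `X` is a flat vector field on `U`: `∇ X = 0`. -/
def Connection.IsFlatField (nabla : S.Connection) {U : Opens M} (X : S.T U) : Prop :=
  ∀ (V : Opens M) (h : V ≤ U) (Z : S.T V), nabla.cov V Z (X.restrict h) = 0

/-! ### F-manifolds with compatible flat structure -/

/-- Supercommutativity of a multiplication. -/
def TangentMul.IsSupercommutative (m : S.TangentMul) : Prop :=
  ∀ (U : Opens M) (a b : ZMod 2) (X Y : S.T U), X.IsHom a → Y.IsHom b →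
    m.mul U X Y = sgn a b • m.mul U Y X

/-- Associativity of a multiplication. -/
def TangentMul.IsAssociative (m : S.TangentMul) : Prop :=
  ∀ (U : Opens M) (X Y Z : S.T U), m.mul U (m.mul U X Y) Z = m.mul U X (m.mul U Y Z)

/-- `P_X(Z,W) = [X, Z ∘ W] - [X, Z] ∘ W - (-1)^{XZ} Z ∘ [X, W]`, for `X`, `Z` of parities
`a`, `c`. -/
def TangentMul.P (m : S.TangentMul) {U : Opens M} (a c : ZMod 2) (X Z W : S.T U) : S.T U :=
  bracket X (m.mul U Z W) - m.mul U (bracket X Z) W - sgn a c • m.mul U Z (bracket X W)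

/-- The multiplication defines an F-manifold: it is supercommutative, associative, and
`P_{X ∘ Y}(Z,W) = X ∘ P_Y(Z,W) + (-1)^{XY} Y ∘ P_X(Z,W)`. -/
structure TangentMul.IsFManifold (m : S.TangentMul) : Prop where
  supercomm : m.IsSupercommutative
  assoc : m.IsAssociative
  hertlingManin : ∀ (U : Opens M) (a b c d : ZMod 2) (X Y Z W : S.T U),
    X.IsHom a → Y.IsHom b → Z.IsHom c → W.IsHom d →
      m.P (a + b) c (m.mul U X Y) Z W =
        m.mul U X (m.P b c Y Z W) + sgn a b • m.mul U Y (m.P a c X Z W)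

/-- Compatibility with the flat structure of `∇`: near every point there is a local vector potential
`C`, with `X ∘ Y = [X, [Y, C]]` for all local flat vector fields `X`, `Y`. -/
def TangentMul.IsCompatible (m : S.TangentMul) (nabla : S.Connection) : Prop :=
  ∀ x : M, ∃ U : Opens M, x ∈ U ∧ ∃ C : S.T U, ∀ (V : Opens M) (h : V ≤ U) (X Y : S.T V),
    nabla.IsFlatField X → nabla.IsFlatField Y →
      m.mul V X Y = bracket X (bracket Y (C.restrict h))

/-- `(M, ∘, ∇)` is an F-manifold with compatible flat structure: `∘` defines an F-manifold, `∇` is a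
torsionless flat connection (that is, an affine flat structure), and the two are compatible. -/
structure IsFManifoldWithFlatStructure (m : S.TangentMul) (nabla : S.Connection) : Prop where
  isFManifold : m.IsFManifold
  torsionless : nabla.IsTorsionless
  flat : nabla.IsFlat
  compatible : m.IsCompatible nabla

end SuperSpace
end SuperGeom

end

/-! The two sides are compared through a third condition on `∇` and `∘`: `∇` is torsionless and
flat, `∘` is supercommutative and associative, and the covariant derivative `(∇_X ∘)(Y, Z)` is
supersymmetric in `X` and `Y`. The failure of this symmetry is `TangentMul.defect`.

The pencil is easy to relate to it (`forall_pencil_iff`). The torsion of `∇ + λA` is that of `∇`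
plus `λ` times the supercommutator of `∘`. If `∇` is flat and torsionless, the curvature is `λ D +
λ² Q`, where `D` is the defect and `Q` is `X ∘ (Y ∘ Z) - (-1)^{XY} Y ∘ (X ∘ Z)`
(`pencil_curvature`). The values `λ = 0, 1, -1` separate the coefficients, and for a
supercommutative multiplication `Q = 0` is associativity.

For F-manifolds (`isFManifoldWithFlatStructure_iff`) two things are needed. First, the
Hertling–Manin identity is a consequence of the third condition: differentiating associativity in
two ways and using symmetry gives `covMul_mul`, and torsion-freeness turns covariant derivatives
into brackets (`hertlingManin_of_symm`). Secondly, symmetry is equivalent to the existence of local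
potentials. On flat `X`, `Y` the bracket `[X, [Y, C]]` is `∇_X ∇_Y C`. Given `C`, the defect on flat
fields is therefore the curvature applied to `∇_Z C`, and the defect is tensorial, so a flat frame
suffices (`isSymm_of_isCompatible`). Conversely, symmetry makes the form `X ↦ X ∘ e` closed for each
member `e` of a flat frame, so it has a primitive `b_e`; the form sending each `e` to `b_e` is
closed by supercommutativity, and its primitive is `C` (`isCompatible_of_isSymm`).

Both directions rest on the Poincaré lemma for a flat connection on a supermanifold with formal
directions (`Chart.exists_primitive`), which also supplies flat frames (`Chart.exists_flatFrame`).
In the convergent even directions it is an analytic Frobenius theorem, proved by solving a Volterra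
equation along rays (`exists_solution_of_integrable`). In a formal direction an explicit alternating
exponential series does the integration, and in an odd direction a single correction term does.
Uniqueness and convergence in these directions come from the filtration by powers of the ideal
generated by the formal coordinates, the odd coordinates and the odd constants, which is separated
and complete. Together with Hadamard's lemma it also shows that vector fields are determined by
their values on coordinates.

Part (ii) is part (i) with another base connection: the pencil through `∇_λ` is the pencil through
`∇₀` with shifted parameter (`pencil_pencil`). -/

noncomputable section

namespace SuperGeom

/-! ### Integrable linear systems -/

section LinearSystems

variable {X E F G H : Type*} [NormedAddCommGroup X] [NormedSpace ℂ X]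
  [NormedAddCommGroup E] [NormedSpace ℂ E] [NormedAddCommGroup F] [NormedSpace ℂ F]
  [NormedAddCommGroup G] [NormedSpace ℂ G] [NormedAddCommGroup H] [NormedSpace ℂ H]

/-- The map `r ↦ (τ ↦ τ ^ n • r)` into continuous functions on the unit interval. -/
def powCLM (F : Type*) [NormedAddCommGroup F] [NormedSpace ℂ F] (n : ℕ) :
    F →L[ℂ] C(unitInterval, F) :=
  LinearMap.mkContinuous
    { toFun := fun r => ⟨fun τ => ((τ : ℝ) : ℂ) ^ n • r, by fun_prop⟩
      map_add' := fun r s => by ext τ; simp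
      map_smul' := fun c r => by ext τ; simp [smul_comm c] } 1 fun r => by
    rw [one_mul, ContinuousMap.norm_le _ (norm_nonneg r)]
    intro τ
    simp only [LinearMap.coe_mk, AddHom.coe_mk, ContinuousMap.coe_mk, norm_smul, norm_pow,
      Complex.norm_real, Real.norm_eq_abs, abs_of_nonneg τ.2.1]
    exact mul_le_of_le_one_left (norm_nonneg r) (pow_le_one₀ τ.2.1 τ.2.2)

lemma powCLM_apply (n : ℕ) (r : F) (τ : unitInterval) :
    powCLM F n r τ = ((τ : ℝ) : ℂ) ^ n • r := rfl

lemma norm_powCLM_le (n : ℕ) : ‖powCLM F n‖ ≤ 1 :=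
  LinearMap.mkContinuous_norm_le _ zero_le_one _

/-- Balls about the origin contain the segment from the origin to each of their points. Conditions
that hold near `0` can thus be used along whole rays. -/
lemma eventually_forall_unitInterval {Q : X → Prop} (h : ∀ᶠ x in 𝓝 (0 : X), Q x) :
    ∀ᶠ x in 𝓝 (0 : X), ∀ τ : unitInterval, Q (((τ : ℝ) : ℂ) • x) := by
  obtain ⟨ε, hε, hQ⟩ := Metric.eventually_nhds_iff_ball.1 h
  filter_upwards [Metric.ball_mem_nhds (0 : X) hε] with x hx τ
  apply hQ
  rw [mem_ball_zero_iff] at hx ⊢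
  rw [norm_smul, Complex.norm_real, Real.norm_eq_abs, abs_of_nonneg τ.2.1]
  exact (mul_le_of_le_one_left (norm_nonneg x) τ.2.2).trans_lt hx

/-- Restricting an analytic function to the segments from the origin gives an analytic function with
values in the continuous functions on the unit interval. -/
lemma exists_analytic_radial [CompleteSpace F] {f : X → F} (hf : AnalyticAt ℂ f 0) :
    ∃ g : X → C(unitInterval, F), AnalyticAt ℂ g 0 ∧
      ∀ᶠ x in 𝓝 (0 : X), ∀ τ : unitInterval, g x τ = f (((τ : ℝ) : ℂ) • x) := by
  obtain ⟨p, r, hp⟩ := hf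
  -- On the ray through `x` the term of degree `n` is `τ ^ n • p n (x, …, x)`. Since `τ ≤ 1`,
  -- regarding it as a function of `τ` does not increase its norm, and the radius does not shrink.
  let q : FormalMultilinearSeries ℂ X C(unitInterval, F) := fun n =>
    (powCLM F n).compContinuousMultilinearMap (p n)
  have hq : p.radius ≤ q.radius := FormalMultilinearSeries.radius_le_of_le fun n =>
    ((powCLM F n).norm_compContinuousMultilinearMap_le (p n)).trans
      (mul_le_of_le_one_left (norm_nonneg _) (norm_powCLM_le n))
  have hr : r ≤ q.radius := hp.r_le.trans hq
  have hqs := q.hasFPowerSeriesOnBall (hp.r_pos.trans_le hr)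
  refine ⟨q.sum, hqs.analyticAt, ?_⟩
  filter_upwards [Metric.eball_mem_nhds (0 : X) hp.r_pos] with x hx τ
  have h1 := hqs.hasSum (Metric.eball_subset_eball hr hx)
  rw [zero_add] at h1
  have h2 := (ContinuousMap.evalCLM ℂ τ).hasSum h1
  have hx' : ((τ : ℝ) : ℂ) • x ∈ Metric.eball (0 : X) r := by
    rw [Metric.mem_eball, edist_zero_right] at hx ⊢
    refine lt_of_le_of_lt ?_ hx
    rw [← ofReal_norm, ← ofReal_norm]
    apply ENNReal.ofReal_le_ofReal
    rw [norm_smul, Complex.norm_real, Real.norm_eq_abs, abs_of_nonneg τ.2.1]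
    exact mul_le_of_le_one_left (norm_nonneg x) τ.2.2
  have h3 := hp.hasSum hx'
  rw [zero_add] at h3
  refine h2.unique ?_
  convert h3 using 2 with n
  change ((τ : ℝ) : ℂ) ^ n • p n (fun _ => x) = _
  rw [show (fun _ : Fin n => ((τ : ℝ) : ℂ) • x) = fun i : Fin n =>
    (fun _ : Fin n => ((τ : ℝ) : ℂ)) i • (fun _ : Fin n => x) i from rfl,
    ContinuousMultilinearMap.map_smul_univ]
  simp

/-- A continuous bilinear map applied pointwise to continuous functions on the unit interval. -/
def pointwiseCLM (B : F →L[ℂ] G →L[ℂ] H) :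
    C(unitInterval, F) →L[ℂ] C(unitInterval, G) →L[ℂ] C(unitInterval, H) :=
  LinearMap.mkContinuous₂
    (LinearMap.mk₂ ℂ (fun f g => ⟨fun τ => B (f τ) (g τ), by fun_prop⟩)
      (fun f f' g => by ext τ; simp) (fun c f g => by ext τ; simp)
      (fun f g g' => by ext τ; simp) (fun c f g => by ext τ; simp)) ‖B‖ fun f g => by
    rw [ContinuousMap.norm_le _ (by positivity)]
    intro τ
    refine (B.le_opNorm₂ _ _).trans ?_
    gcongr
    · exact f.norm_coe_le_norm τ
    · exact g.norm_coe_le_norm τ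

/-- The value of a function on the unit interval, extended by constants to the line. -/
def lineExt (f : C(unitInterval, F)) (s : ℝ) : F := f (Set.projIcc 0 1 zero_le_one s)

@[fun_prop]
lemma continuous_lineExt (f : C(unitInterval, F)) : Continuous (lineExt f) :=
  f.continuous.comp continuous_projIcc

lemma lineExt_coe (f : C(unitInterval, F)) (τ : unitInterval) : lineExt f τ = f τ := by
  simp [lineExt]

lemma hasDerivAt_integral_lineExt [CompleteSpace F] (f : C(unitInterval, F)) (s : ℝ) :
    HasDerivAt (fun t => ∫ r in (0 : ℝ)..t, lineExt f r) (lineExt f s) s :=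
  ((continuous_lineExt f).integral_hasStrictDerivAt 0 s).hasDerivAt

/-- The Volterra operator `(V f)(τ) = ∫₀^τ f`. -/
def volterra (F : Type*) [NormedAddCommGroup F] [NormedSpace ℂ F] [CompleteSpace F] :
    C(unitInterval, F) →L[ℂ] C(unitInterval, F) :=
  LinearMap.mkContinuous
    { toFun := fun f => ⟨fun τ => ∫ r in (0 : ℝ)..(τ : ℝ), lineExt f r,
        (continuous_iff_continuousAt.2 fun s =>
          (hasDerivAt_integral_lineExt f s).continuousAt).comp continuous_subtype_val⟩
      map_add' := fun f g => by
        ext τ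
        exact intervalIntegral.integral_add ((continuous_lineExt f).intervalIntegrable _ _)
          ((continuous_lineExt g).intervalIntegrable _ _)
      map_smul' := fun c f => by
        ext τ
        exact intervalIntegral.integral_smul c _ } 1 fun f => by
    rw [one_mul, ContinuousMap.norm_le _ (norm_nonneg f)]
    intro τ
    have := intervalIntegral.norm_integral_le_of_norm_le_const (a := (0 : ℝ)) (b := τ)
      (C := ‖f‖) (f := lineExt f) fun s _ => f.norm_coe_le_norm _
    refine this.trans ?_
    rw [sub_zero, abs_of_nonneg τ.2.1]
    exact mul_le_of_le_one_right (norm_nonneg f) τ.2.2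

lemma volterra_apply [CompleteSpace F] (f : C(unitInterval, F)) (τ : unitInterval) :
    volterra F f τ = ∫ r in (0 : ℝ)..(τ : ℝ), lineExt f r := rfl

/-- A function vanishing at `0` is the Volterra transform of its derivative. -/
lemma eq_volterra [CompleteSpace F] {φ : ℝ → F} {f ψ : C(unitInterval, F)}
    (hf : ∀ τ : unitInterval, f τ = φ τ) (h0 : φ 0 = 0)
    (hφ : ∀ τ : unitInterval, HasDerivAt φ (ψ τ) τ) : f = volterra F ψ := by
  ext τ
  rw [volterra_apply, hf, ← sub_zero (φ τ), ← h0]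
  refine (intervalIntegral.integral_eq_sub_of_hasDerivAt ?_
    ((continuous_lineExt ψ).intervalIntegrable _ _)).symm
  intro s hs
  rw [Set.uIcc_of_le τ.2.1] at hs
  have := hφ ⟨s, hs.1, hs.2.trans τ.2.2⟩
  rwa [← lineExt_coe ψ] at this

lemma analyticAt_bilin (B : F →L[ℂ] G →L[ℂ] H) {f : X → F} {g : X → G} {x : X}
    (hf : AnalyticAt ℂ f x) (hg : AnalyticAt ℂ g x) : AnalyticAt ℂ (fun y => B (f y) (g y)) x :=
  AnalyticAt.comp (g := fun z : F × G => B z.1 z.2) (f := fun y => (f y, g y))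
    (B.analyticAt_bilinear (f x, g x)) (hf.prod hg)

lemma analyticAt_clm (L : F →L[ℂ] G) {f : X → F} {x : X} (hf : AnalyticAt ℂ f x) :
    AnalyticAt ℂ (fun y => L (f y)) x :=
  (L.analyticAt (f x)).comp hf

lemma hasFDerivAt_bilin (B : F →L[ℂ] G →L[ℂ] H) {f : X → F} {g : X → G} {x : X}
    (hf : AnalyticAt ℂ f x) (hg : AnalyticAt ℂ g x) (v : X) :
    fderiv ℂ (fun y => B (f y) (g y)) x v =
      B (f x) (fderiv ℂ g x v) + B (fderiv ℂ f x v) (g x) := by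
  rw [(B.hasFDerivAt_of_bilinear hf.differentiableAt.hasFDerivAt
    hg.differentiableAt.hasFDerivAt).fderiv]
  rfl

/-- The derivative along a segment from the origin. -/
lemma hasDerivAt_radial {f : X → F} (x : X) {s : ℝ} (hf : AnalyticAt ℂ f ((s : ℂ) • x)) :
    HasDerivAt (fun t : ℝ => f ((t : ℂ) • x)) (fderiv ℂ f ((s : ℂ) • x) x) s := by
  have h1 : HasDerivAt (fun t : ℝ => (t : ℂ) • x) x s := by
    have := (Complex.ofRealCLM.hasDerivAt (x := s)).smul_const x
    simpa using this
  exact (hf.differentiableAt.hasFDerivAt.restrictScalars ℝ).comp_hasDerivAt s h1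

/-- The derivative in the base point of the restriction to segments from the origin. -/
lemma fderiv_radial_apply [CompleteSpace F] {f : X → F} {g : X → C(unitInterval, F)} {x : X}
    (hg : AnalyticAt ℂ g x) (τ : unitInterval) (hf : AnalyticAt ℂ f (((τ : ℝ) : ℂ) • x))
    (h : ∀ᶠ y in 𝓝 x, g y τ = f (((τ : ℝ) : ℂ) • y)) (v : X) :
    fderiv ℂ g x v τ = ((τ : ℝ) : ℂ) • fderiv ℂ f (((τ : ℝ) : ℂ) • x) v := by
  have h1 : HasFDerivAt (fun y => g y τ)
      ((ContinuousMap.evalCLM ℂ τ).comp (fderiv ℂ g x)) x :=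
    (ContinuousMap.evalCLM ℂ τ : C(unitInterval, F) →L[ℂ] F).hasFDerivAt.comp x
      hg.differentiableAt.hasFDerivAt
  have h2 : HasFDerivAt (fun y => f (((τ : ℝ) : ℂ) • y))
      ((fderiv ℂ f (((τ : ℝ) : ℂ) • x)).comp (((τ : ℝ) : ℂ) • ContinuousLinearMap.id ℂ X)) x :=
    hf.differentiableAt.hasFDerivAt.comp x ((hasFDerivAt_id x).const_smul _)
  have h3 := h1.unique (h2.congr_of_eventuallyEq h)
  have := congrArg (fun L => L v) h3
  simpa using this

/-- Analytic dependence on the parameter of the solution of `u + V (g · u) = b`, for small `g`. -/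
lemma exists_analytic_solution [CompleteSpace F] [CompleteSpace G] (V : F →L[ℂ] F)
    (μ : G →L[ℂ] F →L[ℂ] F) {g : X → G} {b : X → F} (hg : AnalyticAt ℂ g 0) (hb : AnalyticAt ℂ b 0) (hg0 : g 0 = 0) :
    ∃ u : X → F, AnalyticAt ℂ u 0 ∧ u 0 = b 0 ∧
      (∀ᶠ x in 𝓝 (0 : X), u x + V (μ (g x) (u x)) = b x) ∧
      (∀ᶠ x in 𝓝 (0 : X), ∀ v, fderiv ℂ u x v +
        V (μ (g x) (fderiv ℂ u x v) + μ (fderiv ℂ g x v) (u x)) = fderiv ℂ b x v) ∧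
      (∀ᶠ x in 𝓝 (0 : X), ∀ w, w + V (μ (g x) w) = 0 → w = 0) := by
  let L : G →L[ℂ] F →L[ℂ] F := (ContinuousLinearMap.compL ℂ F F F V).comp μ
  have hL : ∀ a w, L a w = V (μ a w) := fun _ _ => rfl
  -- The equation is `K x (u x) = b x`. As `g 0 = 0`, `K 0` is the identity, so `K x` is invertible
  -- for small `x` and its inverse depends analytically on `x`.
  let K : X → F →L[ℂ] F := fun x => 1 + L (g x)
  have hK : AnalyticAt ℂ K 0 := analyticAt_const.add (analyticAt_clm L hg)
  have hK0 : K 0 = 1 := by simp [K, hg0]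
  have hinv : AnalyticAt ℂ (fun x => Ring.inverse (K x)) 0 := by
    refine AnalyticAt.comp (g := Ring.inverse) (f := K) ?_ hK
    rw [hK0]
    exact analyticAt_inverse (𝕜 := ℂ) (1 : (F →L[ℂ] F)ˣ)
  have hu : AnalyticAt ℂ (fun x => Ring.inverse (K x) (b x)) 0 :=
    analyticAt_bilin (ContinuousLinearMap.id ℂ _) hinv hb
  have hunit : ∀ᶠ x in 𝓝 (0 : X), IsUnit (K x) := by
    refine hK.continuousAt.eventually (Units.isOpen.mem_nhds ?_)
    change IsUnit (K 0)
    simp [hK0]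
  have hsol : ∀ᶠ x in 𝓝 (0 : X), Ring.inverse (K x) (b x) +
      V (μ (g x) (Ring.inverse (K x) (b x))) = b x := by
    filter_upwards [hunit] with x hx
    exact congrArg (fun L => L (b x)) (Ring.mul_inverse_cancel _ hx)
  refine ⟨_, hu, by simp [hK0], hsol, ?_, ?_⟩
  · filter_upwards [hu.eventually_analyticAt, hg.eventually_analyticAt, hb.eventually_analyticAt,
      hsol.eventually_nhds] with x hux hgx hbx hsolx v
    have d1 := hasFDerivAt_bilin L hgx hux v
    have d2 : fderiv ℂ (fun x => Ring.inverse (K x) (b x) + L (g x) (Ring.inverse (K x) (b x))) x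
        = fderiv ℂ b x := Filter.EventuallyEq.fderiv_eq hsolx
    rw [fderiv_fun_add hux.differentiableAt (analyticAt_bilin L hgx hux).differentiableAt] at d2
    have d3 := congrArg (fun L => L v) d2
    rw [_root_.add_apply, d1] at d3
    rw [map_add]
    exact d3
  · filter_upwards [hunit] with x hx w hw
    have h1 := congrArg (fun L => L w) (Ring.inverse_mul_cancel _ hx)
    change Ring.inverse (K x) (w + V (μ (g x) w)) = w at h1
    rw [← h1, hw, map_zero]

/-- The radial components `τ ↦ f (τ x) x` of a differential form depend analytically on `x`. -/
lemma exists_analytic_radial_form [CompleteSpace F] {f : X → X →L[ℂ] F} (hf : AnalyticAt ℂ f 0) :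
    ∃ g : X → C(unitInterval, F), AnalyticAt ℂ g 0 ∧ g 0 = 0 ∧
      ∀ᶠ x in 𝓝 (0 : X), ∀ τ : unitInterval, g x τ = f (((τ : ℝ) : ℂ) • x) x ∧
        ∀ v, fderiv ℂ g x v τ = f (((τ : ℝ) : ℂ) • x) v +
          ((τ : ℝ) : ℂ) • fderiv ℂ f (((τ : ℝ) : ℂ) • x) v x := by
  obtain ⟨f', hf', ef⟩ := exists_analytic_radial hf
  let B : C(unitInterval, X →L[ℂ] F) →L[ℂ] C(unitInterval, X) →L[ℂ] C(unitInterval, F) :=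
    pointwiseCLM (ContinuousLinearMap.id ℂ _)
  have hB : ∀ a b τ, B a b τ = a τ (b τ) := fun _ _ _ => rfl
  refine ⟨fun x => B (f' x) (powCLM X 0 x),
    analyticAt_bilin (H := C(unitInterval, F)) B hf' ((powCLM X 0).analyticAt 0), by simp, ?_⟩
  filter_upwards [hf'.eventually_analyticAt, ef.eventually_nhds,
    eventually_forall_unitInterval hf.eventually_analyticAt] with x hx ex hfx τ
  refine ⟨?_, fun v => ?_⟩
  · rw [hB, ex.self_of_nhds τ, powCLM_apply, pow_zero, one_smul]
  · have := hasFDerivAt_bilin (H := C(unitInterval, F)) B hx ((powCLM X 0).analyticAt x) v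
    rw [this, ContinuousLinearMap.fderiv, ContinuousMap.add_apply, hB, hB, powCLM_apply,
      powCLM_apply, ex.self_of_nhds τ,
      fderiv_radial_apply hx τ (hfx τ) (ex.mono fun y hy => hy τ)]
    simp

/-- The derivative of `s ↦ s (A(s x) v U(s) - h(s x) v)`. -/
lemma hasDerivAt_radial_defect {A : X → X →L[ℂ] E →L[ℂ] E} {h : X → X →L[ℂ] E} {x : X} (v : X)
    {s : ℝ} (hA : AnalyticAt ℂ A ((s : ℂ) • x)) (hh : AnalyticAt ℂ h ((s : ℂ) • x)) {U : ℝ → E}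
    {U' : E} (hU : HasDerivAt U U' s) :
    HasDerivAt (fun t : ℝ => (t : ℂ) • (A ((t : ℂ) • x) v (U t) - h ((t : ℂ) • x) v))
      ((s : ℂ) • (fderiv ℂ A ((s : ℂ) • x) x v (U s) + A ((s : ℂ) • x) v U' -
        fderiv ℂ h ((s : ℂ) • x) x v) + (A ((s : ℂ) • x) v (U s) - h ((s : ℂ) • x) v)) s := by
  have d0 : ∀ {F : Type _} [NormedAddCommGroup F] [NormedSpace ℂ F] {f : X → X →L[ℂ] F},
      AnalyticAt ℂ f ((s : ℂ) • x) → HasDerivAt (fun t : ℝ => f ((t : ℂ) • x) v)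
        (fderiv ℂ f ((s : ℂ) • x) x v) s := by
    intro F _ _ f hf
    let L : (X →L[ℂ] F) →L[ℝ] F := (ContinuousLinearMap.apply ℂ F v).restrictScalars ℝ
    exact L.hasFDerivAt.comp_hasDerivAt s (hasDerivAt_radial x hf)
  have d1 := d0 hA
  have d2 := d0 hh
  let R : (E →L[ℂ] E) →L[ℝ] (E →L[ℝ] E) := ContinuousLinearMap.restrictScalarsL ℂ E E ℝ ℝ
  have d3 : HasDerivAt (fun t : ℝ => A ((t : ℂ) • x) v (U t))
      (fderiv ℂ A ((s : ℂ) • x) x v (U s) + A ((s : ℂ) • x) v U') s :=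
    (R.hasFDerivAt.comp_hasDerivAt s d1).clm_apply hU
  have d4 : HasDerivAt (fun t : ℝ => (t : ℂ)) 1 s := Complex.ofRealCLM.hasDerivAt
  have d5 := d4.smul (d3.sub d2)
  rw [one_smul] at d5
  exact d5

/-- A linear system `dP + A P = h` that satisfies the integrability conditions has an analytic
solution with any given value at the origin. -/
theorem exists_solution_of_integrable [CompleteSpace E] {A : X → X →L[ℂ] E →L[ℂ] E}
    {h : X → X →L[ℂ] E} (hA : AnalyticAt ℂ A 0) (hh : AnalyticAt ℂ h 0)
    (flat : ∀ᶠ x in 𝓝 (0 : X), ∀ v w e, fderiv ℂ A x v w e + A x v (A x w e) =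
      fderiv ℂ A x w v e + A x w (A x v e))
    (closed : ∀ᶠ x in 𝓝 (0 : X), ∀ v w, fderiv ℂ h x v w + A x v (h x w) =
      fderiv ℂ h x w v + A x w (h x v)) (e₀ : E) :
    ∃ P : X → E, AnalyticAt ℂ P 0 ∧ P 0 = e₀ ∧
      ∀ᶠ x in 𝓝 (0 : X), ∀ v, fderiv ℂ P x v + A x v (P x) = h x v := by
  -- The value `u x τ` stands for `P (τ x)`. Integrated along the ray, the radial component of the
  -- system is the Volterra equation `u + V (g u) = e₀ + V η`, and `P x` is `u x 1`. Integrability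
  -- enters only to recover the other components.
  obtain ⟨g, hg, hg0, eg⟩ := exists_analytic_radial_form hA
  obtain ⟨η, hη, hη0, eη⟩ := exists_analytic_radial_form hh
  obtain ⟨μ, hμ⟩ : ∃ μ : C(unitInterval, E →L[ℂ] E) →L[ℂ] C(unitInterval, E) →L[ℂ]
      C(unitInterval, E), ∀ a b τ, μ a b τ = a τ (b τ) :=
    ⟨pointwiseCLM (ContinuousLinearMap.id ℂ _), fun _ _ _ => rfl⟩
  have hb : AnalyticAt ℂ (fun x => powCLM E 0 e₀ + volterra E (η x)) 0 :=
    analyticAt_const.add (analyticAt_clm (volterra E) hη)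
  obtain ⟨u, hu, hu0, hsol, hder, hinj⟩ :=
    exists_analytic_solution (volterra E) μ hg hb hg0
  have hev : ∀ x, AnalyticAt ℂ u x → AnalyticAt ℂ (fun x => u x 1) x := fun x hx =>
    analyticAt_clm (F := C(unitInterval, E)) (ContinuousMap.evalCLM ℂ (1 : unitInterval)) hx
  refine ⟨fun x => u x 1, hev 0 hu, ?_, ?_⟩
  · simp [hu0, hη0, powCLM_apply]
  filter_upwards [eventually_forall_unitInterval flat, eventually_forall_unitInterval closed,
    eventually_forall_unitInterval hA.eventually_analyticAt,
    eventually_forall_unitInterval hh.eventually_analyticAt,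
    hη.eventually_analyticAt, hu.eventually_analyticAt, hder, hinj, hsol,
    eg, eη] with x hflat hclosed hAx hhx hηx hux hderx hinjx hsolx egx eηx v
  have hP : fderiv ℂ (fun x => u x 1) x v = fderiv ℂ u x v 1 := by
    have h1 : HasFDerivAt (fun y => u y 1)
        ((ContinuousMap.evalCLM ℂ (1 : unitInterval)).comp (fderiv ℂ u x)) x :=
      (ContinuousMap.evalCLM ℂ (1 : unitInterval) : C(unitInterval, E) →L[ℂ] E).hasFDerivAt.comp x
        hux.differentiableAt.hasFDerivAt
    rw [h1.fderiv]; rfl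
  have hdiff : fderiv ℂ u x v + volterra E (μ (g x) (fderiv ℂ u x v) + μ (fderiv ℂ g x v) (u x)) =
      volterra E (fderiv ℂ η x v) := by
    rw [hderx v, fderiv_const_add, show fderiv ℂ (fun y => volterra E (η y)) x =
      (volterra E).comp (fderiv ℂ η x) from
        ((volterra E).hasFDerivAt.comp x hηx.differentiableAt.hasFDerivAt).fderiv]
    rfl
  have cA : Continuous fun τ : unitInterval => A (((τ : ℝ) : ℂ) • x) :=
    continuous_iff_continuousAt.2 fun τ => ContinuousAt.comp (g := A)
      (f := fun τ : unitInterval => ((τ : ℝ) : ℂ) • x) (hAx τ).continuousAt (by fun_prop)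
  have ch : Continuous fun τ : unitInterval => h (((τ : ℝ) : ℂ) • x) :=
    continuous_iff_continuousAt.2 fun τ => ContinuousAt.comp (g := h)
      (f := fun τ : unitInterval => ((τ : ℝ) : ℂ) • x) (hhx τ).continuousAt (by fun_prop)
  -- The derivative of `P (τ x)` in `x` carries a factor `τ`, hence the factor in `f`. The equation
  -- in the direction `v` says that `fderiv u x v + f` vanishes at `τ = 1`.
  obtain ⟨f, hf⟩ : ∃ f : C(unitInterval, E), ∀ τ, f τ = ((τ : ℝ) : ℂ) •
      (A (((τ : ℝ) : ℂ) • x) v (u x τ) - h (((τ : ℝ) : ℂ) • x) v) :=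
    ⟨⟨fun τ => ((τ : ℝ) : ℂ) •
      (A (((τ : ℝ) : ℂ) • x) v (u x τ) - h (((τ : ℝ) : ℂ) • x) v), (by fun_prop :
        Continuous fun τ : unitInterval => ((τ : ℝ) : ℂ)).smul
          (((cA.clm_apply continuous_const).clm_apply (u x).continuous).sub
            (ch.clm_apply continuous_const))⟩, fun _ => rfl⟩
  obtain ⟨ψ₀, hψ₀⟩ : ∃ ψ₀ : C(unitInterval, E), ψ₀ = η x - μ (g x) (u x) := ⟨_, rfl⟩
  obtain ⟨U, hU⟩ : ∃ U : ℝ → E, U = fun s => e₀ + ∫ r in (0 : ℝ)..s, lineExt ψ₀ r := ⟨_, rfl⟩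
  have huU : ∀ τ : unitInterval, u x τ = U τ := by
    intro τ
    have e2 : u x = powCLM E 0 e₀ + volterra E ψ₀ := by
      rw [hψ₀, map_sub, ← add_sub_assoc]
      exact eq_sub_of_add_eq hsolx
    rw [e2, hU, ContinuousMap.add_apply, powCLM_apply, volterra_apply, pow_zero, one_smul]
  have hU' : ∀ τ : unitInterval, HasDerivAt U (ψ₀ τ) τ := by
    intro τ
    have := (hasDerivAt_integral_lineExt ψ₀ τ).const_add e₀
    rwa [lineExt_coe, ← hU] at this
  -- The integrability conditions for the pair `v`, `x` at the point `τ x` replace derivatives of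
  -- `A` and `h` along the ray by derivatives in the direction `v`, that is, by the derivatives of
  -- `g` and `η`.
  have hfV : f = volterra E (μ (fderiv ℂ g x v) (u x) - fderiv ℂ η x v - μ (g x) f) := by
    refine eq_volterra (φ := fun s : ℝ => (s : ℂ) •
      (A ((s : ℂ) • x) v (U s) - h ((s : ℂ) • x) v)) (fun τ => by rw [hf, huU]) (by simp) ?_
    intro τ
    refine (hasDerivAt_radial_defect v (hAx τ) (hhx τ) (hU' τ)).congr_deriv ?_
    have e1 := hflat τ v x (u x τ)
    have e2 := hclosed τ v x
    rw [ContinuousMap.sub_apply, ContinuousMap.sub_apply, hμ, hμ, (egx τ).1, (egx τ).2,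
      (eηx τ).2, hf, ← huU, hψ₀, ContinuousMap.sub_apply, hμ, (egx τ).1, (eηx τ).1]
    simp only [map_sub, map_smul, _root_.add_apply, _root_.smul_apply]
    linear_combination (norm := module) (((τ : ℝ) : ℂ)) • e2 - (((τ : ℝ) : ℂ)) • e1
  -- The inhomogeneous terms of the Volterra equations for `fderiv u x v` and for `f` are opposite,
  -- so the sum solves the homogeneous equation, which has only the zero solution.
  have hw : fderiv ℂ u x v + f = 0 := by
    refine hinjx _ ?_
    have h2 := hfV
    rw [map_add] at hdiff
    rw [map_sub, map_sub] at h2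
    rw [map_add, map_add]
    linear_combination (norm := module) hdiff + h2
  have h1 := congrArg (fun L : C(unitInterval, E) => L 1) hw
  simp only [ContinuousMap.add_apply, hf, ContinuousMap.zero_apply, Set.Icc.coe_one,
    Complex.ofReal_one, one_smul] at h1
  rw [hP]
  linear_combination (norm := module) h1

end LinearSystems

/-! ### Holomorphic functions with values in finite-dimensional spaces -/

section Holomorphic

variable {p : ℕ} {G G' G'' : Type*} [AddCommGroup G] [Module ℂ G] [AddCommGroup G'] [Module ℂ G']
  [AddCommGroup G''] [Module ℂ G'']

/-- `F` is holomorphic at `y`: its composites with all linear functionals are analytic. -/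
def HolAt (F : (Fin p → ℂ) → G) (y : Fin p → ℂ) : Prop :=
  ∀ l : G →ₗ[ℂ] ℂ, AnalyticAt ℂ (fun z => l (F z)) y

variable {F F' : (Fin p → ℂ) → G} {y : Fin p → ℂ}

lemma HolAt.congr (hF : HolAt F y) (h : F =ᶠ[𝓝 y] F') : HolAt F' y := fun l =>
  (hF l).congr (h.mono fun z hz => by simp [hz])

lemma HolAt.comp_linear (hF : HolAt F y) (L : G →ₗ[ℂ] G') : HolAt (fun z => L (F z)) y :=
  fun l => hF (l.comp L)

lemma HolAt.const (c : G) : HolAt (fun _ => c) y := fun _ => analyticAt_const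

lemma HolAt.add (hF : HolAt F y) (hF' : HolAt F' y) : HolAt (fun z => F z + F' z) y := fun l => by
  simp only [map_add]
  exact (hF l).add (hF' l)

lemma HolAt.smul {g : (Fin p → ℂ) → ℂ} (hg : AnalyticAt ℂ g y) (hF : HolAt F y) :
    HolAt (fun z => g z • F z) y := fun l => by
  simp only [map_smul]
  exact hg.mul (hF l)

lemma HolAt.sum {J : Type*} (s : Finset J) {f : J → (Fin p → ℂ) → G} (hf : ∀ j ∈ s, HolAt (f j) y) :
    HolAt (fun z => ∑ j ∈ s, f j z) y := fun l => by
  simpa using Finset.analyticAt_fun_sum s fun j hj => hf j hj l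

lemma AnalyticAt.holAt {g : (Fin p → ℂ) → ℂ} (hg : AnalyticAt ℂ g y) : HolAt g y := fun l => by
  have : (fun z => l (g z)) = fun z => g z * l 1 := by
    funext z
    rw [← smul_eq_mul (g z), ← map_smul, smul_eq_mul, mul_one]
  rw [this]
  exact hg.mul analyticAt_const

section Finite

variable [Module.Finite ℂ G]

lemma sum_finBasis_repr (x : G) :
    ∑ i, (Module.finBasis ℂ G).coord i x • Module.finBasis ℂ G i = x :=
  (Module.finBasis ℂ G).sum_repr x

lemma linear_apply_eq_sum (L : G →ₗ[ℂ] G') (x : G) :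
    L x = ∑ i, (Module.finBasis ℂ G).coord i x • L (Module.finBasis ℂ G i) := by
  conv_lhs => rw [← sum_finBasis_repr x, map_sum]
  simp only [map_smul]

lemma bilin_apply_eq_sum (B : G →ₗ[ℂ] G' →ₗ[ℂ] G'') (x : G) (w : G') :
    B x w = ∑ i, (Module.finBasis ℂ G).coord i x • B (Module.finBasis ℂ G i) w :=
  linear_apply_eq_sum (B.flip w) x

lemma HolAt.bilin [Module.Finite ℂ G'] (B : G →ₗ[ℂ] G' →ₗ[ℂ] G'') {H : (Fin p → ℂ) → G'} (hF : HolAt F y)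
    (hH : HolAt H y) : HolAt (fun z => B (F z) (H z)) y := by
  have : (fun z => B (F z) (H z)) = fun z => ∑ i, (Module.finBasis ℂ G).coord i (F z) •
      B (Module.finBasis ℂ G i) (H z) := by
    funext z
    exact bilin_apply_eq_sum B _ _
  rw [this]
  exact HolAt.sum _ fun i _ => (hH.comp_linear _).smul (hF _)

lemma HolAt.eventually (hF : HolAt F y) : ∀ᶠ z in 𝓝 y, HolAt F z := by
  have h : ∀ᶠ z in 𝓝 y, ∀ i, AnalyticAt ℂ (fun z => (Module.finBasis ℂ G).coord i (F z)) z :=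
    Filter.eventually_all.2 fun i => (hF _).eventually_analyticAt
  filter_upwards [h] with z hz
  have e : F = fun z => ∑ i, (Module.finBasis ℂ G).coord i (F z) • Module.finBasis ℂ G i := by
    funext z
    exact (sum_finBasis_repr (F z)).symm
  rw [e]
  exact HolAt.sum _ fun i _ => (HolAt.const _).smul (hz i)

/-- The partial derivative of a function with values in a finite-dimensional space. -/
def pd (i : Fin p) (F : (Fin p → ℂ) → G) (y : Fin p → ℂ) : G :=
  ∑ j, fderiv ℂ (fun z => (Module.finBasis ℂ G).coord j (F z)) y (Pi.single i 1) •
    Module.finBasis ℂ G j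

/-- Linear functionals commute with differentiation of holomorphic functions, so the basis chosen in
the definition of `pd` is immaterial. Identities for `pd` are proved by testing with functionals. -/
lemma HolAt.apply_pd (hF : HolAt F y) (i : Fin p) (l : G →ₗ[ℂ] ℂ) :
    l (pd i F y) = fderiv ℂ (fun z => l (F z)) y (Pi.single i 1) := by
  have e : (fun z => l (F z)) =
      fun z => ∑ j, (Module.finBasis ℂ G).coord j (F z) * l (Module.finBasis ℂ G j) := by
    funext z
    exact linear_apply_eq_sum l _
  rw [e, fderiv_fun_sum fun j _ => (hF _).differentiableAt.mul_const _, pd]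
  simp only [map_sum, map_smul, _root_.sum_apply, smul_eq_mul]
  refine Finset.sum_congr rfl fun j _ => ?_
  rw [fderiv_mul_const (hF _).differentiableAt]
  simp [mul_comm]

lemma eq_of_forall_dual {x x' : G} (h : ∀ l : G →ₗ[ℂ] ℂ, l x = l x') : x = x' := by
  rw [← sum_finBasis_repr x, ← sum_finBasis_repr x']
  simp only [h]

lemma HolAt.pd (hF : HolAt F y) (i : Fin p) : HolAt (pd i F) y := by
  refine HolAt.sum _ fun j _ => HolAt.smul ?_ (HolAt.const _)
  exact analyticAt_clm (ContinuousLinearMap.apply ℂ ℂ (Pi.single i 1)) (hF _).fderiv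

lemma pd_congr (i : Fin p) (h : F =ᶠ[𝓝 y] F') : SuperGeom.pd i F y = SuperGeom.pd i F' y := by
  unfold SuperGeom.pd
  refine Finset.sum_congr rfl fun j _ => ?_
  have h' : (fun z => (Module.finBasis ℂ G).coord j (F z)) =ᶠ[𝓝 y]
      fun z => (Module.finBasis ℂ G).coord j (F' z) := h.mono fun z hz => by simp [hz]
  rw [h'.fderiv_eq]

lemma HolAt.linear_pd [Module.Finite ℂ G'] (hF : HolAt F y) (L : G →ₗ[ℂ] G') (i : Fin p) :
    L (SuperGeom.pd i F y) = SuperGeom.pd i (fun z => L (F z)) y :=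
  eq_of_forall_dual fun l => by
    rw [(hF.comp_linear L).apply_pd i l]
    exact hF.apply_pd i (l.comp L)

lemma HolAt.pd_add (hF : HolAt F y) (hF' : HolAt F' y) (i : Fin p) :
    SuperGeom.pd i (fun z => F z + F' z) y = SuperGeom.pd i F y + SuperGeom.pd i F' y :=
  eq_of_forall_dual fun l => by
    rw [(hF.add hF').apply_pd, map_add, hF.apply_pd, hF'.apply_pd]
    simp only [map_add]
    rw [fderiv_fun_add (hF l).differentiableAt (hF' l).differentiableAt]
    rfl

lemma pd_const (i : Fin p) (c : G) : SuperGeom.pd i (fun _ => c) y = 0 := by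
  simp [SuperGeom.pd]

lemma HolAt.pd_sum {J : Type*} (s : Finset J) {f : J → (Fin p → ℂ) → G}
    (hf : ∀ j ∈ s, HolAt (f j) y) (i : Fin p) :
    SuperGeom.pd i (fun z => ∑ j ∈ s, f j z) y = ∑ j ∈ s, SuperGeom.pd i (f j) y := by
  classical
  induction s using Finset.induction_on with
  | empty => simp [pd_const]
  | insert a s ha ih =>
    simp only [Finset.sum_insert ha]
    rw [HolAt.pd_add (hf a (by simp)) (HolAt.sum _ fun j hj => hf j (by simp [hj])),
      ih fun j hj => hf j (by simp [hj])]

lemma HolAt.pd_smul {g : (Fin p → ℂ) → ℂ} (hg : AnalyticAt ℂ g y) (hF : HolAt F y) (i : Fin p) :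
    SuperGeom.pd i (fun z => g z • F z) y =
      fderiv ℂ g y (Pi.single i 1) • F y + g y • SuperGeom.pd i F y :=
  eq_of_forall_dual fun l => by
    rw [(hF.smul hg).apply_pd, map_add, map_smul, map_smul, hF.apply_pd]
    simp only [map_smul, smul_eq_mul]
    rw [fderiv_fun_mul hg.differentiableAt (hF l).differentiableAt]
    simp [add_comm, mul_comm]

lemma HolAt.pd_bilin [Module.Finite ℂ G'] [Module.Finite ℂ G''] (B : G →ₗ[ℂ] G' →ₗ[ℂ] G'') {H : (Fin p → ℂ) → G'}
    (hF : HolAt F y) (hH : HolAt H y) (i : Fin p) :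
    SuperGeom.pd i (fun z => B (F z) (H z)) y =
      B (SuperGeom.pd i F y) (H y) + B (F y) (SuperGeom.pd i H y) := by
  have e : (fun z => B (F z) (H z)) = fun z => ∑ i, (Module.finBasis ℂ G).coord i (F z) •
      B (Module.finBasis ℂ G i) (H z) := by
    funext z
    exact bilin_apply_eq_sum B _ _
  rw [e, HolAt.pd_sum _ fun j _ => (hH.comp_linear _).smul (hF _)]
  have e2 : B (F y) (SuperGeom.pd i H y) = ∑ j, (Module.finBasis ℂ G).coord j (F y) •
      B (Module.finBasis ℂ G j) (SuperGeom.pd i H y) :=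
    bilin_apply_eq_sum B _ _
  rw [e2, SuperGeom.pd, map_sum, LinearMap.sum_apply, ← Finset.sum_add_distrib]
  refine Finset.sum_congr rfl fun j _ => ?_
  rw [HolAt.pd_smul (hF _) (hH.comp_linear _), hH.linear_pd, map_smul, LinearMap.smul_apply]

end Finite

/-! #### Hadamard's lemma -/

lemma shift_apply_self {X F : Type*} [NormedAddCommGroup X] [NormedSpace ℂ X]
    [NormedAddCommGroup F] [NormedSpace ℂ F] (P : FormalMultilinearSeries ℂ X F) (n : ℕ) (w : X) :
    P.shift n (fun _ => w) w = P (n + 1) fun _ => w := by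
  simp only [FormalMultilinearSeries.shift, ContinuousMultilinearMap.curryRight_apply]
  congr 1
  funext i
  refine Fin.lastCases ?_ (fun j => ?_) i <;> simp

/-- Leaving one slot open in each term of positive degree gives a power series of linear maps with
the same radius. Filling the slot with the increment `z - x` restores `f z - f x`. -/
lemma exists_hadamard {X F : Type*} [NormedAddCommGroup X] [NormedSpace ℂ X]
    [NormedAddCommGroup F] [NormedSpace ℂ F] [CompleteSpace F] {f : X → F} {x : X}
    (hf : AnalyticAt ℂ f x) : ∃ Q : X → X →L[ℂ] F, AnalyticAt ℂ Q x ∧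
      ∀ᶠ z in 𝓝 x, f z = f x + Q z (z - x) := by
  obtain ⟨P, r, hP⟩ := hf
  have hr : r ≤ P.shift.radius := by rw [P.radius_shift]; exact hP.r_le
  have hQ := P.shift.hasFPowerSeriesOnBall (hP.r_pos.trans_le hr)
  refine ⟨fun z => P.shift.sum (z - x), ?_, ?_⟩
  · have h1 : AnalyticAt ℂ P.shift.sum (x - x) := by rw [sub_self]; exact hQ.analyticAt
    exact AnalyticAt.comp (g := P.shift.sum) (f := fun z => z - x) h1
      (analyticAt_id.sub analyticAt_const)
  · filter_upwards [Metric.eball_mem_nhds x hP.r_pos] with z hz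
    have hz' : z - x ∈ Metric.eball (0 : X) r := by
      rw [Metric.mem_eball, edist_zero_right]
      rwa [Metric.mem_eball, edist_eq_enorm_sub] at hz
    have h1 := hP.hasSum hz'
    rw [add_sub_cancel] at h1
    have h2 := hQ.hasSum (Metric.eball_subset_eball hr hz')
    rw [zero_add] at h2
    have h3 := (ContinuousLinearMap.apply ℂ F (z - x)).hasSum h2
    have h4 := (hasSum_nat_add_iff' 1).2 h1
    rw [Finset.sum_range_one, hP.coeff_zero] at h4
    have h5 : f z - f x = P.shift.sum (z - x) (z - x) := by
      refine h4.unique ?_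
      have e : (fun n => P (n + 1) fun _ => z - x) =
          fun n => ContinuousLinearMap.apply ℂ F (z - x) (P.shift n fun _ => z - x) := by
        funext n
        symm
        exact shift_apply_self P n (z - x)
      rw [e]
      exact h3
    rw [← h5, add_sub_cancel]

lemma HolAt.exists_hadamard [Module.Finite ℂ G] (hF : HolAt F y) :
    ∃ Q : Fin p → (Fin p → ℂ) → G, (∀ i, HolAt (Q i) y) ∧
      ∀ᶠ z in 𝓝 y, F z = F y + ∑ i, (z i - y i) • Q i z := by
  choose q hq hq' using fun j => SuperGeom.exists_hadamard (hF ((Module.finBasis ℂ G).coord j))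
  refine ⟨fun i z => ∑ j, q j z (Pi.single i 1) • Module.finBasis ℂ G j, fun i => ?_, ?_⟩
  · exact HolAt.sum _ fun j _ => (HolAt.const _).smul
      (analyticAt_clm (ContinuousLinearMap.apply ℂ ℂ (Pi.single i 1)) (hq j))
  · filter_upwards [Filter.eventually_all.2 hq'] with z hz
    rw [← sum_finBasis_repr (F z), ← sum_finBasis_repr (F y)]
    simp only [hz, Finset.smul_sum]
    rw [Finset.sum_comm, ← Finset.sum_add_distrib]
    refine Finset.sum_congr rfl fun j _ => ?_
    rw [add_smul]
    congr 1
    conv_lhs => rw [← Finset.univ_sum_single (z - y), map_sum, Finset.sum_smul]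
    refine Finset.sum_congr rfl fun i _ => ?_
    rw [show (Pi.single i ((z - y) i) : Fin p → ℂ) = (z i - y i) • Pi.single i 1 by
      rw [← Pi.single_smul]; simp, map_smul, smul_eq_mul, mul_smul]

/-! #### Integrable systems in finite-dimensional spaces -/

section Normed

variable {E : Type*} [NormedAddCommGroup E] [NormedSpace ℂ E] [FiniteDimensional ℂ E]

lemma HolAt.analyticAt' {f : (Fin p → ℂ) → E} (hf : HolAt f y) : AnalyticAt ℂ f y := by
  have e : f = fun z => ∑ i, (Module.finBasis ℂ E).coord i (f z) • Module.finBasis ℂ E i := by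
    funext z
    exact (sum_finBasis_repr (f z)).symm
  rw [e]
  exact Finset.analyticAt_fun_sum _ fun i _ => (hf _).smul analyticAt_const

lemma AnalyticAt.holAt' {f : (Fin p → ℂ) → E} (hf : AnalyticAt ℂ f y) : HolAt f y := fun l =>
  analyticAt_clm l.toContinuousLinearMap hf

lemma pd_eq_fderiv {f : (Fin p → ℂ) → E} (hf : AnalyticAt ℂ f y) (i : Fin p) :
    SuperGeom.pd i f y = fderiv ℂ f y (Pi.single i 1) :=
  eq_of_forall_dual fun l => by
    rw [(AnalyticAt.holAt' hf).apply_pd]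
    have h := (l.toContinuousLinearMap.hasFDerivAt.comp y
      hf.differentiableAt.hasFDerivAt).fderiv
    have h' := congrArg (fun L => L (Pi.single i 1)) h
    exact h'

lemma sum_smul_single (v : Fin p → ℂ) : v = ∑ i, v i • (Pi.single i 1 : Fin p → ℂ) := by
  conv_lhs => rw [← Finset.univ_sum_single v]
  refine Finset.sum_congr rfl fun i _ => ?_
  rw [← Pi.single_smul]; simp

lemma clm_apply_eq_sum (L : (Fin p → ℂ) →L[ℂ] E) (v : Fin p → ℂ) :
    L v = ∑ i, v i • L (Pi.single i 1) := by
  conv_lhs => rw [sum_smul_single v, map_sum]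
  simp only [map_smul]

/-- The differential form with given components. -/
def formOf (a : Fin p → E) : (Fin p → ℂ) →L[ℂ] E :=
  ∑ i, (ContinuousLinearMap.proj i : (Fin p → ℂ) →L[ℂ] ℂ).smulRight (a i)

lemma formOf_apply (a : Fin p → E) (v : Fin p → ℂ) : formOf a v = ∑ i, v i • a i := by
  simp [formOf, _root_.sum_apply]

lemma formOf_single (a : Fin p → E) (i : Fin p) : formOf a (Pi.single i 1) = a i := by
  rw [formOf_apply, Finset.sum_eq_single i]
  · simp
  · intro j _ hj; simp [Pi.single_eq_of_ne hj]
  · simp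

lemma analyticAt_formOf {a : Fin p → (Fin p → ℂ) → E} (ha : ∀ i, AnalyticAt ℂ (a i) y) :
    AnalyticAt ℂ (fun z => formOf fun i => a i z) y := by
  refine Finset.analyticAt_fun_sum _ fun i _ => ?_
  exact analyticAt_clm ((ContinuousLinearMap.smulRightL ℂ (Fin p → ℂ) E)
    (ContinuousLinearMap.proj i : (Fin p → ℂ) →L[ℂ] ℂ)) (ha i)

lemma fderiv_formOf {a : Fin p → (Fin p → ℂ) → E} (ha : ∀ i, AnalyticAt ℂ (a i) y)
    (v w : Fin p → ℂ) :
    fderiv ℂ (fun z => formOf fun i => a i z) y v w = ∑ i, ∑ j, (v i * w j) • SuperGeom.pd i (a j) y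
    := by
  have h1 : fderiv ℂ (fun z => formOf fun i => a i z) y v w =
      fderiv ℂ (fun z => formOf (fun i => a i z) w) y v := by
    have h := ((ContinuousLinearMap.apply ℂ E w).hasFDerivAt.comp y
      (analyticAt_formOf ha).differentiableAt.hasFDerivAt).fderiv
    exact (congrArg (fun L => L v) h).symm
  rw [h1]
  simp only [formOf_apply]
  rw [fderiv_fun_sum (A := fun i z => w i • a i z)
    fun i _ => (ha i).differentiableAt.const_smul _, _root_.sum_apply,
    Finset.sum_comm]
  refine Finset.sum_congr rfl fun j _ => ?_
  rw [fderiv_fun_const_smul (ha j).differentiableAt, _root_.smul_apply, clm_apply_eq_sum,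
    Finset.smul_sum]
  refine Finset.sum_congr rfl fun i _ => ?_
  rw [pd_eq_fderiv (ha j), smul_smul, mul_comm]

lemma pd_comp_add (f : (Fin p → ℂ) → E) (i : Fin p) (x : Fin p → ℂ) :
    SuperGeom.pd i (fun x => f (y + x)) x = SuperGeom.pd i f (y + x) := by
  unfold SuperGeom.pd
  refine Finset.sum_congr rfl fun j _ => ?_
  rw [fderiv_comp_add_left (f := fun z => (Module.finBasis ℂ E).coord j (f z)) y]

/-- Integrability for pairs of coordinate directions extends bilinearly to all pairs of vectors, as
the coordinate-free theorem requires. -/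
lemma sum_swap_of_symm (v w : Fin p → ℂ) (D B : Fin p → Fin p → E)
    (h : ∀ i j, D i j + B i j = D j i + B j i) :
    ∑ i, ∑ j, (v i * w j) • D i j + ∑ j, ∑ i, w j • v i • B i j =
      ∑ i, ∑ j, (w i * v j) • D i j + ∑ j, ∑ i, v j • w i • B i j := by
  rw [Finset.sum_comm (f := fun j i => w j • v i • B i j),
    Finset.sum_comm (f := fun i j => (w i * v j) • D i j), ← Finset.sum_add_distrib,
    ← Finset.sum_add_distrib]
  refine Finset.sum_congr rfl fun i _ => ?_
  rw [← Finset.sum_add_distrib, ← Finset.sum_add_distrib]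
  refine Finset.sum_congr rfl fun j _ => ?_
  linear_combination (norm := module) (v i * w j) • h i j

/-- A system `∂ᵢ P + Aᵢ P = hᵢ` that satisfies the integrability conditions has a solution with any
given value at the base point. -/
lemma exists_pd_solution {a : Fin p → (Fin p → ℂ) → E →L[ℂ] E} {h : Fin p → (Fin p → ℂ) → E}
    (ha : ∀ i, AnalyticAt ℂ (a i) y) (hh : ∀ i, AnalyticAt ℂ (h i) y)
    (flat : ∀ᶠ z in 𝓝 y, ∀ i j e, SuperGeom.pd i (a j) z e + a i z (a j z e) =
      SuperGeom.pd j (a i) z e + a j z (a i z e))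
    (closed : ∀ᶠ z in 𝓝 y, ∀ i j, SuperGeom.pd i (h j) z + a i z (h j z) =
      SuperGeom.pd j (h i) z + a j z (h i z)) (e₀ : E) :
    ∃ P : (Fin p → ℂ) → E, AnalyticAt ℂ P y ∧ P y = e₀ ∧
      ∀ᶠ z in 𝓝 y, ∀ i, SuperGeom.pd i P z + a i z (P z) = h i z := by
  have htr : Filter.Tendsto (fun x : Fin p → ℂ => y + x) (𝓝 0) (𝓝 y) :=
    (continuous_const.add continuous_id).tendsto' _ _ (by simp)
  have shift_an : ∀ {F : Type _} [NormedAddCommGroup F] [NormedSpace ℂ F] {f : (Fin p → ℂ) → F}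
      {x : Fin p → ℂ}, AnalyticAt ℂ f (y + x) → AnalyticAt ℂ (fun x => f (y + x)) x :=
    fun {F _ _ f x} hf => AnalyticAt.comp (g := f) (f := fun x => y + x) hf
      (analyticAt_const.add analyticAt_id)
  have ha0 : ∀ i, AnalyticAt ℂ (fun x => a i (y + x)) 0 := fun i => shift_an (by simpa using ha i)
  have hh0 : ∀ i, AnalyticAt ℂ (fun x => h i (y + x)) 0 := fun i => shift_an (by simpa using hh i)
  have hflat : ∀ᶠ x in 𝓝 (0 : Fin p → ℂ), ∀ v w e,
      fderiv ℂ (fun x => formOf fun i => a i (y + x)) x v w e +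
        formOf (fun i => a i (y + x)) v (formOf (fun i => a i (y + x)) w e) =
      fderiv ℂ (fun x => formOf fun i => a i (y + x)) x w v e +
        formOf (fun i => a i (y + x)) w (formOf (fun i => a i (y + x)) v e) := by
    filter_upwards [htr.eventually flat,
      htr.eventually (Filter.eventually_all.2 fun i => (ha i).eventually_analyticAt)]
      with x hx hax v w e
    have hax' := fun i => shift_an (hax i)
    rw [fderiv_formOf hax', fderiv_formOf hax']
    simp only [formOf_apply, _root_.sum_apply, _root_.smul_apply, map_sum, map_smul, pd_comp_add,
      Finset.smul_sum]
    exact sum_swap_of_symm v w (fun i j => SuperGeom.pd i (a j) (y + x) e)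
      (fun i j => a i (y + x) (a j (y + x) e)) fun i j => hx i j e
  have hclosed : ∀ᶠ x in 𝓝 (0 : Fin p → ℂ), ∀ v w,
      fderiv ℂ (fun x => formOf fun i => h i (y + x)) x v w +
        formOf (fun i => a i (y + x)) v (formOf (fun i => h i (y + x)) w) =
      fderiv ℂ (fun x => formOf fun i => h i (y + x)) x w v +
        formOf (fun i => a i (y + x)) w (formOf (fun i => h i (y + x)) v) := by
    filter_upwards [htr.eventually closed,
      htr.eventually (Filter.eventually_all.2 fun i => (hh i).eventually_analyticAt)]
      with x hx hhx v w
    have hhx' := fun i => shift_an (hhx i)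
    rw [fderiv_formOf hhx', fderiv_formOf hhx']
    simp only [formOf_apply, _root_.sum_apply, _root_.smul_apply, map_sum, map_smul, pd_comp_add,
      Finset.smul_sum]
    exact sum_swap_of_symm v w (fun i j => SuperGeom.pd i (h j) (y + x))
      (fun i j => a i (y + x) (h j (y + x))) hx
  obtain ⟨P, hP, hP0, hPs⟩ := exists_solution_of_integrable (analyticAt_formOf ha0)
    (analyticAt_formOf hh0) hflat hclosed e₀
  refine ⟨fun z => P (z - y), ?_, by simpa using hP0, ?_⟩
  · exact AnalyticAt.comp (g := P) (f := fun z => z - y) (by simpa using hP)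
      (analyticAt_id.sub analyticAt_const)
  · have htr' : Filter.Tendsto (fun z : Fin p → ℂ => z - y) (𝓝 y) (𝓝 0) :=
      (continuous_id.sub continuous_const).tendsto' _ _ (by simp)
    filter_upwards [htr'.eventually hPs, htr'.eventually hP.eventually_analyticAt] with z hz hPz i
    have h1 := hz (Pi.single i 1)
    rw [formOf_single, formOf_single, add_sub_cancel] at h1
    have h2 : AnalyticAt ℂ (fun z => P (z - y)) z := AnalyticAt.comp (g := P)
      (f := fun z => z - y) hPz (analyticAt_id.sub analyticAt_const)
    rw [pd_eq_fderiv h2]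
    simp only [sub_eq_add_neg] at h1 ⊢
    rw [fderiv_comp_add_right]
    exact h1

end Normed

/-- A system `∂ᵢ P + Aᵢ P = hᵢ` that satisfies the integrability conditions has a holomorphic
solution with any given value at the base point. -/
theorem exists_hol_solution [Module.Finite ℂ G] {A : Fin p → (Fin p → ℂ) → G →ₗ[ℂ] G}
    {h : Fin p → (Fin p → ℂ) → G} (hA : ∀ i, HolAt (A i) y) (hh : ∀ i, HolAt (h i) y)
    (flat : ∀ᶠ z in 𝓝 y, ∀ i j e, SuperGeom.pd i (A j) z e + A i z (A j z e) =
      SuperGeom.pd j (A i) z e + A j z (A i z e))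
    (closed : ∀ᶠ z in 𝓝 y, ∀ i j, SuperGeom.pd i (h j) z + A i z (h j z) =
      SuperGeom.pd j (h i) z + A j z (h i z)) (e₀ : G) :
    ∃ P : (Fin p → ℂ) → G, HolAt P y ∧ P y = e₀ ∧
      ∀ᶠ z in 𝓝 y, ∀ i, SuperGeom.pd i P z + A i z (P z) = h i z := by
  -- `HolAt` refers to linear functionals and needs no norm. A basis moves the system to a space
  -- `ℂ^d`, where the analytic theorem applies.
  let b : G ≃ₗ[ℂ] (Fin (Module.finrank ℂ G) → ℂ) := (Module.finBasis ℂ G).equivFun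
  let c : (G →ₗ[ℂ] G) →ₗ[ℂ] ((Fin (Module.finrank ℂ G) → ℂ) →L[ℂ]
      (Fin (Module.finrank ℂ G) → ℂ)) :=
    LinearMap.toContinuousLinearMap.toLinearMap.comp b.conj.toLinearMap
  have hc : ∀ L e, c L (b e) = b (L e) := fun L e => by
    change b (L (b.symm (b e))) = _
    rw [b.symm_apply_apply]
  have hflat : ∀ᶠ z in 𝓝 y, ∀ i j e, SuperGeom.pd i (fun z => c (A j z)) z e +
      c (A i z) (c (A j z) e) = SuperGeom.pd j (fun z => c (A i z)) z e +
        c (A j z) (c (A i z) e) := by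
    filter_upwards [flat, Filter.eventually_all.2 fun i => (hA i).eventually] with z hz hAz i j e
    obtain ⟨e, rfl⟩ := b.surjective e
    rw [← (hAz j).linear_pd c, ← (hAz i).linear_pd c]
    simp only [hc]
    rw [← map_add, ← map_add, hz]
  have hclosed : ∀ᶠ z in 𝓝 y, ∀ i j, SuperGeom.pd i (fun z => b (h j z)) z +
      c (A i z) (b (h j z)) = SuperGeom.pd j (fun z => b (h i z)) z + c (A j z) (b (h i z)) := by
    filter_upwards [closed, Filter.eventually_all.2 fun i => (hh i).eventually] with z hz hhz i j
    have h1 := fun i j => (hhz i).linear_pd b.toLinearMap j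
    simp only [LinearEquiv.coe_coe] at h1
    rw [← h1, ← h1]
    simp only [hc]
    rw [← map_add, ← map_add, hz]
  obtain ⟨P, hP, hP0, hPs⟩ := exists_pd_solution (y := y) (a := fun i z => c (A i z))
    (h := fun i z => b (h i z)) (fun i => ((hA i).comp_linear c).analyticAt')
    (fun i => ((hh i).comp_linear b.toLinearMap).analyticAt') hflat hclosed (b e₀)
  have hPh := AnalyticAt.holAt' hP
  refine ⟨fun z => b.symm (P z), hPh.comp_linear b.symm.toLinearMap, by simp [hP0], ?_⟩
  filter_upwards [hPs, hPh.eventually] with z hz hPz i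
  have h1 := congrArg b.symm (hz i)
  have h2 := hPz.linear_pd b.symm.toLinearMap i
  simp only [LinearEquiv.coe_coe] at h2
  rw [map_add, h2, b.symm_apply_apply] at h1
  rw [← h1]
  congr 1
  rw [LinearEquiv.eq_symm_apply, ← hc, b.apply_symm_apply]

end Holomorphic

/-! ### The Grassmann algebra -/

section GrassmannAlgebra

instance finite_exteriorAlgebra {V : Type*} [AddCommGroup V] [Module ℂ V] [Module.Finite ℂ V] :
    Module.Finite ℂ (ExteriorAlgebra ℂ V) :=
  Module.Finite.of_basis (Module.finBasis ℂ V).ExteriorAlgebra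

/-- The odd coordinates in the Grassmann algebra. -/
def xi (N : ℕ) {q : ℕ} (j : Fin q) : Grassmann N q := ExteriorAlgebra.ι ℂ (Pi.single j 1, 0)

/-- The inclusion of the constants in the Grassmann algebra. -/
def gconst (N q : ℕ) : Constants N →ₐ[ℂ] Grassmann N q :=
  ExteriorAlgebra.map (LinearMap.inr ℂ (Fin q → ℂ) (Fin N → ℂ))

variable {N q k : ℕ}

/-- The parity involution of the Grassmann algebra. -/
abbrev ginv : Grassmann N q →ₐ[ℂ] Grassmann N q := CliffordAlgebra.involute

/-- The derivative `∂/∂ξⱼ` of the Grassmann algebra. -/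
def gder (j : Fin q) : Grassmann N q →ₗ[ℂ] Grassmann N q :=
  CliffordAlgebra.contractLeft (Q := (0 : QuadraticForm ℂ ((Fin q → ℂ) × (Fin N → ℂ))))
    ((LinearMap.proj j).comp (LinearMap.fst ℂ (Fin q → ℂ) (Fin N → ℂ)))

lemma gder_algebraMap (j : Fin q) (r : ℂ) : gder j (algebraMap ℂ (Grassmann N q) r) = 0 :=
  CliffordAlgebra.contractLeft_algebraMap (Q := 0) _ r

lemma gder_iota_mul (j : Fin q) (w : (Fin q → ℂ) × (Fin N → ℂ)) (a : Grassmann N q) :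
    gder j (ExteriorAlgebra.ι ℂ w * a) = w.1 j • a - ExteriorAlgebra.ι ℂ w * gder j a :=
  CliffordAlgebra.contractLeft_ι_mul _ w a

lemma gder_iota (j : Fin q) (w : (Fin q → ℂ) × (Fin N → ℂ)) :
    gder j (ExteriorAlgebra.ι ℂ w) = algebraMap ℂ (Grassmann N q) (w.1 j) :=
  CliffordAlgebra.contractLeft_ι (Q := 0) _ w

/-- The super Leibniz rule, with the sign written through the involution so that it needs no
homogeneity. It propagates from generators to products because the involution is multiplicative. -/
lemma gder_mul (j : Fin q) (a b : Grassmann N q) :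
    gder j (a * b) = gder j a * b + ginv a * gder j b := by
  induction a using ExteriorAlgebra.induction generalizing b with
  | algebraMap r =>
    rw [gder_algebraMap, zero_mul, zero_add, ← Algebra.smul_def, map_smul, AlgHom.commutes,
      ← Algebra.smul_def]
  | ι w =>
    rw [gder_iota_mul, gder_iota, ← Algebra.smul_def]
    change _ = _ + CliffordAlgebra.involute (CliffordAlgebra.ι _ w) * _
    rw [CliffordAlgebra.involute_ι, neg_mul, ← sub_eq_add_neg]
  | mul a a' ha ha' =>
    rw [mul_assoc, ha, ha', ha, map_mul]
    noncomm_ring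
  | add a a' ha ha' =>
    rw [add_mul, map_add, ha, ha', map_add, map_add]
    noncomm_ring

lemma ginv_gder (j : Fin q) (a : Grassmann N q) : ginv (gder j a) = - gder j (ginv a) := by
  induction a using ExteriorAlgebra.induction with
  | algebraMap r => simp [gder_algebraMap]
  | ι w =>
    have : ginv (ExteriorAlgebra.ι ℂ w : Grassmann N q) = - ExteriorAlgebra.ι ℂ w :=
      CliffordAlgebra.involute_ι w
    rw [this, map_neg, gder_iota, AlgHom.commutes, neg_neg]
  | mul a a' ha ha' =>
    have hh : ginv (ginv a) = a := CliffordAlgebra.involute_involute a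
    rw [gder_mul, map_add, map_mul, map_mul, ha, ha', map_mul, gder_mul, hh]
    noncomm_ring
  | add a a' ha ha' => rw [map_add, map_add, ha, ha', map_add, map_add, neg_add]

lemma gder_gconst (j : Fin q) (c : Constants N) : gder j (gconst N q c) = 0 := by
  induction c using ExteriorAlgebra.induction with
  | algebraMap r => rw [AlgHom.commutes, gder_algebraMap]
  | ι w =>
    rw [gconst, ExteriorAlgebra.map_apply_ι, gder_iota]
    simp
  | mul a a' ha ha' => rw [map_mul, gder_mul, ha, ha', zero_mul, mul_zero, add_zero]
  | add a a' ha ha' => rw [map_add, map_add, ha, ha', add_zero]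

lemma gder_xi (j i : Fin q) : gder j (xi N i) = if i = j then 1 else 0 := by
  rw [xi, gder_iota]
  split_ifs with h
  · subst h; simp
  · simp [Ne.symm h]

lemma ginv_xi (j : Fin q) : ginv (xi N j) = - xi N j := CliffordAlgebra.involute_ι _

/-- Hadamard's lemma in the odd variables: modulo the `ξ`'s only constants remain. For products one
needs that a constant can be moved past `ξⱼ` at the price of changing the constant (`hcomm`). -/
lemma exists_eq_gconst_add (a : Grassmann N q) : ∃ (c : Constants N) (b : Fin q → Grassmann N q),
    a = gconst N q c + ∑ j, xi N j * b j := by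
  induction a using ExteriorAlgebra.induction with
  | algebraMap r => exact ⟨algebraMap ℂ _ r, 0, by simp⟩
  | ι w =>
    refine ⟨ExteriorAlgebra.ι ℂ w.2, fun j => algebraMap ℂ _ (w.1 j), ?_⟩
    rw [gconst, ExteriorAlgebra.map_apply_ι]
    have : ∀ j, xi N j * algebraMap ℂ (Grassmann N q) (w.1 j) =
        ExteriorAlgebra.ι ℂ (w.1 j • (Pi.single j 1, 0)) := fun j => by
      rw [← Algebra.commutes, ← Algebra.smul_def, map_smul, xi]
    simp only [this]
    rw [← map_sum, ← map_add]
    congr 1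
    ext i
    · simp [Prod.fst_sum, Finset.sum_apply, Pi.single_apply]
    · simp [Prod.snd_sum]
  | mul a a' ha ha' =>
    obtain ⟨c, b, rfl⟩ := ha
    obtain ⟨c', b', rfl⟩ := ha'
    have hcomm : ∀ (c : Constants N) (j : Fin q), ∃ d, gconst N q c * xi N j = xi N j * d := by
      intro c j
      induction c using ExteriorAlgebra.induction with
      | algebraMap r => exact ⟨algebraMap ℂ _ r, by rw [AlgHom.commutes, Algebra.commutes]⟩
      | ι w =>
        refine ⟨- ExteriorAlgebra.ι ℂ (0, w), ?_⟩
        rw [gconst, ExteriorAlgebra.map_apply_ι, mul_neg]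
        exact eq_neg_of_add_eq_zero_left (ExteriorAlgebra.ι_add_mul_swap _ _)
      | mul a a' ha ha' =>
        obtain ⟨d, hd⟩ := ha
        obtain ⟨d', hd'⟩ := ha'
        exact ⟨d * d', by rw [map_mul, mul_assoc, hd', ← mul_assoc, hd, mul_assoc]⟩
      | add a a' ha ha' =>
        obtain ⟨d, hd⟩ := ha
        obtain ⟨d', hd'⟩ := ha'
        exact ⟨d + d', by rw [map_add, add_mul, hd, hd', mul_add]⟩
    choose d hd using hcomm c
    refine ⟨c * c', fun j => b j * (gconst N q c' + ∑ i, xi N i * b' i) + d j * b' j, ?_⟩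
    rw [add_mul, mul_add (gconst N q c), map_mul, Finset.mul_sum, Finset.sum_mul, add_assoc,
      ← Finset.sum_add_distrib]
    congr 1
    refine Finset.sum_congr rfl fun j _ => ?_
    rw [← mul_assoc, hd]
    noncomm_ring
  | add a a' ha ha' =>
    obtain ⟨c, b, rfl⟩ := ha
    obtain ⟨c', b', rfl⟩ := ha'
    refine ⟨c + c', b + b', ?_⟩
    simp only [map_add, Pi.add_apply, mul_add, Finset.sum_add_distrib]
    abel

/-- The filtration of the Grassmann algebra by degree. -/
def gfil (N q n : ℕ) : Submodule ℂ (Grassmann N q) :=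
  (LinearMap.range (ExteriorAlgebra.ι ℂ : _ →ₗ[ℂ] Grassmann N q)) ^ n * ⊤

lemma gfil_zero : gfil N q 0 = ⊤ := by
  rw [gfil, pow_zero, one_mul]

lemma iota_mul_mem_gfil {n : ℕ} (w : (Fin q → ℂ) × (Fin N → ℂ)) {a : Grassmann N q}
    (ha : a ∈ gfil N q n) : ExteriorAlgebra.ι ℂ w * a ∈ gfil N q (n + 1) := by
  rw [gfil, pow_succ', mul_assoc]
  exact Submodule.mul_mem_mul ⟨w, rfl⟩ ha

lemma gfil_mul_right {n : ℕ} {a : Grassmann N q} (ha : a ∈ gfil N q n) (b : Grassmann N q) :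
    a * b ∈ gfil N q n := by
  have h : a * b ∈ gfil N q n * ⊤ := Submodule.mul_mem_mul ha trivial
  rw [gfil, mul_assoc] at h
  exact (mul_le_mul' le_rfl le_top : _ ≤ _ * (⊤ : Submodule ℂ (Grassmann N q))) h

lemma gfil_succ_le (n : ℕ) : gfil N q (n + 1) ≤ gfil N q n := by
  rw [gfil, pow_succ, mul_assoc]
  exact mul_le_mul' le_rfl le_top

lemma gfil_antitone : Antitone (gfil N q) := antitone_nat_of_succ_le gfil_succ_le

/-- A word that ends in a generator also begins with one, unless it is a scalar times a generator,
and scalars are central. Hence the right ideal spanned by the generators is two-sided. -/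
lemma top_mul_range_le :
    (⊤ : Submodule ℂ (Grassmann N q)) * LinearMap.range (ExteriorAlgebra.ι ℂ) ≤
      LinearMap.range (ExteriorAlgebra.ι ℂ) * ⊤ := by
  rw [Submodule.mul_le]
  rintro a - _ ⟨w, rfl⟩
  induction a using ExteriorAlgebra.induction generalizing w with
  | algebraMap r =>
    rw [Algebra.commutes]
    exact Submodule.mul_mem_mul ⟨w, rfl⟩ trivial
  | ι w' => exact Submodule.mul_mem_mul ⟨w', rfl⟩ trivial
  | mul a a' ha ha' =>
    rw [mul_assoc]
    have h1 := ha' w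
    generalize a' * ExteriorAlgebra.ι ℂ w = z at h1
    induction h1 using Submodule.mul_induction_on' with
    | mem_mul_mem m hm n hn =>
      obtain ⟨w', rfl⟩ := hm
      rw [← mul_assoc]
      have := Submodule.mul_mem_mul (ha w') (show n ∈ (⊤ : Submodule ℂ (Grassmann N q)) from trivial)
      rw [mul_assoc] at this
      exact (mul_le_mul' le_rfl le_top : _ ≤ _ * (⊤ : Submodule ℂ (Grassmann N q))) this
    | add x _ y _ hx hy => rw [mul_add]; exact add_mem hx hy
  | add a a' ha ha' => rw [add_mul]; exact add_mem (ha w) (ha' w)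

/-- The power of the space of generators is the exterior power of degree `q + N + 1` of a space of
dimension `q + N`. -/
lemma gfil_eq_bot : gfil N q (q + N + 1) = ⊥ := by
  have h : (LinearMap.range (ExteriorAlgebra.ι ℂ : _ →ₗ[ℂ] Grassmann N q)) ^ (q + N + 1) = ⊥ := by
    change (⋀[ℂ]^(q + N + 1) ((Fin q → ℂ) × (Fin N → ℂ))) = ⊥
    apply Submodule.finrank_eq_zero.1
    rw [exteriorPower.finrank_eq, Module.finrank_prod, Module.finrank_fin_fun,
      Module.finrank_fin_fun]
    exact Nat.choose_eq_zero_of_lt (by omega)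
  rw [gfil, h, Submodule.bot_mul]

end GrassmannAlgebra

/-! ### Power series over the Grassmann algebra -/

section PowerSeries

variable {N q k : ℕ}

/-- Apply an additive map to all coefficients. -/
def coeffMap (L : Grassmann N q →ₗ[ℂ] Grassmann N q) : ModelAlg N q k →ₗ[ℂ] ModelAlg N q k where
  toFun f := fun m => L (MvPowerSeries.coeff m f)
  map_add' f g := by funext m; exact L.map_add _ _
  map_smul' c f := by funext m; exact L.map_smul _ _

lemma coeff_coeffMap (L : Grassmann N q →ₗ[ℂ] Grassmann N q) (f : ModelAlg N q k)
    (m : Fin k →₀ ℕ) : MvPowerSeries.coeff m (coeffMap L f) = L (MvPowerSeries.coeff m f) := rfl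

/-- The formal derivative `∂/∂tⱼ`. -/
def tder (j : Fin k) : ModelAlg N q k →ₗ[ℂ] ModelAlg N q k where
  toFun f := fun m => ((m j + 1 : ℕ) : ℂ) • MvPowerSeries.coeff (m + Finsupp.single j 1) f
  map_add' f g := by funext m; exact (congrArg _ (map_add _ _ _)).trans (smul_add _ _ _)
  map_smul' c f := by funext m; exact smul_comm _ c _

lemma coeff_tder (j : Fin k) (f : ModelAlg N q k) (m : Fin k →₀ ℕ) :
    MvPowerSeries.coeff m (tder j f) =
      ((m j + 1 : ℕ) : ℂ) • MvPowerSeries.coeff (m + Finsupp.single j 1) f := rfl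

lemma coeff_X_mul_add (j : Fin k) (f : ModelAlg N q k) (m : Fin k →₀ ℕ) :
    MvPowerSeries.coeff (m + Finsupp.single j 1) (MvPowerSeries.X j * f) =
      MvPowerSeries.coeff m f := by
  rw [add_comm, MvPowerSeries.X, MvPowerSeries.coeff_add_monomial_mul, one_mul]

lemma coeff_X_mul_of_eq_zero (j : Fin k) (f : ModelAlg N q k) {m : Fin k →₀ ℕ} (hm : m j = 0) :
    MvPowerSeries.coeff m (MvPowerSeries.X j * f) = 0 := by
  classical
  rw [MvPowerSeries.X, MvPowerSeries.coeff_monomial_mul, if_neg]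
  intro h
  have := h j
  simp [hm] at this

lemma X_mul_injective (j : Fin k) :
    Function.Injective fun f : ModelAlg N q k => MvPowerSeries.X j * f := by
  intro f g h
  ext m
  rw [← coeff_X_mul_add j f, ← coeff_X_mul_add j g]
  exact congrArg _ h

lemma coeff_X_mul_tder (j : Fin k) (f : ModelAlg N q k) (m : Fin k →₀ ℕ) :
    MvPowerSeries.coeff m (MvPowerSeries.X j * tder j f) = ((m j : ℕ) : ℂ) •
      MvPowerSeries.coeff m f := by
  by_cases hm : m j = 0
  · rw [coeff_X_mul_of_eq_zero j _ hm, hm, Nat.cast_zero, zero_smul]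
  · obtain ⟨m, rfl⟩ : ∃ m', m = m' + Finsupp.single j 1 := by
      refine ⟨m - Finsupp.single j 1, (tsub_add_cancel_of_le ?_).symm⟩
      rw [Finsupp.single_le_iff]
      omega
    rw [coeff_X_mul_add, coeff_tder]
    simp

/-- Multiplication by `tⱼ` is injective and turns `∂/∂tⱼ` into the Euler operator, which scales the
coefficient at `m` by `m j`. The Leibniz rule becomes the additivity of `m j` over the antidiagonal.
-/
lemma tder_mul (j : Fin k) (f g : ModelAlg N q k) :
    tder j (f * g) = tder j f * g + f * tder j g := by
  classical
  apply X_mul_injective j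
  change _ * _ = _ * _
  rw [mul_add, ← mul_assoc, ← mul_assoc, (MvPowerSeries.commute_X f j).eq.symm, mul_assoc f]
  ext m
  rw [coeff_X_mul_tder, map_add, MvPowerSeries.coeff_mul, MvPowerSeries.coeff_mul,
    MvPowerSeries.coeff_mul, ← Finset.sum_add_distrib, Finset.smul_sum]
  refine Finset.sum_congr rfl fun a ha => ?_
  rw [coeff_X_mul_tder, coeff_X_mul_tder, ← Finset.HasAntidiagonal.mem_antidiagonal.1 ha, Finsupp.add_apply,
    Nat.cast_add, add_smul, smul_mul_assoc, mul_smul_comm]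

lemma coeffMap_gder_mul (j : Fin q) (f g : ModelAlg N q k) :
    coeffMap (gder j) (f * g) = coeffMap (gder j) f * g +
      ModelAlg.parity N q k f * coeffMap (gder j) g := by
  classical
  ext m
  rw [coeff_coeffMap, map_add, MvPowerSeries.coeff_mul, MvPowerSeries.coeff_mul,
    MvPowerSeries.coeff_mul, ← Finset.sum_add_distrib, map_sum]
  exact Finset.sum_congr rfl fun a _ => gder_mul j _ _

end PowerSeries

/-! ### Functions in a chart -/

lemma IsHol.holAt {p : ℕ} {E : Type} [AddCommGroup E] [Module ℂ E] {V : Opens (Fin p → ℂ)}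
    {f : V → E} (hf : IsHol f) {F : (Fin p → ℂ) → E} (hF : ∀ x : V, F x = f x) (x : V) :
    HolAt F x := by
  obtain ⟨ι, _, g, c, hg, h⟩ := hf x
  have h1 : HolAt (fun y : Fin p → ℂ => ∑ i, g i y • c i) (x : Fin p → ℂ) :=
    HolAt.sum _ fun i _ => (HolAt.const _).smul (hg i)
  refine h1.congr ?_
  have h2 : ∀ᶠ y in 𝓝 (x : Fin p → ℂ), ∀ hy : y ∈ V, f ⟨y, hy⟩ = ∑ i, g i y • c i := by
    rw [nhds_subtype_eq_comap, Filter.eventually_comap] at h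
    exact h.mono fun y hy hyV => hy ⟨y, hyV⟩ rfl
  filter_upwards [h2, V.isOpen.mem_nhds x.2] with y hy hyV
  rw [← hy hyV, ← hF ⟨y, hyV⟩]

lemma HolAt.isHol {p : ℕ} {E : Type} [AddCommGroup E] [Module ℂ E] [Module.Finite ℂ E]
    {V : Opens (Fin p → ℂ)} {F : (Fin p → ℂ) → E} (hF : ∀ x : V, HolAt F x) :
    IsHol (fun x : V => F x) := fun x =>
  ⟨Fin (Module.finrank ℂ E), inferInstance, fun i z => (Module.finBasis ℂ E).coord i (F z),
    Module.finBasis ℂ E, fun _ => hF x _, Filter.Eventually.of_forall fun y =>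
      (sum_finBasis_repr (F y)).symm⟩

/-- A function with values in the model algebra has holomorphic coefficients at `y`. -/
def HolS {N q k p : ℕ} (F : (Fin p → ℂ) → ModelAlg N q k) (y : Fin p → ℂ) : Prop :=
  ∀ m : Fin k →₀ ℕ, HolAt (fun z => MvPowerSeries.coeff m (F z)) y

/-- The index set of the coordinates: even, formal even, and odd ones. -/
abbrev Idx (p k q : ℕ) : Type := Fin p ⊕ Fin k ⊕ Fin q

/-- The parity of a coordinate. -/
def ipar {p k q : ℕ} : Idx p k q → ZMod 2 := Sum.elim (fun _ => 0) (Sum.elim (fun _ => 0) fun _ => 1)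

/-- The coordinates as functions with values in the model algebra. -/
def coordVal (N : ℕ) {p k q : ℕ} : Idx p k q → (Fin p → ℂ) → ModelAlg N q k
  | .inl i => fun y => MvPowerSeries.C (algebraMap ℂ _ (y i))
  | .inr (.inl j) => fun _ => MvPowerSeries.X j
  | .inr (.inr j) => fun _ => MvPowerSeries.C (xi N j)

/-- The coordinate derivatives of functions with values in the model algebra. -/
def mder {N p k q : ℕ} : Idx p k q → ((Fin p → ℂ) → ModelAlg N q k) → (Fin p → ℂ) → ModelAlg N q k
  | .inl i => fun F y m => pd i (fun z => MvPowerSeries.coeff m (F z)) y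
  | .inr (.inl j) => fun F y => tder j (F y)
  | .inr (.inr j) => fun F y => coeffMap (gder j) (F y)

section ModelDerivatives

variable {N p k q : ℕ} {F F' : (Fin p → ℂ) → ModelAlg N q k} {y : Fin p → ℂ}

lemma HolS.const (a : ModelAlg N q k) : HolS (fun _ => a) y := fun _ => HolAt.const _

lemma HolS.of_C {a : (Fin p → ℂ) → Grassmann N q} (ha : HolAt a y) :
    HolS (fun z => (MvPowerSeries.C (a z) : ModelAlg N q k)) y := fun m => by
  classical
  simp only [MvPowerSeries.coeff_C]
  by_cases hm : m = 0
  · simpa [hm] using ha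
  · simpa [hm] using HolAt.const (0 : Grassmann N q)

lemma analyticAt_coord (i : Fin p) : AnalyticAt ℂ (fun z : Fin p → ℂ => z i) y :=
  (ContinuousLinearMap.proj (R := ℂ) (φ := fun _ : Fin p => ℂ) i).analyticAt y

lemma holS_coordVal (i : Idx p k q) : HolS (coordVal N i) y := by
  rcases i with i | j | j
  · refine HolS.of_C ?_
    exact (AnalyticAt.holAt (analyticAt_coord i)).comp_linear
      (Algebra.linearMap ℂ (Grassmann N q))
  · exact HolS.const _
  · exact HolS.const _

lemma HolS.mder (hF : HolS F y) (i : Idx p k q) : HolS (mder i F) y := by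
  rcases i with i | j | j
  · exact fun m => (hF m).pd i
  · exact fun m => (hF _).comp_linear (((m j + 1 : ℕ) : ℂ) • LinearMap.id)
  · exact fun m => (hF m).comp_linear (gder j)

lemma mder_congr (i : Idx p k q) (h : F =ᶠ[𝓝 y] F') :
    SuperGeom.mder i F y = SuperGeom.mder i F' y := by
  rcases i with i | j | j
  · funext m
    exact pd_congr i (h.mono fun z hz => by simp [hz])
  · exact congrArg (tder j) h.self_of_nhds
  · exact congrArg (coeffMap (gder j)) h.self_of_nhds

lemma mder_add (i : Idx p k q) (hF : HolS F y) (hF' : HolS F' y) :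
    SuperGeom.mder i (fun z => F z + F' z) y = SuperGeom.mder i F y + SuperGeom.mder i F' y := by
  rcases i with i | j | j
  · funext m
    change pd i (fun z => MvPowerSeries.coeff m (F z + F' z)) y = _
    simp only [map_add]
    exact (hF m).pd_add (hF' m) i
  · exact map_add (tder j) _ _
  · exact map_add (coeffMap (gder j)) _ _

lemma mder_smul (i : Idx p k q) (c : ℂ) (hF : HolS F y) :
    SuperGeom.mder i (fun z => c • F z) y = c • SuperGeom.mder i F y := by
  rcases i with i | j | j
  · funext m
    have h := (hF m).linear_pd (c • LinearMap.id) i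
    simp only [LinearMap.smul_apply, LinearMap.id_apply] at h
    change pd i (fun z => c • MvPowerSeries.coeff m (F z)) y = _
    exact h.symm
  · exact map_smul (tder j) _ _
  · exact map_smul (coeffMap (gder j)) _ _

/-- The power `ε ↦ ε ^ a` of the parity involution, for `a` in `ℤ/2`. -/
def parPow (N q k : ℕ) (a : ZMod 2) (f : ModelAlg N q k) : ModelAlg N q k :=
  if a = 0 then f else ModelAlg.parity N q k f

/-- The twist by `parPow` is the sign of moving the derivative past `F`, in a form valid for
inhomogeneous `F`. -/
lemma mder_mul (i : Idx p k q) (hF : HolS F y) (hF' : HolS F' y) :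
    SuperGeom.mder i (fun z => F z * F' z) y =
      SuperGeom.mder i F y * F' y + parPow N q k (ipar i) (F y) * SuperGeom.mder i F' y := by
  classical
  rcases i with i | j | j
  · ext m
    change pd i (fun z => MvPowerSeries.coeff m (F z * F' z)) y = _
    simp only [map_add, MvPowerSeries.coeff_mul]
    rw [HolAt.pd_sum (f := fun (a : (Fin k →₀ ℕ) × (Fin k →₀ ℕ)) z => MvPowerSeries.coeff a.1 (F z) * MvPowerSeries.coeff a.2 (F' z))
      _ fun a _ => HolAt.bilin (LinearMap.mul ℂ (Grassmann N q)) (hF a.1) (hF' a.2), ← Finset.sum_add_distrib]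
    exact Finset.sum_congr rfl fun a _ =>
      HolAt.pd_bilin (LinearMap.mul ℂ (Grassmann N q)) (hF a.1) (hF' a.2) i
  · exact tder_mul j _ _
  · exact coeffMap_gder_mul j _ _

lemma parity_mder (i : Idx p k q) (hF : HolS F y) :
    ModelAlg.parity N q k (SuperGeom.mder i F y) =
      sgn 1 (ipar i) • SuperGeom.mder i (fun z => ModelAlg.parity N q k (F z)) y := by
  have h0 : sgn 1 0 = 1 := by decide
  have h1 : sgn 1 1 = -1 := by decide
  rcases i with i | j | j
  · change _ = sgn 1 0 • _
    rw [h0, one_smul]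
    funext m
    exact (hF m).linear_pd (ginv : Grassmann N q →ₐ[ℂ] Grassmann N q).toLinearMap i
  · change _ = sgn 1 0 • _
    rw [h0, one_smul]
    funext m
    exact map_smul (ginv : Grassmann N q →ₐ[ℂ] Grassmann N q) _ _
  · change _ = sgn 1 1 • _
    rw [h1, neg_one_zsmul]
    funext m
    exact ginv_gder j _

lemma tder_C (j : Fin k) (a : Grassmann N q) : tder j (MvPowerSeries.C a) = 0 := by
  classical
  ext m
  rw [coeff_tder, MvPowerSeries.coeff_C, if_neg, smul_zero, map_zero]
  intro h
  have := DFunLike.congr_fun h j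
  simp at this

lemma mder_C (i : Idx p k q) (c : Constants N) :
    SuperGeom.mder i (fun _ => MvPowerSeries.C (gconst N q c)) y = 0 := by
  classical
  rcases i with i | j | j
  · funext m
    exact pd_const i _
  · exact tder_C j _
  · ext m
    change gder j (MvPowerSeries.coeff m (MvPowerSeries.C (gconst N q c))) = _
    rw [MvPowerSeries.coeff_C, map_zero]
    split_ifs
    · exact gder_gconst j c
    · exact map_zero _

lemma mder_coordVal (i j : Idx p k q) :
    SuperGeom.mder i (coordVal N j) y = if j = i then 1 else 0 := by
  classical
  rcases i with i | i | i <;> rcases j with j | j | j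
  · ext m
    change pd i (fun z => MvPowerSeries.coeff m (MvPowerSeries.C (algebraMap ℂ _ (z j)))) y = _
    simp only [MvPowerSeries.coeff_C]
    by_cases hm : m = 0
    · subst hm
      simp only [if_true]
      have h1 := (AnalyticAt.holAt (analyticAt_coord (y := y) j)).linear_pd
        (Algebra.linearMap ℂ (Grassmann N q)) i
      simp only [Algebra.linearMap_apply] at h1
      rw [← h1, pd_eq_fderiv (analyticAt_coord j)]
      have h2 : fderiv ℂ (fun z : Fin p → ℂ => z j) y =
          ContinuousLinearMap.proj (R := ℂ) (φ := fun _ : Fin p => ℂ) j :=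
        (ContinuousLinearMap.proj (R := ℂ) (φ := fun _ : Fin p => ℂ) j).fderiv
      rw [h2]
      by_cases hij : j = i
      · subst hij; simp
      · simp [hij]
    · simp only [if_neg hm, pd_const]
      split_ifs
      · simp [MvPowerSeries.coeff_one, hm]
      · simp
  · rw [if_neg (by simp)]
    funext m
    exact pd_const i _
  · rw [if_neg (by simp)]
    funext m
    exact pd_const i _
  · rw [if_neg (by simp)]
    exact tder_C i _
  · ext m
    change MvPowerSeries.coeff m (tder i (MvPowerSeries.X j)) = _
    rw [coeff_tder, MvPowerSeries.coeff_X]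
    by_cases hij : j = i
    · subst hij
      by_cases hm : m = 0
      · subst hm; simp
      · rw [if_neg (by simpa using hm), if_pos rfl, MvPowerSeries.coeff_one, if_neg hm, smul_zero]
    · rw [if_neg, if_neg (by simpa using hij), smul_zero, map_zero]
      intro h
      have := DFunLike.congr_fun h i
      simp [hij] at this
  · rw [if_neg (by simp)]
    exact tder_C i _
  · rw [if_neg (by simp)]
    ext m
    change gder i (MvPowerSeries.coeff m (MvPowerSeries.C (algebraMap ℂ _ (y j)))) = _
    rw [MvPowerSeries.coeff_C, map_zero]
    split_ifs
    · exact gder_algebraMap i _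
    · exact map_zero _
  · rw [if_neg (by simp)]
    ext m
    change gder i (MvPowerSeries.coeff m (MvPowerSeries.X j)) = _
    rw [MvPowerSeries.coeff_X, map_zero]
    split_ifs
    · rw [← map_one (algebraMap ℂ _), gder_algebraMap]
    · exact map_zero _
  · ext m
    change gder i (MvPowerSeries.coeff m (MvPowerSeries.C (xi N j))) = _
    rw [MvPowerSeries.coeff_C]
    by_cases hm : m = 0
    · subst hm
      rw [if_pos rfl, gder_xi]
      by_cases hij : j = i
      · subst hij; simp
      · simp [hij]
    · rw [if_neg hm, map_zero]
      split_ifs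
      · simp [MvPowerSeries.coeff_one, hm]
      · simp

end ModelDerivatives

namespace SuperSpace.Chart

variable {N : ℕ} {M : Type u} [TopologicalSpace M] {S : SuperSpace.{u, v} N M} {p k q : ℕ}
  (φ : S.Chart p k q)

lemma subset_source {φ : S.Chart p k q} {U V : Opens M} (h : V ≤ U)
    (hU : (U : Set M) ⊆ φ.e.source) : (V : Set M) ⊆ φ.e.source := fun _ hy => hU (h hy)

/-- A function on an open subset of a chart, as a function on `ℂ^p` with values in the model algebra
(extended by zero). -/
def rep {V : Opens M} (hV : (V : Set M) ⊆ φ.e.source) (f : S.O V) (y : Fin p → ℂ) :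
    ModelAlg N q k :=
  open Classical in if h : y ∈ φ.e '' V then (φ.iso V hV f).1 ⟨y, h⟩ else 0

variable {φ} {V W : Opens M} {hV : (V : Set M) ⊆ φ.e.source} {x : M}

lemma rep_apply (f : S.O V) (hx : x ∈ V) :
    φ.rep hV f (φ.e x) = (φ.iso V hV f).1 ⟨φ.e x, x, hx, rfl⟩ :=
  dif_pos _

lemma rep_add (f g : S.O V) (hx : x ∈ V) :
    φ.rep hV (f + g) (φ.e x) = φ.rep hV f (φ.e x) + φ.rep hV g (φ.e x) := by
  rw [rep_apply _ hx, rep_apply _ hx, rep_apply _ hx, map_add]; rfl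

lemma rep_zero (hx : x ∈ V) : φ.rep hV (0 : S.O V) (φ.e x) = 0 := by
  rw [rep_apply _ hx, map_zero]; rfl

lemma rep_sub (f g : S.O V) (hx : x ∈ V) :
    φ.rep hV (f - g) (φ.e x) = φ.rep hV f (φ.e x) - φ.rep hV g (φ.e x) := by
  rw [rep_apply _ hx, rep_apply _ hx, rep_apply _ hx, map_sub]; rfl

lemma rep_mul (f g : S.O V) (hx : x ∈ V) :
    φ.rep hV (f * g) (φ.e x) = φ.rep hV f (φ.e x) * φ.rep hV g (φ.e x) := by
  rw [rep_apply _ hx, rep_apply _ hx, rep_apply _ hx, map_mul]; rfl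

lemma rep_one (hx : x ∈ V) : φ.rep hV (1 : S.O V) (φ.e x) = 1 := by
  rw [rep_apply _ hx, map_one]; rfl

lemma rep_smul (c : ℂ) (f : S.O V) (hx : x ∈ V) :
    φ.rep hV (c • f) (φ.e x) = c • φ.rep hV f (φ.e x) := by
  rw [rep_apply _ hx, rep_apply _ hx, map_smul]; rfl

lemma rep_zsmul (n : ℤ) (f : S.O V) (hx : x ∈ V) :
    φ.rep hV (n • f) (φ.e x) = n • φ.rep hV f (φ.e x) := by
  rw [rep_apply _ hx, rep_apply _ hx, map_zsmul]; rfl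

lemma rep_sum {J : Type*} (s : Finset J) (f : J → S.O V) (hx : x ∈ V) :
    φ.rep hV (∑ j ∈ s, f j) (φ.e x) = ∑ j ∈ s, φ.rep hV (f j) (φ.e x) := by
  classical
  induction s using Finset.induction_on with
  | empty => simpa using rep_zero hx
  | insert a s ha ih => rw [Finset.sum_insert ha, Finset.sum_insert ha, rep_add _ _ hx, ih]

lemma rep_res {hW : (W : Set M) ⊆ φ.e.source} (h : W ≤ V) (f : S.O V) (hx : x ∈ W) :
    φ.rep hW (S.res h f) (φ.e x) = φ.rep hV f (φ.e x) := by
  rw [rep_apply _ hx, rep_apply _ (h hx)]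
  exact φ.iso_res V W hV h f x hx

lemma rep_par (f : S.O V) (hx : x ∈ V) :
    φ.rep hV (S.par V f) (φ.e x) = ModelAlg.parity N q k (φ.rep hV f (φ.e x)) := by
  rw [rep_apply _ hx, rep_apply _ hx]
  exact φ.iso_par V hV f x hx

lemma rep_const (c : Constants N) (hx : x ∈ V) :
    φ.rep hV (S.const V c) (φ.e x) = MvPowerSeries.C (gconst N q c) := by
  rw [rep_apply _ hx]
  exact φ.iso_const V hV c x hx

lemma holS_rep (f : S.O V) (hx : x ∈ V) : HolS (φ.rep hV f) (φ.e x) := fun m =>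
  IsHol.holAt ((φ.iso V hV f).2 m) (fun y => congrArg _ (dif_pos y.2)) ⟨φ.e x, x, hx, rfl⟩

lemma rep_ext {f g : S.O V} (h : ∀ x ∈ V, φ.rep hV f (φ.e x) = φ.rep hV g (φ.e x)) : f = g := by
  apply (φ.iso V hV).injective
  apply Subtype.ext
  funext ⟨y, x, hx, hy⟩
  subst hy
  rw [← rep_apply f hx, ← rep_apply g hx, h x hx]

variable (φ) in
/-- The function on an open subset of a chart with given values in the model algebra. -/
def ofRep {V : Opens M} (hV : (V : Set M) ⊆ φ.e.source) (F : (Fin p → ℂ) → ModelAlg N q k)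
    (hF : ∀ x ∈ V, HolS F (φ.e x)) : S.O V :=
  (φ.iso V hV).symm ⟨fun y => F y, fun m => HolAt.isHol
    (V := ⟨φ.e '' V, φ.e.isOpen_image_of_subset_source V.isOpen hV⟩)
    (F := fun z => MvPowerSeries.coeff m (F z)) (by rintro ⟨_, x, hx, rfl⟩; exact hF x hx m)⟩

lemma rep_ofRep {F : (Fin p → ℂ) → ModelAlg N q k} (hF : ∀ x ∈ V, HolS F (φ.e x)) (hx : x ∈ V) :
    φ.rep hV (φ.ofRep hV F hF) (φ.e x) = F (φ.e x) := by
  rw [rep_apply _ hx, ofRep, AlgEquiv.apply_symm_apply]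

lemma eventually_image {Q : (Fin p → ℂ) → Prop} (hV : (V : Set M) ⊆ φ.e.source) (hx : x ∈ V)
    (h : ∀ x' ∈ V, Q (φ.e x')) : ∀ᶠ y in 𝓝 (φ.e x), Q y := by
  have : φ.e '' V ∈ 𝓝 (φ.e x) :=
    (φ.e.isOpen_image_of_subset_source V.isOpen hV).mem_nhds ⟨x, hx, rfl⟩
  filter_upwards [this]
  rintro _ ⟨x', hx', rfl⟩
  exact h x' hx'

lemma exists_nhd {Q : (Fin p → ℂ) → Prop} (hV : (V : Set M) ⊆ φ.e.source) (hx : x ∈ V)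
    (h : ∀ᶠ y in 𝓝 (φ.e x), Q y) : ∃ W : Opens M, W ≤ V ∧ x ∈ W ∧ ∀ x' ∈ W, Q (φ.e x') := by
  obtain ⟨O, hO, hO', hxO⟩ := eventually_nhds_iff.1 h
  refine ⟨V ⊓ ⟨φ.e.source ∩ φ.e ⁻¹' O, φ.e.isOpen_inter_preimage hO'⟩, inf_le_left,
    ⟨hx, hV hx, hxO⟩, fun x' hx' => hO _ hx'.2.2⟩

lemma eventuallyEq_rep_ofRep {F : (Fin p → ℂ) → ModelAlg N q k} (hF : ∀ x ∈ V, HolS F (φ.e x))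
    (hx : x ∈ V) : φ.rep hV (φ.ofRep hV F hF) =ᶠ[𝓝 (φ.e x)] F :=
  eventually_image hV hx fun _ hx' => rep_ofRep hF hx'

/-! #### Coordinates -/

variable (φ) in
/-- The coordinate functions on an open subset of a chart. -/
def coord (i : Idx p k q) (hV : (V : Set M) ⊆ φ.e.source) : S.O V :=
  φ.ofRep hV (coordVal N i) fun _ _ => holS_coordVal i

lemma rep_coord (i : Idx p k q) (hx : x ∈ V) :
    φ.rep hV (φ.coord i hV) (φ.e x) = coordVal N i (φ.e x) := rep_ofRep _ hx

lemma eventuallyEq_rep_coord (i : Idx p k q) (hx : x ∈ V) :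
    φ.rep hV (φ.coord i hV) =ᶠ[𝓝 (φ.e x)] coordVal N i :=
  eventuallyEq_rep_ofRep (fun _ _ => holS_coordVal i) hx

lemma res_coord {hW : (W : Set M) ⊆ φ.e.source} (i : Idx p k q) (h : W ≤ V) :
    S.res h (φ.coord i hV) = φ.coord i hW :=
  rep_ext (hV := hW) fun x hx => by rw [rep_res (hV := hV) h _ hx, rep_coord i (h hx), rep_coord i hx]

lemma isHom_coord (i : Idx p k q) : S.IsHom (ipar i) (φ.coord i hV) := by
  classical
  refine rep_ext (hV := hV) fun x hx => ?_
  rw [rep_par _ hx, rep_zsmul _ _ hx, rep_coord i hx]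
  have h0 : sgn 1 0 = 1 := by decide
  have h1 : sgn 1 1 = -1 := by decide
  rcases i with i | j | j
  · change _ = sgn 1 0 • _
    rw [h0, one_smul]
    ext m
    change ginv (MvPowerSeries.coeff m (MvPowerSeries.C _)) =
      MvPowerSeries.coeff m (MvPowerSeries.C _)
    rw [MvPowerSeries.coeff_C]
    split_ifs
    · exact AlgHom.commutes _ _
    · exact map_zero _
  · change _ = sgn 1 0 • _
    rw [h0, one_smul]
    ext m
    change ginv (MvPowerSeries.coeff m (MvPowerSeries.X j)) =
      MvPowerSeries.coeff m (MvPowerSeries.X j)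
    rw [MvPowerSeries.coeff_X]
    split_ifs
    · exact map_one _
    · exact map_zero _
  · change _ = sgn 1 1 • _
    rw [h1, neg_one_zsmul]
    ext m
    rw [map_neg]
    change ginv (MvPowerSeries.coeff m (MvPowerSeries.C _)) =
      -MvPowerSeries.coeff m (MvPowerSeries.C _)
    rw [MvPowerSeries.coeff_C]
    split_ifs
    · exact ginv_xi j
    · simp

variable (φ) in
/-- The coordinate derivatives of functions on an open subset of a chart. -/
def dO (i : Idx p k q) (hV : (V : Set M) ⊆ φ.e.source) : Module.End ℂ (S.O V) where
  toFun f := φ.ofRep hV (mder i (φ.rep hV f)) fun _ hx => (holS_rep f hx).mder i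
  map_add' f g := rep_ext (hV := hV) fun x hx => by
    rw [rep_ofRep _ hx, rep_add _ _ hx, rep_ofRep _ hx, rep_ofRep _ hx,
      ← mder_add i (holS_rep f hx) (holS_rep g hx)]
    exact mder_congr i (eventually_image hV hx fun _ hx' => rep_add _ _ hx')
  map_smul' c f := rep_ext (hV := hV) fun x hx => by
    rw [rep_ofRep _ hx, RingHom.id_apply, rep_smul _ _ hx, rep_ofRep _ hx,
      ← mder_smul i c (holS_rep f hx)]
    exact mder_congr i (eventually_image hV hx fun _ hx' => rep_smul _ _ hx')

lemma rep_dO (i : Idx p k q) (f : S.O V) (hx : x ∈ V) :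
    φ.rep hV (φ.dO i hV f) (φ.e x) = mder i (φ.rep hV f) (φ.e x) :=
  rep_ofRep (fun _ hx => (holS_rep f hx).mder i) hx

lemma dO_coord (i j : Idx p k q) :
    φ.dO i hV (φ.coord j hV) = if j = i then 1 else 0 := rep_ext (hV := hV) fun x hx => by
  rw [rep_dO i _ hx, mder_congr i (eventuallyEq_rep_coord j hx), mder_coordVal]
  split_ifs
  · exact (rep_one hx).symm
  · exact (rep_zero hx).symm

lemma res_dO {hW : (W : Set M) ⊆ φ.e.source} (i : Idx p k q) (h : W ≤ V) (f : S.O V) :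
    S.res h (φ.dO i hV f) = φ.dO i hW (S.res h f) := rep_ext (hV := hW) fun x hx => by
  rw [rep_res (hV := hV) h _ hx, rep_dO i _ (h hx), rep_dO i _ hx]
  exact mder_congr i (eventually_image hW hx
    fun _ hx' => (rep_res h _ hx').symm)

variable (φ) in
/-- The coordinate derivatives as endomorphisms of the structure sheaf of a chart. -/
def dEnd (i : Idx p k q) {U : Opens M} (hU : (U : Set M) ⊆ φ.e.source) : S.SheafEnd U :=
  ⟨fun V => φ.dO i (subset_source V.2 hU), fun _ _ h f => res_dO i h f⟩

lemma isDer_dEnd (i : Idx p k q) {U : Opens M} (hU : (U : Set M) ⊆ φ.e.source) :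
    S.IsDer (ipar i) (φ.dEnd i hU) where
  parity V h f := rep_ext (hV := subset_source h hU) fun x hx => by
    change φ.rep (subset_source h hU) (S.par V (φ.dO i (subset_source h hU) f)) _ = φ.rep (subset_source h hU) (_ • φ.dO i (subset_source h hU) (S.par V f)) _
    rw [rep_par _ hx, rep_zsmul _ _ hx, rep_dO i _ hx, rep_dO i _ hx,
      parity_mder i (holS_rep f hx)]
    congr 1
    exact mder_congr i (eventually_image (subset_source h hU) hx
      fun _ hx' => (rep_par _ hx').symm)
  leibniz V h c f g hf := rep_ext (hV := subset_source h hU) fun x hx => by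
    change φ.rep (subset_source h hU) (φ.dO i (subset_source h hU) (f * g)) _ =
      φ.rep (subset_source h hU) (φ.dO i (subset_source h hU) f * g + sgn (ipar i) c • (f * φ.dO i (subset_source h hU) g)) _
    rw [rep_add _ _ hx, rep_zsmul _ _ hx, rep_mul _ _ hx, rep_mul _ _ hx, rep_dO i _ hx,
      rep_dO i _ hx, rep_dO i _ hx,
      mder_congr (F' := fun z => φ.rep (subset_source h hU) f z *
        φ.rep (subset_source h hU) g z) i
        (eventually_image (subset_source h hU) hx fun _ hx' => rep_mul f g hx'),
      mder_mul i (holS_rep f hx) (holS_rep g hx), ← smul_mul_assoc]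
    congr 2
    have hf' : φ.rep (subset_source h hU) (S.par V f) (φ.e x) =
        φ.rep (subset_source h hU) (sgn 1 c • f) (φ.e x) := by rw [hf.eq]
    rw [rep_par _ hx, rep_zsmul _ _ hx] at hf'
    obtain hi | hi := zmod_two_cases (ipar i) <;> rw [hi]
    · rw [sgn_zero_left, one_smul]; rfl
    · exact hf'
  const V h c := rep_ext (hV := subset_source h hU) fun x hx => by
    change φ.rep (subset_source h hU) (φ.dO i (subset_source h hU) (S.const V c)) _ = φ.rep (subset_source h hU) 0 _
    rw [rep_zero hx, rep_dO i _ hx, ← mder_C (y := φ.e x) i c]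
    exact mder_congr i (eventually_image (subset_source h hU) hx
      fun _ hx' => rep_const c hx')

end SuperSpace.Chart

/-! ### Vector fields on superspaces -/

namespace SuperSpace

variable {N : ℕ} {M : Type u} [TopologicalSpace M] {S : SuperSpace.{u, v} N M}

/-- Both sections glue the restrictions of `f`, and gluing is unique. -/
lemma eq_of_iSup_eq {ι : Type u} (W : ι → Opens M) {U : Opens M} (hU : iSup W = U) (f g : S.O U)
    (h : ∀ i (hi : W i ≤ U), S.res hi f = S.res hi g) : f = g := by
  subst hU
  have key := S.isSheaf W (fun i => S.res (le_iSup W i) f) fun i j =>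
    (S.res_res (le_iSup W i) inf_le_left f).trans (S.res_res (le_iSup W j) inf_le_right f).symm
  exact key.unique (fun i => rfl) fun i => (h i (le_iSup W i)).symm

lemma eq_of_locally {U : Opens M} {f g : S.O U}
    (h : ∀ x ∈ U, ∃ (V : Opens M) (hV : V ≤ U), x ∈ V ∧ S.res hV f = S.res hV g) : f = g := by
  choose V hV hx e using h
  refine eq_of_iSup_eq (fun x : U => V x.1 x.2) ?_ f g fun x hi => e x.1 x.2
  refine le_antisymm (iSup_le fun x => hV x.1 x.2) fun x hxU => ?_
  exact (le_iSup (fun x : U => V x.1 x.2) ⟨x, hxU⟩) (hx x hxU)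

lemma isHom_zero {U : Opens M} (a : ZMod 2) : S.IsHom a (0 : S.O U) := by
  rw [IsHom, map_zero, smul_zero]

lemma IsHom.mul {U : Opens M} {a b : ZMod 2} {f g : S.O U} (hf : S.IsHom a f) (hg : S.IsHom b g) :
    S.IsHom (a + b) (f * g) := by
  rw [IsHom, map_mul, hf.eq, hg.eq, smul_mul_smul_comm, sgn_one_add]

lemma IsHom.add {U : Opens M} {a : ZMod 2} {f g : S.O U} (hf : S.IsHom a f) (hg : S.IsHom a g) :
    S.IsHom a (f + g) := by
  rw [IsHom, map_add, hf.eq, hg.eq, smul_add]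

lemma IsHom.sub {U : Opens M} {a : ZMod 2} {f g : S.O U} (hf : S.IsHom a f) (hg : S.IsHom a g) :
    S.IsHom a (f - g) := by
  rw [IsHom, map_sub, hf.eq, hg.eq, smul_sub]

lemma isHom_algebraMap {U : Opens M} (c : ℂ) : S.IsHom 0 (algebraMap ℂ (S.O U) c) := by
  rw [IsHom, AlgHom.commutes, show sgn 1 0 = 1 by decide, one_smul]

lemma isHom_one {U : Opens M} : S.IsHom 0 (1 : S.O U) := by
  simpa using isHom_algebraMap (S := S) (U := U) 1

namespace T

variable {U V W : Opens M}

lemma ext {X Y : S.T U} (h : ∀ V (hV : V ≤ U) f, X.toEnd.app V hV f = Y.toEnd.app V hV f) :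
    X = Y := Subtype.ext (SheafEnd.ext h)

lemma res_app (X : S.T U) (hV : V ≤ U) (h : W ≤ V) (f : S.O V) :
    S.res h (X.toEnd.app V hV f) = X.toEnd.app W (h.trans hV) (S.res h f) :=
  X.toEnd.2 ⟨V, hV⟩ ⟨W, h.trans hV⟩ h f

lemma res_deriv (X : S.T U) (h : V ≤ U) (f : S.O U) :
    S.res h (X.deriv f) = (X.restrict h).deriv (S.res h f) := X.res_app le_rfl h f

lemma eq_of_locally {X Y : S.T U}
    (h : ∀ x ∈ U, ∃ (V : Opens M) (hV : V ≤ U), x ∈ V ∧ X.restrict hV = Y.restrict hV) : X = Y := by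
  refine T.ext fun W hW f => SuperSpace.eq_of_locally fun x hx => ?_
  obtain ⟨V, hV, hxV, e⟩ := h x (hW hx)
  refine ⟨V ⊓ W, inf_le_right, ⟨hxV, hx⟩, ?_⟩
  rw [X.res_app hW, Y.res_app hW]
  exact congrArg (fun Z : S.T V => Z.toEnd.app (V ⊓ W) inf_le_left (S.res inf_le_right f)) e

lemma deriv_add (X : S.T U) (f g : S.O U) : X.deriv (f + g) = X.deriv f + X.deriv g :=
  map_add (X.toEnd.app U le_rfl) f g

lemma deriv_zero (X : S.T U) : X.deriv 0 = 0 := map_zero (X.toEnd.app U le_rfl)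

lemma add_deriv (X Y : S.T U) (f : S.O U) : (X + Y).deriv f = X.deriv f + Y.deriv f := rfl

lemma zero_deriv (f : S.O U) : (0 : S.T U).deriv f = 0 := rfl

lemma sub_deriv (X Y : S.T U) (f : S.O U) : (X - Y).deriv f = X.deriv f - Y.deriv f := rfl

lemma smul_deriv (g : S.O U) (X : S.T U) (f : S.O U) : (g • X).deriv f = g * X.deriv f :=
  congrArg (· * X.deriv f) (S.res_self g)

lemma sum_deriv {J : Type*} (s : Finset J) (X : J → S.T U) (f : S.O U) :
    (∑ j ∈ s, X j).deriv f = ∑ j ∈ s, (X j).deriv f := by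
  classical
  induction s using Finset.induction_on with
  | empty => rfl
  | insert a s ha ih => rw [Finset.sum_insert ha, Finset.sum_insert ha, add_deriv, ih]

lemma restrict_zero (h : V ≤ U) : (0 : S.T U).restrict h = 0 := rfl

lemma restrict_sub (h : V ≤ U) (X Y : S.T U) : (X - Y).restrict h = X.restrict h - Y.restrict h :=
  rfl

lemma restrict_zsmul (h : V ≤ U) (n : ℤ) (X : S.T U) : (n • X).restrict h = n • X.restrict h := rfl

lemma restrict_restrict (h : V ≤ U) (h' : W ≤ V) (X : S.T U) :
    (X.restrict h).restrict h' = X.restrict (h'.trans h) := rfl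

lemma restrict_sum {J : Type*} (h : V ≤ U) (s : Finset J) (X : J → S.T U) :
    (∑ j ∈ s, X j).restrict h = ∑ j ∈ s, (X j).restrict h := by
  classical
  induction s using Finset.induction_on with
  | empty => rfl
  | insert a s ha ih => rw [Finset.sum_insert ha, Finset.sum_insert ha, restrict_add, ih]

/-! #### Parity -/

lemma IsHom.restrict {a : ZMod 2} {X : S.T U} (hX : X.IsHom a) (h : V ≤ U) :
    (X.restrict h).IsHom a := IsDer.restrict h hX

lemma isHom_zero (a : ZMod 2) : (0 : S.T U).IsHom a := IsDer.zero a

lemma IsHom.zsmul {a : ZMod 2} {X : S.T U} (n : ℤ) (hX : X.IsHom a) : (n • X).IsHom a := by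
  have h := T.IsHom.smul (isHom_algebraMap (S := S) (U := U) n) hX
  rwa [zero_add, map_intCast, Int.cast_smul_eq_zsmul] at h

lemma IsHom.neg {a : ZMod 2} {X : S.T U} (hX : X.IsHom a) : (-X).IsHom a := by
  simpa using hX.zsmul (-1)

lemma IsHom.sub {a : ZMod 2} {X Y : S.T U} (hX : X.IsHom a) (hY : Y.IsHom a) :
    (X - Y).IsHom a := by
  rw [sub_eq_add_neg]; exact hX.add hY.neg

lemma IsHom.sum {J : Type*} {a : ZMod 2} (s : Finset J) {X : J → S.T U}
    (hX : ∀ j ∈ s, (X j).IsHom a) : (∑ j ∈ s, X j).IsHom a := by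
  classical
  induction s using Finset.induction_on with
  | empty => exact isHom_zero a
  | insert b s hb ih =>
    rw [Finset.sum_insert hb]
    exact (hX b (by simp)).add (ih fun j hj => hX j (by simp [hj]))

lemma IsHom.deriv {a c : ZMod 2} {X : S.T U} {f : S.O U} (hX : X.IsHom a) (hf : S.IsHom c f) :
    S.IsHom (a + c) (X.deriv f) := IsDer.isHom hX le_rfl hf

lemma IsHom.deriv_mul {a c : ZMod 2} {X : S.T U} {f : S.O U} (hX : X.IsHom a) (hf : S.IsHom c f)
    (g : S.O U) : X.deriv (f * g) = X.deriv f * g + sgn a c • (f * X.deriv g) :=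
  hX.leibniz U le_rfl c f g hf

/-- The homogeneous components of a vector field. -/
def hp (a : ZMod 2) (X : S.T U) : S.T U := T.ofDer (X.toEnd.homPart a) (isDer_homPart a X)

lemma isHom_hp (a : ZMod 2) (X : S.T U) : (X.hp a).IsHom a := isDer_homPart a X

lemma hp_add_hp (X : S.T U) : X.hp 0 + X.hp 1 = X := by
  obtain ⟨_, D₀, D₁, h₀, h₁, rfl⟩ := X
  refine Subtype.ext ?_
  change (D₀ + D₁).homPart 0 + (D₀ + D₁).homPart 1 = _
  rw [homPart_zero h₀ h₁, homPart_one h₀ h₁]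

lemma hp_zero_add {X Y : S.T U} (hX : X.IsHom 0) (hY : Y.IsHom 1) : (X + Y).hp 0 = X :=
  Subtype.ext (homPart_zero hX hY)

lemma hp_one_add {X Y : S.T U} (hX : X.IsHom 0) (hY : Y.IsHom 1) : (X + Y).hp 1 = Y :=
  Subtype.ext (homPart_one hX hY)

lemma IsHom.hp_self {a : ZMod 2} {X : S.T U} (hX : X.IsHom a) : X.hp a = X := by
  obtain rfl | rfl := zmod_two_cases a
  · simpa using hp_zero_add hX (isHom_zero 1)
  · simpa using hp_one_add (isHom_zero 0) hX

lemma IsHom.hp_of_ne {a b : ZMod 2} {X : S.T U} (hX : X.IsHom a) (h : b ≠ a) : X.hp b = 0 := by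
  obtain rfl | rfl := zmod_two_cases a <;> obtain rfl | rfl := zmod_two_cases b
  · exact absurd rfl h
  · simpa using hp_one_add hX (isHom_zero 1)
  · simpa using hp_zero_add (isHom_zero 0) hX
  · exact absurd rfl h

lemma hp_add (a : ZMod 2) (X Y : S.T U) : (X + Y).hp a = X.hp a + Y.hp a := by
  have e : X + Y = (X.hp 0 + Y.hp 0) + (X.hp 1 + Y.hp 1) := by
    rw [add_add_add_comm, hp_add_hp, hp_add_hp]
  conv_lhs => rw [e]
  obtain rfl | rfl := zmod_two_cases a
  · exact hp_zero_add ((isHom_hp 0 X).add (isHom_hp 0 Y)) ((isHom_hp 1 X).add (isHom_hp 1 Y))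
  · exact hp_one_add ((isHom_hp 0 X).add (isHom_hp 0 Y)) ((isHom_hp 1 X).add (isHom_hp 1 Y))

lemma hp_restrict (a : ZMod 2) (h : V ≤ U) (X : S.T U) :
    (X.restrict h).hp a = (X.hp a).restrict h := rfl

/-- Additive properties of vector fields can be checked on homogeneous ones. -/
lemma induction_hom {P : S.T U → Prop} (X : S.T U) (hom : ∀ a Y, IsHom a Y → P Y)
    (add : ∀ Y Z, P Y → P Z → P (Y + Z)) : P X :=
  X.hp_add_hp ▸ add _ _ (hom 0 _ (isHom_hp 0 X)) (hom 1 _ (isHom_hp 1 X))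

end T

/-! #### The bracket -/

section Bracket

variable {U V : Opens M}

/-- The bracket of vector fields of parities `a` and `b`. -/
def hbr {a b : ZMod 2} {X Y : S.T U} (hX : X.IsHom a) (hY : Y.IsHom b) : S.T U :=
  T.ofDer (scomm a b X.toEnd Y.toEnd) (IsDer.scomm hX hY)

lemma hbr_congr {a b : ZMod 2} {X X' Y Y' : S.T U} {hX : X.IsHom a} {hY : Y.IsHom b}
    {hX' : X'.IsHom a} {hY' : Y'.IsHom b} (h : X = X') (h' : Y = Y') :
    hbr hX hY = hbr hX' hY' := by
  subst h h'; rfl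

lemma bracket_eq (X Y : S.T U) :
    bracket X Y = ∑ a : ZMod 2, ∑ b : ZMod 2, hbr (T.isHom_hp a X) (T.isHom_hp b Y) := rfl

lemma hbr_zero_left {a b : ZMod 2} {Y : S.T U} (hX : (0 : S.T U).IsHom a) (hY : Y.IsHom b) :
    hbr hX hY = 0 := by
  refine T.ext fun W hW f => ?_
  change (0 : S.O W) - sgn a b • Y.toEnd.app W hW 0 = 0
  rw [map_zero, smul_zero, sub_zero]

lemma hbr_zero_right {a b : ZMod 2} {X : S.T U} (hX : X.IsHom a) (hY : (0 : S.T U).IsHom b) :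
    hbr hX hY = 0 := by
  refine T.ext fun W hW f => ?_
  change X.toEnd.app W hW 0 - sgn a b • (0 : S.O W) = 0
  rw [map_zero, smul_zero, sub_zero]

/-- The components of the other parity vanish, so one of the four summands survives. -/
lemma bracket_of_isHom {a b : ZMod 2} {X Y : S.T U} (hX : X.IsHom a) (hY : Y.IsHom b) :
    bracket X Y = hbr hX hY := by
  rw [bracket_eq, Finset.sum_eq_single a, Finset.sum_eq_single b]
  · exact hbr_congr hX.hp_self hY.hp_self
  · intro c _ hc
    exact (hbr_congr (hX' := T.isHom_hp a X) (hY' := T.isHom_zero c) rfl (hY.hp_of_ne hc)).trans (hbr_zero_right _ _)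
  · simp
  · intro c _ hc
    exact Finset.sum_eq_zero fun d _ =>
      (hbr_congr (hX' := T.isHom_zero c) (hY' := T.isHom_hp d Y) (hX.hp_of_ne hc) rfl).trans (hbr_zero_left _ _)
  · simp

lemma bracket_add_left (X X' Y : S.T U) : bracket (X + X') Y = bracket X Y + bracket X' Y := by
  simp only [bracket_eq, ← Finset.sum_add_distrib]
  refine Finset.sum_congr rfl fun a _ => Finset.sum_congr rfl fun b _ => ?_
  rw [hbr_congr (hX' := (T.isHom_hp a X).add (T.isHom_hp a X')) (hY' := T.isHom_hp b Y)
    (T.hp_add a X X') rfl]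
  refine T.ext fun W hW f => ?_
  change ((X.hp a).toEnd.app W hW ((Y.hp b).toEnd.app W hW f) +
      (X'.hp a).toEnd.app W hW ((Y.hp b).toEnd.app W hW f)) -
      sgn a b • (Y.hp b).toEnd.app W hW ((X.hp a).toEnd.app W hW f + (X'.hp a).toEnd.app W hW f) =
    ((X.hp a).toEnd.app W hW ((Y.hp b).toEnd.app W hW f) -
      sgn a b • (Y.hp b).toEnd.app W hW ((X.hp a).toEnd.app W hW f)) +
    ((X'.hp a).toEnd.app W hW ((Y.hp b).toEnd.app W hW f) -
      sgn a b • (Y.hp b).toEnd.app W hW ((X'.hp a).toEnd.app W hW f))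
  rw [map_add, smul_add]
  abel

lemma bracket_add_right (X Y Y' : S.T U) : bracket X (Y + Y') = bracket X Y + bracket X Y' := by
  simp only [bracket_eq, ← Finset.sum_add_distrib]
  refine Finset.sum_congr rfl fun a _ => Finset.sum_congr rfl fun b _ => ?_
  rw [hbr_congr (hX' := T.isHom_hp a X) (hY' := (T.isHom_hp b Y).add (T.isHom_hp b Y')) rfl (T.hp_add b Y Y')]
  refine T.ext fun W hW f => ?_
  change (X.hp a).toEnd.app W hW ((Y.hp b).toEnd.app W hW f + (Y'.hp b).toEnd.app W hW f) -
      sgn a b • ((Y.hp b).toEnd.app W hW ((X.hp a).toEnd.app W hW f) +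
        (Y'.hp b).toEnd.app W hW ((X.hp a).toEnd.app W hW f)) =
    ((X.hp a).toEnd.app W hW ((Y.hp b).toEnd.app W hW f) -
      sgn a b • (Y.hp b).toEnd.app W hW ((X.hp a).toEnd.app W hW f)) +
    ((X.hp a).toEnd.app W hW ((Y'.hp b).toEnd.app W hW f) -
      sgn a b • (Y'.hp b).toEnd.app W hW ((X.hp a).toEnd.app W hW f))
  rw [map_add, smul_add]
  abel

lemma T.IsHom.bracket_deriv {a b : ZMod 2} {X Y : S.T U} (hX : X.IsHom a) (hY : Y.IsHom b)
    (f : S.O U) : (SuperSpace.bracket X Y).deriv f =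
      X.deriv (Y.deriv f) - sgn a b • Y.deriv (X.deriv f) := by
  rw [bracket_of_isHom hX hY]
  rfl

end Bracket

end SuperSpace

/-! ### The filtration of the model algebra by the ideal of the coordinates and constants -/

section Filtration

variable {N q k p : ℕ}

lemma top_mul_range_pow_le (n : ℕ) :
    (⊤ : Submodule ℂ (Grassmann N q)) * LinearMap.range (ExteriorAlgebra.ι ℂ) ^ n ≤
      LinearMap.range (ExteriorAlgebra.ι ℂ) ^ n * ⊤ := by
  induction n with
  | zero => simp
  | succ n ih =>
    rw [pow_succ', ← mul_assoc]
    refine (mul_le_mul' top_mul_range_le le_rfl).trans ?_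
    rw [mul_assoc, mul_assoc]
    exact mul_le_mul' le_rfl ih

lemma pow_mul_top_mul_le {A : Type*} [Ring A] [Algebra ℂ A] {P : Submodule ℂ A} (n m : ℕ)
    (h : ⊤ * P ^ m ≤ P ^ m * ⊤) : (P ^ n * ⊤) * (P ^ m * ⊤) ≤ P ^ (n + m) * ⊤ := by
  rw [mul_assoc (P ^ n), ← mul_assoc ⊤ (P ^ m), pow_add, mul_assoc (P ^ n)]
  refine mul_le_mul' le_rfl ((mul_le_mul' h le_rfl).trans ?_)
  rw [mul_assoc]
  exact mul_le_mul' le_rfl le_top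

lemma gfil_mul {n m : ℕ} {a b : Grassmann N q} (ha : a ∈ gfil N q n) (hb : b ∈ gfil N q m) :
    a * b ∈ gfil N q (n + m) := by
  have h : a * b ∈ gfil N q n * gfil N q m := Submodule.mul_mem_mul ha hb
  exact pow_mul_top_mul_le n m (top_mul_range_pow_le m) h

lemma gfil_succ_induction {n : ℕ} {P : Grassmann N q → Prop} {a : Grassmann N q}
    (ha : a ∈ gfil N q (n + 1))
    (mul : ∀ w b, b ∈ gfil N q n → P (ExteriorAlgebra.ι ℂ w * b))
    (add : ∀ a b, P a → P b → P (a + b)) : P a := by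
  rw [gfil, pow_succ', mul_assoc] at ha
  refine Submodule.mul_induction_on ha ?_ add
  rintro _ ⟨w, rfl⟩ b hb
  exact mul w b hb

lemma gder_mem_gfil (j : Fin q) {n : ℕ} {a : Grassmann N q} (ha : a ∈ gfil N q n) :
    gder j a ∈ gfil N q (n - 1) := by
  induction n generalizing a with
  | zero => rw [Nat.zero_sub, gfil_zero]; trivial
  | succ n ih =>
    refine gfil_succ_induction (P := fun a => gder j a ∈ gfil N q n) ha (fun w b hb => ?_) fun a b ha hb => ?_
    · rw [gder_iota_mul]
      refine Submodule.sub_mem _ (Submodule.smul_mem _ _ hb) ?_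
      refine gfil_antitone ?_ (iota_mul_mem_gfil w (ih hb))
      omega
    · rw [map_add]; exact Submodule.add_mem _ ha hb

lemma ginv_mem_gfil {n : ℕ} {a : Grassmann N q} (ha : a ∈ gfil N q n) :
    ginv a ∈ gfil N q n := by
  induction n generalizing a with
  | zero => rw [gfil_zero]; trivial
  | succ n ih =>
    refine gfil_succ_induction (P := fun a => ginv a ∈ gfil N q (n + 1)) ha (fun w b hb => ?_) fun a b ha hb => ?_
    · rw [map_mul, show ginv (ExteriorAlgebra.ι ℂ w : Grassmann N q) = -ExteriorAlgebra.ι ℂ w from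
        CliffordAlgebra.involute_ι w, neg_mul]
      exact Submodule.neg_mem _ (iota_mul_mem_gfil w (ih hb))
    · rw [map_add]; exact Submodule.add_mem _ ha hb

lemma xi_mem_gfil (j : Fin q) : xi N j ∈ gfil N q 1 := by
  have := iota_mul_mem_gfil (n := 0) (q := q) (N := N) (Pi.single j 1, 0) (a := 1)
    (by rw [gfil_zero]; trivial)
  rwa [mul_one] at this

/-- The filtration of the model algebra by the powers of the ideal generated by the formal and the
odd coordinates and the odd constants. -/
def mfil (N q k n : ℕ) : Submodule ℂ (ModelAlg N q k) where
  carrier := {a | ∀ m : Fin k →₀ ℕ, MvPowerSeries.coeff m a ∈ gfil N q (n - m.degree)}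
  add_mem' ha hb m := by
    rw [map_add]; exact Submodule.add_mem _ (ha m) (hb m)
  zero_mem' m := by
    rw [map_zero]; exact Submodule.zero_mem _
  smul_mem' c a ha m := Submodule.smul_mem _ c (ha m)

lemma mem_mfil_zero (a : ModelAlg N q k) : a ∈ mfil N q k 0 := fun m => by
  rw [Nat.zero_sub, gfil_zero]; trivial

lemma mfil_antitone : Antitone (mfil N q k) := fun _ _ h _ ha m =>
  gfil_antitone (Nat.sub_le_sub_right h _) (ha m)

lemma mfil_mul {n m : ℕ} {a b : ModelAlg N q k} (ha : a ∈ mfil N q k n) (hb : b ∈ mfil N q k m) :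
    a * b ∈ mfil N q k (n + m) := fun i => by
  classical
  rw [MvPowerSeries.coeff_mul]
  refine Submodule.sum_mem _ fun j hj => gfil_antitone ?_ (gfil_mul (ha j.1) (hb j.2))
  rw [← Finset.HasAntidiagonal.mem_antidiagonal.1 hj, map_add]
  omega

lemma X_mem_mfil (j : Fin k) : (MvPowerSeries.X j : ModelAlg N q k) ∈ mfil N q k 1 := fun m => by
  classical
  rw [MvPowerSeries.coeff_X]
  split_ifs with h
  · rw [h, Finsupp.degree_single, Nat.sub_self, gfil_zero]; trivial
  · exact Submodule.zero_mem _

lemma C_mem_mfil {n : ℕ} {a : Grassmann N q} (ha : a ∈ gfil N q n) :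
    (MvPowerSeries.C a : ModelAlg N q k) ∈ mfil N q k n := fun m => by
  classical
  rw [MvPowerSeries.coeff_C]
  split_ifs with h
  · exact gfil_antitone (Nat.sub_le _ _) ha
  · exact Submodule.zero_mem _

lemma parity_mem_mfil {n : ℕ} {a : ModelAlg N q k} (ha : a ∈ mfil N q k n) :
    ModelAlg.parity N q k a ∈ mfil N q k n := fun m => ginv_mem_gfil (ha m)

lemma coeff_eq_zero_of_mem_mfil {n : ℕ} {a : ModelAlg N q k} (ha : a ∈ mfil N q k n)
    {m : Fin k →₀ ℕ} (hm : m.degree + (q + N + 1) ≤ n) : MvPowerSeries.coeff m a = 0 := by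
  have h := gfil_antitone (show q + N + 1 ≤ n - m.degree by omega) (ha m)
  rwa [gfil_eq_bot, Submodule.mem_bot] at h

/-- The filtration is separated: the ideal in the Grassmann algebra is nilpotent, so depth `m.degree
+ (q + N + 1)` already kills the coefficient at `m`. Arguments by successive approximation end here.
-/
lemma eq_zero_of_forall_mem_mfil {a : ModelAlg N q k} (h : ∀ n, a ∈ mfil N q k n) : a = 0 := by
  ext m
  rw [coeff_eq_zero_of_mem_mfil (h _) le_rfl, map_zero]

/-- Composed with the quotient map modulo `P`, the function is locally zero, and linear maps commute
with `pd`. -/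
lemma pd_mem_of_eventually {G : Type*} [AddCommGroup G] [Module ℂ G] [Module.Finite ℂ G]
    {F : (Fin p → ℂ) → G} {y : Fin p → ℂ} (hF : HolAt F y) (P : Submodule ℂ G)
    (h : ∀ᶠ z in 𝓝 y, F z ∈ P) (i : Fin p) : pd i F y ∈ P := by
  rw [← Submodule.Quotient.mk_eq_zero, ← Submodule.mkQ_apply, hF.linear_pd,
    pd_congr (F' := fun _ => 0), pd_const]
  filter_upwards [h] with z hz
  rwa [Submodule.mkQ_apply, Submodule.Quotient.mk_eq_zero]

/-- Derivatives in the convergent directions keep the depth. A formal or odd derivative removes one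
generator and costs at most one degree. -/
lemma mder_mem_mfil {F : (Fin p → ℂ) → ModelAlg N q k} {y : Fin p → ℂ} (hF : HolS F y) {n : ℕ}
    (h : ∀ᶠ z in 𝓝 y, F z ∈ mfil N q k (n + 1)) (i : Idx p k q) : mder i F y ∈ mfil N q k n := by
  intro m
  rcases i with i | j | j
  · exact gfil_antitone (by omega)
      (pd_mem_of_eventually (hF m) (gfil N q (n + 1 - m.degree)) (h.mono fun z hz => hz m) i)
  · change ((m j + 1 : ℕ) : ℂ) • MvPowerSeries.coeff (m + Finsupp.single j 1) (F y) ∈ _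
    refine Submodule.smul_mem _ _ (gfil_antitone ?_ (h.self_of_nhds (m + Finsupp.single j 1)))
    rw [map_add, Finsupp.degree_single]
    omega
  · have := gder_mem_gfil j (h.self_of_nhds m)
    exact gfil_antitone (by omega) this

/-- The limit of a series whose terms lie deeper and deeper in the filtration. -/
def mlim (b : ℕ → ModelAlg N q k) : ModelAlg N q k := fun m =>
  ∑ n ∈ Finset.range (m.degree + (q + N + 1)), MvPowerSeries.coeff m (b n)

/-- Terms of index at least `m.degree + (q + N + 1)` have no coefficient at `m`. So the difference
at `m` is either a sum of vanishing terms or a sum of terms of index at least `n`. -/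
lemma mlim_sub_mem {b : ℕ → ModelAlg N q k} (hb : ∀ n, b n ∈ mfil N q k n) (n : ℕ) :
    mlim b - ∑ i ∈ Finset.range n, b i ∈ mfil N q k n := fun m => by
  rw [map_sub, map_sum]
  change ∑ i ∈ Finset.range (m.degree + (q + N + 1)), _ - _ ∈ _
  rcases le_total (m.degree + (q + N + 1)) n with h | h
  · rw [← Finset.sum_range_add_sum_Ico _ h, Finset.sum_eq_zero (s := Finset.Ico _ _), add_zero,
      sub_self]
    · exact Submodule.zero_mem _
    · intro i hi
      exact coeff_eq_zero_of_mem_mfil (hb i) (Finset.mem_Ico.1 hi).1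
  · rw [← Finset.sum_range_add_sum_Ico _ h, add_sub_cancel_left]
    refine Submodule.sum_mem _ fun i hi => gfil_antitone ?_ (hb i m)
    have := (Finset.mem_Ico.1 hi).1
    omega

/-- Each coefficient of the limit is a finite sum, over an index range independent of the point; no
analytic convergence is involved. -/
lemma HolS.mlim {b : ℕ → (Fin p → ℂ) → ModelAlg N q k} {y : Fin p → ℂ} (hb : ∀ n, HolS (b n) y) :
    HolS (fun z => mlim fun n => b n z) y := fun m => by
  change HolAt (fun z => ∑ n ∈ Finset.range (m.degree + (q + N + 1)),
    MvPowerSeries.coeff m (b n z)) y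
  exact HolAt.sum _ fun n _ => hb n m

/-- The reduction modulo all formal and odd coordinates and odd constants. -/
def aug (N q k : ℕ) : ModelAlg N q k →+* ℂ :=
  (ExteriorAlgebra.algebraMapInv : Grassmann N q →ₐ[ℂ] ℂ).toRingHom.comp
    MvPowerSeries.constantCoeff

lemma gfil_one_of_algebraMapInv {a : Grassmann N q} (ha : ExteriorAlgebra.algebraMapInv a = 0) :
    a ∈ gfil N q 1 := by
  have key : ∀ a : Grassmann N q,
      a - algebraMap ℂ _ (ExteriorAlgebra.algebraMapInv a) ∈ gfil N q 1 := by
    intro a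
    induction a using ExteriorAlgebra.induction with
    | algebraMap r => simp
    | ι w =>
      have h1 : ExteriorAlgebra.algebraMapInv (ExteriorAlgebra.ι ℂ w : Grassmann N q) = 0 := by
        simp [ExteriorAlgebra.algebraMapInv]
      rw [h1, map_zero, sub_zero, ← mul_one (ExteriorAlgebra.ι ℂ w)]
      exact iota_mul_mem_gfil (n := 0) w (by rw [gfil_zero]; trivial)
    | mul a b ha hb =>
      have e : a * b - algebraMap ℂ _ (ExteriorAlgebra.algebraMapInv (a * b)) =
          (a - algebraMap ℂ _ (ExteriorAlgebra.algebraMapInv a)) * b +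
            algebraMap ℂ _ (ExteriorAlgebra.algebraMapInv a) *
              (b - algebraMap ℂ _ (ExteriorAlgebra.algebraMapInv b)) := by
        rw [map_mul, map_mul]; noncomm_ring
      rw [e]
      refine Submodule.add_mem _ (gfil_mul_right ha b) ?_
      rw [← Algebra.smul_def]
      exact Submodule.smul_mem _ _ hb
    | add a b ha hb =>
      rw [map_add, map_add, add_sub_add_comm]
      exact Submodule.add_mem _ ha hb
  simpa [ha] using key a

lemma mem_mfil_one_of_aug {a : ModelAlg N q k} (ha : aug N q k a = 0) : a ∈ mfil N q k 1 := by
  intro m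
  by_cases hm : m = 0
  · subst hm
    rw [map_zero, Nat.sub_zero]
    exact gfil_one_of_algebraMapInv ha
  · have : m.degree ≠ 0 := by rwa [Ne, Finsupp.degree_eq_zero_iff]
    rw [show 1 - m.degree = 0 by omega, gfil_zero]; trivial

lemma aug_X (j : Fin k) : aug N q k (MvPowerSeries.X j) = 0 := by
  change ExteriorAlgebra.algebraMapInv (MvPowerSeries.constantCoeff (MvPowerSeries.X j)) = 0
  rw [MvPowerSeries.constantCoeff_X, map_zero]

lemma aug_C (a : Grassmann N q) : aug N q k (MvPowerSeries.C a) =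
    ExteriorAlgebra.algebraMapInv a := by
  change ExteriorAlgebra.algebraMapInv (MvPowerSeries.constantCoeff (MvPowerSeries.C a)) = _
  rw [MvPowerSeries.constantCoeff_C]

lemma algebraMapInv_xi (j : Fin q) : ExteriorAlgebra.algebraMapInv (xi N j) = 0 := by
  simp [xi, ExteriorAlgebra.algebraMapInv]

lemma aug_parity (a : ModelAlg N q k) : aug N q k (ModelAlg.parity N q k a) = aug N q k a := by
  have key : ∀ b : Grassmann N q,
      ExteriorAlgebra.algebraMapInv (ginv b) = ExteriorAlgebra.algebraMapInv b := by
    intro b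
    induction b using ExteriorAlgebra.induction with
    | algebraMap r => rw [AlgHom.commutes]
    | ι w =>
      rw [show ginv (ExteriorAlgebra.ι ℂ w : Grassmann N q) = -ExteriorAlgebra.ι ℂ w from
        CliffordAlgebra.involute_ι w]
      simp [ExteriorAlgebra.algebraMapInv]
    | mul a b ha hb => rw [map_mul, map_mul, map_mul, ha, hb]
    | add a b ha hb => rw [map_add, map_add, map_add, ha, hb]
  exact key _

/-- The part of a power series divisible by `tⱼ` but not involving the `tᵢ` with `i < j`, divided by
`tⱼ`. -/
def lowPart (j : Fin k) (f : ModelAlg N q k) : ModelAlg N q k := fun m =>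
  open Classical in if ∀ i < j, m i = 0 then MvPowerSeries.coeff (m + Finsupp.single j 1) f else 0

/-- Every nonconstant monomial is charged to the smallest index that occurs in it, so exactly one
summand contributes to its coefficient. -/
lemma eq_C_add_sum_X_mul (f : ModelAlg N q k) :
    f = MvPowerSeries.C (MvPowerSeries.coeff 0 f) + ∑ j, MvPowerSeries.X j * lowPart j f := by
  classical
  ext m
  rw [map_add, map_sum, MvPowerSeries.coeff_C]
  by_cases hm : m = 0
  · subst hm
    rw [if_pos rfl, Finset.sum_eq_zero, add_zero]
    exact fun j _ => coeff_X_mul_of_eq_zero j _ rfl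
  · obtain ⟨j, hj, hmin⟩ : ∃ j, m j ≠ 0 ∧ ∀ i < j, m i = 0 := by
      have hne : (Finset.univ.filter fun j => m j ≠ 0).Nonempty := by
        by_contra h
        rw [Finset.not_nonempty_iff_eq_empty, Finset.filter_eq_empty_iff] at h
        exact hm (Finsupp.ext fun j => by simpa using h (Finset.mem_univ j))
      refine ⟨_, (Finset.mem_filter.1 (Finset.min'_mem _ hne)).2, fun i hi => ?_⟩
      by_contra h
      exact absurd (Finset.min'_le _ i (Finset.mem_filter.2 ⟨Finset.mem_univ i, h⟩)) (not_le.2 hi)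
    have e : ∀ i, m i ≠ 0 → m = m - Finsupp.single i 1 + Finsupp.single i 1 := fun i hi =>
      (tsub_add_cancel_of_le (Finsupp.single_le_iff.2 (Nat.one_le_iff_ne_zero.2 hi))).symm
    rw [if_neg hm, zero_add, Finset.sum_eq_single j]
    · conv_rhs => rw [e j hj]
      rw [coeff_X_mul_add]
      change _ = if _ then _ else _
      rw [if_pos, ← e j hj]
      intro i hi
      simp [hmin i hi]
    · intro i _ hij
      by_cases hi : m i = 0
      · exact coeff_X_mul_of_eq_zero i _ hi
      · rw [e i hi, coeff_X_mul_add]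
        change (if _ then _ else _) = _
        rw [if_neg]
        intro h
        have hji : j < i := by
          rcases lt_trichotomy i j with h' | h' | h'
          · exact absurd (hmin i h') hi
          · exact absurd h' hij
          · exact h'
        have := h j hji
        rw [Finsupp.tsub_apply, Finsupp.single_eq_of_ne (by exact hij.symm)] at this
        exact hj (by simpa using this)
    · simp

lemma HolS.lowPart {F : (Fin p → ℂ) → ModelAlg N q k} {y : Fin p → ℂ} (hF : HolS F y) (j : Fin k) :
    HolS (fun z => lowPart j (F z)) y := fun m => by
  classical
  change HolAt (fun z => if ∀ i < j, m i = 0 then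
    MvPowerSeries.coeff (m + Finsupp.single j 1) (F z) else 0) y
  split_ifs
  · exact hF _
  · exact HolAt.const _

end Filtration

/-! ### Hadamard's lemma in a chart, coordinate vector fields, and the filtration of sections -/

namespace SuperSpace

variable {N : ℕ} {M : Type u} [TopologicalSpace M] {S : SuperSpace.{u, v} N M}

lemma algebraMap_eq_const {V : Opens M} (c : ℂ) :
    algebraMap ℂ (S.O V) c = S.const V (algebraMap ℂ _ c) := ((S.const V).commutes c).symm

lemma IsDer.app_algebraMap {U V : Opens M} {a : ZMod 2} {D : S.SheafEnd U} (hD : S.IsDer a D)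
    (h : V ≤ U) (c : ℂ) : D.app V h (algebraMap ℂ _ c) = 0 := by
  rw [algebraMap_eq_const, hD.const]

lemma T.deriv_algebraMap {U : Opens M} (X : S.T U) (c : ℂ) : X.deriv (algebraMap ℂ _ c) = 0 := by
  refine X.induction_hom (P := fun X => X.deriv (algebraMap ℂ _ c) = 0) ?_ ?_
  · intro a Y hY
    exact IsDer.app_algebraMap hY le_rfl c
  · intro Y Z hY hZ
    rw [T.add_deriv, hY, hZ, add_zero]

lemma T.deriv_one {U : Opens M} (X : S.T U) : X.deriv 1 = 0 := by
  simpa using X.deriv_algebraMap 1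

namespace Chart

variable {p k q : ℕ} {φ : S.Chart p k q} {U V W : Opens M} {hU : (U : Set M) ⊆ φ.e.source}
  {hV : (V : Set M) ⊆ φ.e.source} {hW : (W : Set M) ⊆ φ.e.source} {x : M}

/-- The value of a function at a point, modulo all formal and odd coordinates and odd constants. -/
def ev (φ : S.Chart p k q) (hV : (V : Set M) ⊆ φ.e.source) (x : M) (f : S.O V) : ℂ :=
  aug N q k (φ.rep hV f (φ.e x))

lemma rep_algebraMap (c : ℂ) (hx : x ∈ V) :
    φ.rep hV (algebraMap ℂ (S.O V) c) (φ.e x) = MvPowerSeries.C (algebraMap ℂ _ c) := by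
  rw [algebraMap_eq_const, rep_const _ hx, AlgHom.commutes]

/-- The coordinates of the point `y` of the base. -/
def ctr (k q : ℕ) (y : Fin p → ℂ) : Idx p k q → ℂ := Sum.elim y fun _ => 0

/-- Hadamard's lemma. -/
lemma exists_hadamard (hV : (V : Set M) ⊆ φ.e.source) (hx : x ∈ V) (f : S.O V) :
    ∃ (W : Opens M) (h : W ≤ V) (hW : (W : Set M) ⊆ φ.e.source) (c : Constants N)
      (g : Idx p k q → S.O W), x ∈ W ∧ S.res h f = S.const W c +
        ∑ i, (φ.coord i hW - algebraMap ℂ _ (ctr k q (φ.e x) i)) * g i := by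
  -- Three divisions are combined. The part without `t` is divided by the even coordinates
  -- analytically; its value at the point is divided by the odd coordinates, up to a constant; the
  -- terms with `t` are divided by the formal coordinates.
  obtain ⟨Q, hQ, hQ'⟩ := HolAt.exists_hadamard (holS_rep (hV := hV) f hx 0)
  obtain ⟨c, b, hcb⟩ := exists_eq_gconst_add (MvPowerSeries.coeff 0 (φ.rep hV f (φ.e x)))
  have hQ'' : ∀ᶠ z in 𝓝 (φ.e x), ∀ i, HolAt (Q i) z := Filter.eventually_all.2 fun i =>
    (hQ i).eventually
  obtain ⟨W, h, hxW, hQW⟩ := exists_nhd hV hx (hQ'.and hQ'')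
  refine ⟨W, h, subset_source h hV, c, Sum.elim
    (fun i => φ.ofRep (subset_source h hV) (fun z => MvPowerSeries.C (Q i z))
      fun x' hx' => HolS.of_C ((hQW x' hx').2 i))
    (Sum.elim
      (fun j => φ.ofRep (subset_source h hV) (fun z => lowPart j (φ.rep hV f z))
        fun x' hx' => (holS_rep f (h hx')).lowPart j)
      fun l => φ.ofRep (subset_source h hV) (fun _ => MvPowerSeries.C (b l))
        fun x' hx' => HolS.const _), hxW, ?_⟩
  refine rep_ext (hV := subset_source h hV) fun x' hx' => ?_
  rw [rep_res (hV := hV) h _ hx', rep_add _ _ hx', rep_const _ hx', rep_sum _ _ hx']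
  simp only [Fintype.sum_sum_type, Sum.elim_inl, Sum.elim_inr, rep_mul _ _ hx', rep_sub _ _ hx',
    rep_coord _ hx', rep_algebraMap _ hx', rep_ofRep _ hx', coordVal, ctr, map_zero, sub_zero]
  conv_lhs => rw [eq_C_add_sum_X_mul (φ.rep hV f (φ.e x')), (hQW x' hx').1, hcb]
  simp only [map_add, map_sum, map_mul, ← map_sub]
  have e : ∀ (r : ℂ) (a : Grassmann N q), (MvPowerSeries.C (r • a) : ModelAlg N q k) =
      MvPowerSeries.C (algebraMap ℂ _ r) * MvPowerSeries.C a := fun r a => by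
    rw [← map_mul, ← Algebra.smul_def]
  simp only [e]
  abel

lemma isHom_coord_sub (i : Idx p k q) (y : Fin p → ℂ) :
    S.IsHom (ipar i) (φ.coord i hV - algebraMap ℂ _ (ctr k q y i)) := by
  refine (isHom_coord i).sub ?_
  rcases i with i | j | j
  · exact isHom_algebraMap _
  · exact isHom_algebraMap _
  · rw [ctr, Sum.elim_inr, map_zero]
    exact isHom_zero _

lemma rep_coord_sub_mem (i : Idx p k q) (hx : x ∈ V) :
    φ.rep hV (φ.coord i hV - algebraMap ℂ _ (ctr k q (φ.e x) i)) (φ.e x) ∈ mfil N q k 1 := by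
  rw [rep_sub _ _ hx, rep_coord i hx, rep_algebraMap _ hx]
  rcases i with i | j | j
  · rw [coordVal, ctr, Sum.elim_inl, sub_self]; exact Submodule.zero_mem _
  · rw [coordVal, ctr, Sum.elim_inr, map_zero, map_zero, sub_zero]; exact X_mem_mfil j
  · rw [coordVal, ctr, Sum.elim_inr, map_zero, map_zero, sub_zero]; exact C_mem_mfil (xi_mem_gfil j)

/-- Expand `f` near a point by Hadamard's lemma. The constant and the coordinates are killed, so `D
f` is a sum of terms `± (xᵢ - cᵢ) · D gᵢ`, whose first factor has depth `1` at the point. Iteration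
puts `D f` at every depth. The induction runs over all open sets, functions and points at once,
because the `gᵢ` live on a smaller neighbourhood. -/
lemma app_eq_zero {a : ZMod 2} {D : S.SheafEnd U} (hU : (U : Set M) ⊆ φ.e.source)
    (hD : S.IsDer a D) (h0 : ∀ i, D.app U le_rfl (φ.coord i hU) = 0) (hV : V ≤ U) (f : S.O V) :
    D.app V hV f = 0 := by
  have hres : ∀ {V W : Opens M} (hV : V ≤ U) (h : W ≤ V) (f : S.O V),
      S.res h (D.app V hV f) = D.app W (h.trans hV) (S.res h f) := fun {V W} hV h f =>
    D.2 ⟨V, hV⟩ ⟨W, h.trans hV⟩ h f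
  have hcoord : ∀ (W : Opens M) (h : W ≤ U) (hW : (W : Set M) ⊆ φ.e.source) i,
      D.app W h (φ.coord i hW) = 0 := by
    intro W h hW i
    rw [← res_coord (hV := hU) i h, ← hres le_rfl h, h0, map_zero]
  have key : ∀ n (V : Opens M) (hV : V ≤ U) (f : S.O V), ∀ x ∈ V,
      φ.rep (subset_source hV hU) (D.app V hV f) (φ.e x) ∈ mfil N q k n := by
    intro n
    induction n with
    | zero => exact fun _ _ _ _ _ => mem_mfil_zero _
    | succ n ih =>
      intro V hV f x hx
      obtain ⟨W, h, hW, c, g, hxW, e⟩ := exists_hadamard (subset_source hV hU) hx f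
      rw [← rep_res (hW := hW) h _ hxW, hres hV h, e, map_add, map_sum, hD.const, zero_add,
        rep_sum _ _ hxW]
      refine Submodule.sum_mem _ fun i _ => ?_
      rw [hD.leibniz W _ (ipar i) _ _ (isHom_coord_sub i _), map_sub, hcoord W _ hW i,
        hD.app_algebraMap, sub_zero, zero_mul, zero_add, rep_zsmul _ _ hxW, rep_mul _ _ hxW]
      refine zsmul_mem ?_ _
      rw [add_comm n]
      exact mfil_mul (rep_coord_sub_mem i hxW) (ih W (h.trans hV) (g i) x hxW)
  refine rep_ext (hV := subset_source hV hU) fun x hx => ?_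
  rw [rep_zero hx]
  exact eq_zero_of_forall_mem_mfil fun n => key n V hV f x hx

/-! #### Coordinate vector fields -/

variable (φ) in
/-- The coordinate vector fields. -/
def dT (i : Idx p k q) (hU : (U : Set M) ⊆ φ.e.source) : S.T U := T.ofDer _ (isDer_dEnd i hU)

lemma isHom_dT (i : Idx p k q) : (φ.dT i hU).IsHom (ipar i) := isDer_dEnd i hU

lemma deriv_dT (i : Idx p k q) (f : S.O U) : (φ.dT i hU).deriv f = φ.dO i hU f := rfl

lemma restrict_dT (i : Idx p k q) (h : V ≤ U) : (φ.dT i hU).restrict h = φ.dT i hV := rfl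

lemma deriv_dT_coord (i j : Idx p k q) :
    (φ.dT i hU).deriv (φ.coord j hU) = if j = i then 1 else 0 := dO_coord i j

lemma T_ext_of_isHom {a : ZMod 2} {X : S.T U} (hX : X.IsHom a)
    (h : ∀ i, X.deriv (φ.coord i hU) = 0) : X = 0 :=
  T.ext fun _ hV f => app_eq_zero hU hX h hV f

lemma ipar_add_self (a b : ZMod 2) : a + b + b = a := by revert a b; decide

lemma eq_sum_of_isHom {a : ZMod 2} {X : S.T U} (hX : X.IsHom a) :
    X = ∑ i, X.deriv (φ.coord i hU) • φ.dT i hU := by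
  have h : (∑ i, X.deriv (φ.coord i hU) • φ.dT i hU).IsHom a := T.IsHom.sum _ fun i _ => by
    have := T.IsHom.smul (hX.deriv (isHom_coord (φ := φ) (hV := hU) i)) (isHom_dT (φ := φ) (hU := hU) i)
    rwa [ipar_add_self] at this
  refine sub_eq_zero.1 (T_ext_of_isHom (φ := φ) (hU := hU) (hX.sub h) fun j => ?_)
  rw [T.sub_deriv, T.sum_deriv, Finset.sum_eq_single j]
  · rw [T.smul_deriv, deriv_dT_coord, if_pos rfl, mul_one, sub_self]
  · intro i _ hij
    rw [T.smul_deriv, deriv_dT_coord, if_neg hij.symm, mul_zero]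
  · simp

/-- The coordinate vector fields form a basis. -/
lemma eq_sum_deriv_coord (hU : (U : Set M) ⊆ φ.e.source) (X : S.T U) :
    X = ∑ i, X.deriv (φ.coord i hU) • φ.dT i hU := by
  refine X.induction_hom (P := fun X => X = ∑ i, X.deriv (φ.coord i hU) • φ.dT i hU)
    (fun a Y hY => eq_sum_of_isHom hY) fun Y Z hY hZ => ?_
  simp only [T.add_deriv, add_smul, Finset.sum_add_distrib]
  rw [← hY, ← hZ]

lemma T_ext (hU : (U : Set M) ⊆ φ.e.source) {X Y : S.T U}
    (h : ∀ i, X.deriv (φ.coord i hU) = Y.deriv (φ.coord i hU)) : X = Y := by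
  rw [eq_sum_deriv_coord hU X, eq_sum_deriv_coord hU Y]
  simp only [h]

lemma sum_smul_dT_deriv (c : Idx p k q → S.O U) (j : Idx p k q) :
    (∑ i, c i • φ.dT i hU).deriv (φ.coord j hU) = c j := by
  rw [T.sum_deriv, Finset.sum_eq_single j]
  · rw [T.smul_deriv, deriv_dT_coord, if_pos rfl, mul_one]
  · intro i _ hij
    rw [T.smul_deriv, deriv_dT_coord, if_neg hij.symm, mul_zero]
  · simp

/-- Coordinate fields send coordinates to `0` or `1`, so their bracket kills every coordinate. -/
lemma bracket_dT (i j : Idx p k q) : bracket (φ.dT i hU) (φ.dT j hU) = 0 := by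
  refine T_ext hU fun l => ?_
  rw [(isHom_dT i).bracket_deriv (isHom_dT j), deriv_dT_coord, deriv_dT_coord, T.zero_deriv]
  split_ifs <;> simp [T.deriv_one, T.deriv_zero]

/-! #### The filtration of functions and vector fields -/

variable (φ) in
/-- The filtration of functions by the powers of the ideal of formal and odd coordinates and odd
constants. -/
def fil (hU : (U : Set M) ⊆ φ.e.source) (n : ℕ) : Ideal (S.O U) where
  carrier := {f | ∀ x ∈ U, φ.rep hU f (φ.e x) ∈ mfil N q k n}
  add_mem' hf hg x hx := by
    rw [rep_add _ _ hx]; exact Submodule.add_mem _ (hf x hx) (hg x hx)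
  zero_mem' x hx := by
    rw [rep_zero hx]; exact Submodule.zero_mem _
  smul_mem' f g hg x hx := by
    rw [smul_eq_mul, rep_mul _ _ hx]
    exact mfil_antitone (by omega) (mfil_mul (mem_mfil_zero _) (hg x hx))

lemma mul_mem_fil {n m : ℕ} {f g : S.O U} (hf : f ∈ φ.fil hU n) (hg : g ∈ φ.fil hU m) :
    f * g ∈ φ.fil hU (n + m) := fun x hx => by
  rw [rep_mul _ _ hx]; exact mfil_mul (hf x hx) (hg x hx)

lemma mem_fil_zero (f : S.O U) : f ∈ φ.fil hU 0 := fun _ _ => mem_mfil_zero _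

lemma fil_antitone : Antitone (φ.fil hU) := fun _ _ h _ hf x hx => mfil_antitone h (hf x hx)

lemma par_mem_fil {n : ℕ} {f : S.O U} (hf : f ∈ φ.fil hU n) : S.par U f ∈ φ.fil hU n :=
  fun x hx => by
    rw [rep_par _ hx]; exact parity_mem_mfil (hf x hx)

lemma dO_mem_fil {n : ℕ} {f : S.O U} (hf : f ∈ φ.fil hU (n + 1)) (i : Idx p k q) :
    φ.dO i hU f ∈ φ.fil hU n := fun x hx => by
  rw [rep_dO i _ hx]
  exact mder_mem_mfil (holS_rep f hx) (eventually_image hU hx hf) i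

lemma eq_zero_of_forall_mem_fil {f : S.O U} (h : ∀ n, f ∈ φ.fil hU n) : f = 0 :=
  rep_ext (hV := hU) fun x hx => by
    rw [rep_zero hx]; exact eq_zero_of_forall_mem_mfil fun n => h n x hx

/-- Completeness of the filtration: the coefficientwise limit again has holomorphic coefficients. -/
lemma exists_lim {b : ℕ → S.O U} (hb : ∀ n, b n ∈ φ.fil hU n) :
    ∃ s : S.O U, ∀ n, s - ∑ i ∈ Finset.range n, b i ∈ φ.fil hU n := by
  refine ⟨φ.ofRep hU (fun z => mlim fun n => φ.rep hU (b n) z) fun x hx =>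
    HolS.mlim fun n => holS_rep (b n) hx, fun n x hx => ?_⟩
  rw [rep_sub _ _ hx, rep_ofRep _ hx, rep_sum _ _ hx]
  exact mlim_sub_mem (fun n => hb n x hx) n

variable (φ) in
/-- The filtration of vector fields. -/
def filT (hU : (U : Set M) ⊆ φ.e.source) (n : ℕ) : Submodule (S.O U) (S.T U) where
  carrier := {X | ∀ i, X.deriv (φ.coord i hU) ∈ φ.fil hU n}
  add_mem' hX hY i := Ideal.add_mem _ (hX i) (hY i)
  zero_mem' i := Ideal.zero_mem _
  smul_mem' f X hX i := by
    rw [T.smul_deriv]; exact Ideal.mul_mem_left _ _ (hX i)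

lemma smul_mem_filT {n m : ℕ} {f : S.O U} {X : S.T U} (hf : f ∈ φ.fil hU n)
    (hX : X ∈ φ.filT hU m) : f • X ∈ φ.filT hU (n + m) := fun i => by
  rw [T.smul_deriv]; exact mul_mem_fil hf (hX i)

lemma smul_mem_filT_left {n : ℕ} {f : S.O U} (hf : f ∈ φ.fil hU n) (X : S.T U) :
    f • X ∈ φ.filT hU n := smul_mem_filT (m := 0) hf fun _ => mem_fil_zero _

lemma filT_antitone : Antitone (φ.filT hU) := fun _ _ h _ hX i => fil_antitone h (hX i)

lemma eq_zero_of_forall_mem_filT {X : S.T U} (h : ∀ n, X ∈ φ.filT hU n) : X = 0 :=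
  T_ext hU fun i => by
    rw [T.zero_deriv]; exact eq_zero_of_forall_mem_fil fun n => h n i

lemma exists_limT {b : ℕ → S.T U} (hb : ∀ n, b n ∈ φ.filT hU n) :
    ∃ s : S.T U, ∀ n, s - ∑ i ∈ Finset.range n, b i ∈ φ.filT hU n := by
  choose s hs using fun j => exists_lim (φ := φ) (hU := hU) fun n => hb n j
  refine ⟨∑ j, s j • φ.dT j hU, fun n j => ?_⟩
  rw [T.sub_deriv, sum_smul_dT_deriv, T.sum_deriv]
  exact hs j n

end Chart

end SuperSpace

/-! ### Covariant derivatives in coordinates and integration one direction at a time -/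

namespace SuperSpace

variable {N : ℕ} {M : Type u} [TopologicalSpace M] {S : SuperSpace.{u, v} N M} {U V W : Opens M}

/-- The powers of the parity involution. -/
def parP (a : ZMod 2) (f : S.O U) : S.O U := if a = 0 then f else S.par U f

lemma parP_add (a : ZMod 2) (f g : S.O U) : parP a (f + g) = parP a f + parP a g := by
  unfold parP; split_ifs
  · rfl
  · exact map_add _ _ _

lemma parP_of_isHom {a c : ZMod 2} {f : S.O U} (hf : S.IsHom c f) : parP a f = sgn a c • f := by
  obtain rfl | rfl := zmod_two_cases a
  · rw [sgn_zero_left, one_smul]; rfl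
  · exact hf

lemma O_induction_hom {P : S.O U → Prop} (f : S.O U) (hom : ∀ a g, S.IsHom a g → P g)
    (add : ∀ f g, P f → P g → P (f + g)) : P f :=
  S.homPart_add f ▸ add _ _ (hom 0 _ (S.isHom_homPart 0 f)) (hom 1 _ (S.isHom_homPart 1 f))

lemma T.eq_zero_of_eq_neg {X : S.T U} (h : X = -X) : X = 0 := by
  have h2 : (algebraMap ℂ (S.O U) 2) • X = 0 := by
    rw [map_ofNat, ofNat_smul_eq_nsmul, two_nsmul]
    nth_rewrite 2 [h]
    exact add_neg_cancel X
  have h3 : (algebraMap ℂ (S.O U) (1 / 2)) • (algebraMap ℂ (S.O U) 2) • X = 0 := by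
    rw [h2, smul_zero]
  rw [smul_smul, ← map_mul] at h3
  norm_num at h3
  exact h3

namespace Connection

variable (nabla : S.Connection)

lemma cov_smul {a : ZMod 2} {X : S.T U} (hX : X.IsHom a) (f : S.O U) (Y : S.T U) :
    nabla.cov U X (f • Y) = X.deriv f • Y + parP a f • nabla.cov U X Y := by
  refine O_induction_hom (P := fun f => nabla.cov U X (f • Y) =
    X.deriv f • Y + parP a f • nabla.cov U X Y) f (fun c g hg => ?_) fun f g hf hg => ?_
  · rw [nabla.cov_leibniz U a c X g Y hX hg, parP_of_isHom hg, smul_assoc]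
  · rw [add_smul, nabla.cov_add_right, hf, hg, T.deriv_add, parP_add, add_smul, add_smul]
    abel

/-- The covariant derivative as a biadditive map. -/
def covHom (U : Opens M) : S.T U →+ S.T U →+ S.T U :=
  AddMonoidHom.mk' (fun X => AddMonoidHom.mk' (nabla.cov U X) (nabla.cov_add_right U X))
    fun X X' => AddMonoidHom.ext fun Y => nabla.cov_add_left U X X' Y

lemma cov_zero_right (X : S.T U) : nabla.cov U X 0 = 0 := map_zero (nabla.covHom U X)

lemma cov_sub_right (X Y Z : S.T U) : nabla.cov U X (Y - Z) = nabla.cov U X Y - nabla.cov U X Z :=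
  map_sub (nabla.covHom U X) Y Z

lemma cov_zsmul_right (n : ℤ) (X Y : S.T U) : nabla.cov U X (n • Y) = n • nabla.cov U X Y :=
  map_zsmul (nabla.covHom U X) n Y

lemma cov_sum_right {J : Type*} (s : Finset J) (X : S.T U) (Y : J → S.T U) :
    nabla.cov U X (∑ j ∈ s, Y j) = ∑ j ∈ s, nabla.cov U X (Y j) := map_sum (nabla.covHom U X) Y s

lemma cov_zero_left (Y : S.T U) : nabla.cov U 0 Y = 0 :=
  congrArg (fun F : S.T U →+ S.T U => F Y) (map_zero (nabla.covHom U))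

lemma cov_sum_left {J : Type*} (s : Finset J) (X : J → S.T U) (Y : S.T U) :
    nabla.cov U (∑ j ∈ s, X j) Y = ∑ j ∈ s, nabla.cov U (X j) Y := by
  have h := congrArg (fun F : S.T U →+ S.T U => F Y) (map_sum (nabla.covHom U) X s)
  simp only [AddMonoidHom.finsetSum_apply] at h
  exact h

end Connection

namespace Chart

variable {p k q : ℕ} {φ : S.Chart p k q} {hU : (U : Set M) ⊆ φ.e.source}
  {hV : (V : Set M) ⊆ φ.e.source} {hW : (W : Set M) ⊆ φ.e.source} {x : M} {nabla : S.Connection}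

lemma parP_mem_fil {n : ℕ} {f : S.O U} (a : ZMod 2) (hf : f ∈ φ.fil hU n) :
    parP a f ∈ φ.fil hU n := by
  unfold parP; split_ifs
  · exact hf
  · exact par_mem_fil hf

lemma rep_parP (a : ZMod 2) (f : S.O U) (hx : x ∈ U) :
    φ.rep hU (parP a f) (φ.e x) = parPow N q k a (φ.rep hU f (φ.e x)) := by
  unfold parP parPow; split_ifs
  · rfl
  · exact rep_par f hx

/-- The covariant derivative in coordinates. -/
lemma cov_dT_eq_sum (i : Idx p k q) (s : S.T U) : nabla.cov U (φ.dT i hU) s =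
    ∑ j, (φ.dO i hU (s.deriv (φ.coord j hU)) • φ.dT j hU +
      parP (ipar i) (s.deriv (φ.coord j hU)) • nabla.cov U (φ.dT i hU) (φ.dT j hU)) := by
  conv_lhs => rw [eq_sum_deriv_coord hU s, nabla.cov_sum_right]
  exact Finset.sum_congr rfl fun j _ => nabla.cov_smul (isHom_dT i) _ _

/-- The covariant derivative is continuous for the filtration, with a loss of one degree. It can
therefore be applied termwise to limits. -/
lemma cov_dT_mem_filT {n : ℕ} {s : S.T U} (hs : s ∈ φ.filT hU (n + 1)) (i : Idx p k q) :
    nabla.cov U (φ.dT i hU) s ∈ φ.filT hU n := by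
  rw [cov_dT_eq_sum]
  refine Submodule.sum_mem _ fun j _ => Submodule.add_mem _ ?_ ?_
  · exact smul_mem_filT_left (dO_mem_fil (hs j) i) _
  · exact smul_mem_filT_left (parP_mem_fil _ (fil_antitone n.le_succ (hs j))) _

lemma rep_cov_dT (i l : Idx p k q) (s : S.T U) (hx : x ∈ U) :
    φ.rep hU ((nabla.cov U (φ.dT i hU) s).deriv (φ.coord l hU)) (φ.e x) =
      mder i (φ.rep hU (s.deriv (φ.coord l hU))) (φ.e x) +
        ∑ j, parPow N q k (ipar i) (φ.rep hU (s.deriv (φ.coord j hU)) (φ.e x)) *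
          φ.rep hU ((nabla.cov U (φ.dT i hU) (φ.dT j hU)).deriv (φ.coord l hU)) (φ.e x) := by
  rw [cov_dT_eq_sum, Finset.sum_add_distrib, T.add_deriv, sum_smul_dT_deriv, T.sum_deriv,
    rep_add _ _ hx, rep_sum _ _ hx, rep_dO i _ hx]
  congr 1
  refine Finset.sum_congr rfl fun j _ => ?_
  rw [T.smul_deriv, rep_mul _ _ hx, rep_parP _ _ hx]

/-- Coordinate fields supercommute, so flatness has no bracket term for them. -/
lemma flat_dT (flat : nabla.IsFlat) (i j : Idx p k q) (s : S.T U) :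
    nabla.cov U (φ.dT i hU) (nabla.cov U (φ.dT j hU) s) =
      sgn (ipar i) (ipar j) • nabla.cov U (φ.dT j hU) (nabla.cov U (φ.dT i hU) s) := by
  have h := flat U _ _ (φ.dT i hU) (φ.dT j hU) s (isHom_dT i) (isHom_dT j)
  rwa [bracket_dT, nabla.cov_zero_left, sub_eq_zero] at h

/-! #### Integration in the formal and odd directions -/

lemma isHom_pow {f : S.O U} (hf : S.IsHom 0 f) (m : ℕ) : S.IsHom 0 (f ^ m) := by
  induction m with
  | zero => simpa using isHom_one (S := S) (U := U)
  | succ m ih => rw [pow_succ]; simpa using ih.mul hf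

lemma smul_deriv_O {X : S.T U} (c : ℂ) (f : S.O U) : X.deriv (c • f) = c • X.deriv f :=
  map_smul (X.toEnd.app U le_rfl) c f

/-- The factor `f` on the left avoids the exponent `m - 1`. -/
lemma T.IsHom.deriv_pow {a : ZMod 2} {X : S.T U} (hX : X.IsHom a) {f : S.O U} (hf : S.IsHom 0 f)
    {c : ℂ} (h : X.deriv f = algebraMap ℂ _ c) (m : ℕ) :
    f * X.deriv (f ^ m) = (c * m) • f ^ m := by
  induction m with
  | zero => simp [T.deriv_one]
  | succ m ih =>
    rw [pow_succ', hX.deriv_mul hf, sgn_comm, sgn_zero_left, one_smul, h, ih, mul_add,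
      mul_smul_comm, ← Algebra.smul_def, mul_smul_comm, ← add_smul]
    congr 1
    push_cast; ring

lemma coord_mem_fil (j : Fin k ⊕ Fin q) : φ.coord (Sum.inr j) hU ∈ φ.fil hU 1 := fun x hx => by
  rw [rep_coord _ hx]
  rcases j with j | j
  · exact X_mem_mfil j
  · exact C_mem_mfil (xi_mem_gfil j)

lemma pow_mem_fil {f : S.O U} (hf : f ∈ φ.fil hU 1) (m : ℕ) : f ^ m ∈ φ.fil hU m := by
  induction m with
  | zero => exact mem_fil_zero _
  | succ m ih => rw [pow_succ]; exact mul_mem_fil ih hf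

lemma csmul_mem_fil {n : ℕ} {f : S.O U} (hf : f ∈ φ.fil hU n) (c : ℂ) : c • f ∈ φ.fil hU n := by
  rw [Algebra.smul_def]; exact Ideal.mul_mem_left _ _ hf

/-- The exponential series along a formal coordinate. -/
lemma exists_correction_formal (flat : nabla.IsFlat) (j : Fin k) (s h : S.T U) :
    ∃ r : S.T U, nabla.cov U (φ.dT (.inr (.inl j)) hU) (s + φ.coord (.inr (.inl j)) hU • r) = h ∧
      ∀ i, i ≠ .inr (.inl j) → nabla.cov U (φ.dT i hU) h =
        nabla.cov U (φ.dT (.inr (.inl j)) hU) (nabla.cov U (φ.dT i hU) s) →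
        nabla.cov U (φ.dT i hU) (s + φ.coord (.inr (.inl j)) hU • r) =
          nabla.cov U (φ.dT i hU) s := by
  set t : Idx p k q := .inr (.inl j) with ht
  set y := φ.coord t hU with hy
  set D := fun i => nabla.cov U (φ.dT i hU) with hD
  have hy0 : S.IsHom 0 y := isHom_coord t
  have hpar : ∀ (a : ZMod 2) (c : ℂ) (m : ℕ), parP a (c • y ^ m) = c • y ^ m := by
    intro a c m
    have : S.IsHom 0 (c • y ^ m) := by
      rw [Algebra.smul_def]; simpa using (isHom_algebraMap c).mul (isHom_pow hy0 m)
    rw [parP_of_isHom this, sgn_comm, sgn_zero_left, one_smul]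
  have hpar1 : ∀ a : ZMod 2, parP a y = y := by
    intro a
    rw [parP_of_isHom hy0, sgn_comm, sgn_zero_left, one_smul]
  have hdy : (φ.dT t hU).deriv y = 1 := by rw [hy, deriv_dT_coord, if_pos rfl]
  -- `V 0 = D t s - h` is the error to be removed. The vector field subtracted from `s` is `y • σ`,
  -- with `σ` the sum of `α m • y ^ m • V m`; it plays the role of the integral of the error in the
  -- direction `y`.
  set V : ℕ → S.T U := fun m => (D t)^[m] (D t s - h) with hVdef
  have hV1 : ∀ m, D t (V m) = V (m + 1) := fun m => (Function.iterate_succ_apply' _ _ _).symm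
  -- In `D t (y • σ)` the power `y ^ m` occurs with `V m` twice: from differentiating `y ^ (m + 1)`,
  -- with coefficient `β m = (m + 1) α m`, and from `D t (V (m - 1))`, with coefficient `α (m - 1) =
  -- -β m`. These cancel for `m > 0`, and `V 0` remains.
  set α : ℕ → ℂ := fun m => (-1) ^ m / ((m + 1).factorial : ℂ) with hα
  set β : ℕ → ℂ := fun m => (-1) ^ m / (m.factorial : ℂ) with hβ
  have hαβ : ∀ m, α m * (m + 1) = β m := by
    intro m
    simp only [hα, hβ, Nat.factorial_succ]
    have h1 : (m.factorial : ℂ) ≠ 0 := by exact_mod_cast m.factorial_ne_zero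
    have h2 : (m : ℂ) + 1 ≠ 0 := by exact_mod_cast m.succ_ne_zero
    push_cast
    field_simp
  have hαβ' : ∀ m, α m = -β (m + 1) := by
    intro m
    simp only [hα, hβ, pow_succ]; ring
  set b : ℕ → S.T U := fun m => (α m • y ^ m) • V m with hb
  have hbfil : ∀ m, b m ∈ φ.filT hU m := fun m =>
    smul_mem_filT_left (csmul_mem_fil (pow_mem_fil (coord_mem_fil _) m) _) _
  obtain ⟨σ, hσ⟩ := exists_limT hbfil
  have hDσ : ∀ i n, D i σ - ∑ m ∈ Finset.range (n + 1), D i (b m) ∈ φ.filT hU n := by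
    intro i n
    have := cov_dT_mem_filT (nabla := nabla) (hσ (n + 1)) i
    rwa [nabla.cov_sub_right, nabla.cov_sum_right] at this
  refine ⟨-σ, ?_, ?_⟩
  · rw [smul_neg, ← sub_eq_add_neg, nabla.cov_sub_right, nabla.cov_smul (isHom_dT t), hdy, hpar1,
      one_smul]
    refine sub_eq_zero.1 (eq_zero_of_forall_mem_filT (φ := φ) (hU := hU) fun n => ?_)
    -- The partial sums telescope up to one boundary term, which lies at depth `n`.
    have tele : ∀ n, ∑ m ∈ Finset.range n, (b m + y • D t (b m)) =
        V 0 - (β n • y ^ n) • V n := by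
      intro n
      induction n with
      | zero => simp [hβ]
      | succ n ih =>
        rw [Finset.sum_range_succ, ih]
        have e : y • D t (b n) = ((α n * n) • y ^ n) • V n + (α n • y ^ (n + 1)) • V (n + 1) := by
          simp only [hb, hD]
          rw [nabla.cov_smul (isHom_dT t), hpar, smul_add, smul_smul, smul_smul, smul_deriv_O,
            mul_smul_comm, T.IsHom.deriv_pow (isHom_dT t) hy0 (c := 1) (by rw [hdy, map_one]),
            smul_smul, one_mul, mul_smul_comm, ← pow_succ']
          congr 2
          exact hV1 n
        rw [e, ← hαβ n, show β (n + 1) = -α n by rw [hαβ', neg_neg], mul_add, mul_one, add_smul,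
          add_smul, neg_smul, neg_smul]
        simp only [hb]
        abel
    have h1 : D t s - (σ + y • D t σ) - h = (β (n + 1) • y ^ (n + 1)) • V (n + 1) -
        (σ - ∑ m ∈ Finset.range (n + 1), b m) -
        y • (D t σ - ∑ m ∈ Finset.range (n + 1), D t (b m)) := by
      have h2 := tele (n + 1)
      rw [Finset.sum_add_distrib, ← Finset.smul_sum] at h2
      have h3 : V 0 = D t s - h := rfl
      rw [h3] at h2
      rw [smul_sub]
      rw [show (β (n + 1) • y ^ (n + 1)) • V (n + 1) = (D t s - h) -
        (D t s - h - (β (n + 1) • y ^ (n + 1)) • V (n + 1)) by abel, ← h2]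
      abel
    change D t s - (σ + y • D t σ) - h ∈ _
    rw [h1]
    refine Submodule.sub_mem _ (Submodule.sub_mem _ ?_ ?_) (Submodule.smul_mem _ _ (hDσ t n))
    · exact filT_antitone n.le_succ
        (smul_mem_filT_left (csmul_mem_fil (pow_mem_fil (coord_mem_fil _) _) _) _)
    · exact filT_antitone n.le_succ (hσ (n + 1))
  · intro i hi hclosed
    have hdi : (φ.dT i hU).deriv y = 0 := by rw [hy, deriv_dT_coord, if_neg hi.symm]
    have hcomm : ∀ X, D i (D t X) = D t (D i X) := fun X => by
      have := flat_dT (φ := φ) (hU := hU) flat i t X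
      rwa [sgn_comm, show ipar t = 0 from rfl, sgn_zero_left, one_smul] at this
    -- The hypothesis says that the error is killed by `D i`. As `D i` commutes with `D t`, so are
    -- all `V m`, and `y` is constant in the direction `i`; the correction is invisible to `D i`.
    have hVi : ∀ m, D i (V m) = 0 := by
      intro m
      induction m with
      | zero =>
        change D i (D t s - h) = 0
        have : D i (D t s - h) = D i (D t s) - D i h := nabla.cov_sub_right _ _ _
        rw [this, hcomm, sub_eq_zero]
        exact hclosed.symm
      | succ m ih => rw [← hV1, hcomm, ih]; exact nabla.cov_zero_right _
    have hpow : ∀ m, (φ.dT i hU).deriv (y ^ m) = 0 := by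
      intro m
      induction m with
      | zero => rw [pow_zero]; exact T.deriv_one _
      | succ m ih => rw [pow_succ', (isHom_dT i).deriv_mul hy0, hdi, ih]; simp
    have hbi : ∀ m, D i (b m) = 0 := fun m => by
      have : D i (b m) = _ := nabla.cov_smul (isHom_dT i) (α m • y ^ m) (V m)
      rw [this, smul_deriv_O, hpow, smul_zero, zero_smul, zero_add]
      exact (congrArg _ (hVi m)).trans (smul_zero _)
    have hσi : D i σ = 0 := eq_zero_of_forall_mem_filT (φ := φ) (hU := hU) fun n => by
      simpa [hbi] using hDσ i n
    have : D i (s + y • -σ) = D i s + D i (y • -σ) := nabla.cov_add_right _ _ _ _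
    change D i (s + y • -σ) = D i s
    rw [this, smul_neg, show D i (-(y • σ)) = -D i (y • σ) from map_neg (nabla.covHom U _) _,
      show D i (y • σ) = _ from nabla.cov_smul (isHom_dT i) y σ, hdi, zero_smul, zero_add]
    change _ + -(parP _ y • D i σ) = _
    rw [hσi, smul_zero, neg_zero, add_zero]

/-- For an odd direction flatness gives `∇_ξ ∇_ξ = 0`, so the exponential series stops after one
term: with `r = h - ∇_ξ s` one gets `∇_ξ r = 0` and `∇_ξ (s + ξ r) = ∇_ξ s + r`. In the other
directions the hypothesis says that `r` is flat. -/
lemma exists_correction_odd (flat : nabla.IsFlat) (j : Fin q) (s h : S.T U)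
    (hh : nabla.cov U (φ.dT (.inr (.inr j)) hU) h = 0) :
    ∃ r : S.T U, nabla.cov U (φ.dT (.inr (.inr j)) hU) (s + φ.coord (.inr (.inr j)) hU • r) = h ∧
      ∀ i, i ≠ .inr (.inr j) → nabla.cov U (φ.dT i hU) h = sgn (ipar i) 1 •
        nabla.cov U (φ.dT (.inr (.inr j)) hU) (nabla.cov U (φ.dT i hU) s) →
        nabla.cov U (φ.dT i hU) (s + φ.coord (.inr (.inr j)) hU • r) =
          nabla.cov U (φ.dT i hU) s := by
  set t : Idx p k q := .inr (.inr j) with ht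
  have hflat := flat_dT (φ := φ) (hU := hU) flat t t s
  have h11 : sgn (ipar t) (ipar t) = -1 := by rw [show ipar t = 1 from rfl]; decide
  rw [h11, neg_one_zsmul] at hflat
  have h0 := T.eq_zero_of_eq_neg hflat
  refine ⟨h - nabla.cov U (φ.dT t hU) s, ?_, fun i hi hclosed => ?_⟩
  · rw [nabla.cov_add_right, nabla.cov_smul (isHom_dT t), deriv_dT_coord, if_pos rfl, one_smul,
      nabla.cov_sub_right, hh, h0, sub_zero, smul_zero, add_zero, add_sub_cancel]
  · rw [nabla.cov_add_right, nabla.cov_smul (isHom_dT i), deriv_dT_coord, if_neg hi.symm, zero_smul,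
      zero_add, nabla.cov_sub_right, hclosed, flat_dT flat i t s, show ipar t = 1 from rfl, sub_self,
      smul_zero, add_zero]

/-- Integration in the formal and odd directions. -/
lemma exists_correction (flat : nabla.IsFlat) (h : Idx p k q → S.T U)
    (closed : ∀ i j, nabla.cov U (φ.dT i hU) (h j) =
      sgn (ipar i) (ipar j) • nabla.cov U (φ.dT j hU) (h i)) (s : S.T U)
    (J : Finset (Fin k ⊕ Fin q)) :
    ∃ r : Fin k ⊕ Fin q → S.T U,
      (∀ j ∈ J, nabla.cov U (φ.dT (.inr j) hU)
        (s + ∑ j ∈ J, φ.coord (.inr j) hU • r j) = h (.inr j)) ∧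
      ∀ i, nabla.cov U (φ.dT i hU) s = h i →
        nabla.cov U (φ.dT i hU) (s + ∑ j ∈ J, φ.coord (.inr j) hU • r j) = h i := by
  classical
  induction J using Finset.induction_on with
  | empty => exact ⟨fun _ => 0, by simp, by simp⟩
  | insert a J ha ih =>
    obtain ⟨r, hr, hr'⟩ := ih
    set s' := s + ∑ j ∈ J, φ.coord (.inr j) hU • r j
    -- One new direction is solved without spoiling those in which the equation already holds;
    -- closedness supplies the compatibility needed for that.
    obtain ⟨r', h1, h2⟩ : ∃ r' : S.T U,
        nabla.cov U (φ.dT (.inr a) hU) (s' + φ.coord (.inr a) hU • r') = h (.inr a) ∧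
        ∀ i, i ≠ .inr a → nabla.cov U (φ.dT i hU) s' = h i →
          nabla.cov U (φ.dT i hU) (s' + φ.coord (.inr a) hU • r') = h i := by
      rcases a with a | a
      · obtain ⟨r', h1, h2⟩ := exists_correction_formal (φ := φ) (hU := hU) flat a s' (h (.inr (.inl a)))
        refine ⟨r', h1, fun i hi e => (h2 i hi ?_).trans e⟩
        rw [closed, e, sgn_comm, show ipar (.inr (.inl a) : Idx p k q) = 0 from rfl, sgn_zero_left,
          one_smul]
      -- Closedness of an odd component against itself reads `∇ h = -∇ h`, hence `∇ h = 0`.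
      · have hself := closed (.inr (.inr a)) (.inr (.inr a))
        rw [show ipar (.inr (.inr a) : Idx p k q) = 1 from rfl, show sgn 1 1 = -1 by decide,
          neg_one_zsmul] at hself
        obtain ⟨r', h1, h2⟩ := exists_correction_odd (φ := φ) (hU := hU) flat a s' (h (.inr (.inr a)))
          (T.eq_zero_of_eq_neg hself)
        refine ⟨r', h1, fun i hi e => (h2 i hi ?_).trans e⟩
        rw [closed, e, show ipar (.inr (.inr a) : Idx p k q) = 1 from rfl]
    have e : s + ∑ j ∈ insert a J, φ.coord (.inr j) hU • Function.update r a r' j =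
        s' + φ.coord (.inr a) hU • r' := by
      rw [Finset.sum_insert ha, Function.update_self, add_comm (_ • r'), ← add_assoc]
      congr 2
      refine Finset.sum_congr rfl fun j hj => ?_
      rw [Function.update_of_ne (ne_of_mem_of_not_mem hj ha)]
    refine ⟨Function.update r a r', ?_, ?_⟩
    · rw [e]
      intro j hj
      by_cases hja : j = a
      · subst hja; exact h1
      · exact h2 _ (by simpa using hja) (hr j (Finset.mem_of_mem_insert_of_ne hj hja))
    · rw [e]
      intro i hi
      by_cases hia : i = .inr a
      · subst hia; exact h1
      · exact h2 i hia (hr' i hi)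

end Chart

end SuperSpace

/-! ### Flat connections along the locus of vanishing formal coordinates, and the Poincaré lemma -/

lemma HolAt.pi {p : ℕ} {ι G : Type*} [Fintype ι] [AddCommGroup G] [Module ℂ G]
    {F : (Fin p → ℂ) → ι → G} {y : Fin p → ℂ} (h : ∀ i, HolAt (fun z => F z i) y) : HolAt F y := by
  classical
  have e : F = fun z => ∑ i, LinearMap.single ℂ (fun _ : ι => G) i (F z i) := by
    funext z
    simp only [LinearMap.single_apply, Finset.univ_sum_single]
  rw [e]
  exact HolAt.sum _ fun i _ => (h i).comp_linear (LinearMap.single ℂ (fun _ : ι => G) i)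

/-- The right action of matrices on row vectors. -/
def matAct (ι A : Type*) [Fintype ι] [Ring A] [Algebra ℂ A] :
    (ι → ι → A) →ₗ[ℂ] (ι → A) →ₗ[ℂ] ι → A :=
  LinearMap.mk₂ ℂ (fun c w l => ∑ j, w j * c j l)
    (fun c c' w => by funext l; simp [mul_add, Finset.sum_add_distrib])
    (fun r c w => by funext l; simp [Finset.smul_sum])
    (fun c w w' => by funext l; simp [add_mul, Finset.sum_add_distrib])
    (fun r c w => by funext l; simp [Finset.smul_sum])

namespace SuperSpace

variable {N : ℕ} {M : Type u} [TopologicalSpace M] {S : SuperSpace.{u, v} N M} {U V W : Opens M}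

namespace Chart

variable {p k q : ℕ} {φ : S.Chart p k q} {hU : (U : Set M) ⊆ φ.e.source}
  {hV : (V : Set M) ⊆ φ.e.source} {hW : (W : Set M) ⊆ φ.e.source} {x : M} {nabla : S.Connection}

/-! #### Integration in the convergent directions -/

variable (φ) in
/-- The components of a vector field along `t = 0`. -/
def zeroPart (hU : (U : Set M) ⊆ φ.e.source) (s : S.T U) (z : Fin p → ℂ) :
    Idx p k q → Grassmann N q :=
  fun l => MvPowerSeries.constantCoeff (φ.rep hU (s.deriv (φ.coord l hU)) z)

variable (φ) in
/-- The coefficients of a connection along `t = 0`. -/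
def zeroGamma (nabla : S.Connection) (hU : (U : Set M) ⊆ φ.e.source) (i : Fin p)
    (z : Fin p → ℂ) : Idx p k q → Idx p k q → Grassmann N q :=
  fun j => φ.zeroPart hU (nabla.cov U (φ.dT (.inl i) hU) (φ.dT j hU)) z

lemma holAt_zeroPart (s : S.T U) (hx : x ∈ U) : HolAt (φ.zeroPart hU s) (φ.e x) :=
  HolAt.pi fun _ => holS_rep _ hx 0

lemma holAt_zeroGamma (i : Fin p) (hx : x ∈ U) : HolAt (φ.zeroGamma nabla hU i) (φ.e x) :=
  HolAt.pi fun _ => holAt_zeroPart _ hx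

lemma zeroPart_restrict (h : W ≤ U) (s : S.T U) (hx : x ∈ W) :
    φ.zeroPart hW (s.restrict h) (φ.e x) = φ.zeroPart hU s (φ.e x) := by
  funext l
  unfold zeroPart
  rw [← res_coord (hV := hU) (hW := hW) l h, ← T.res_deriv, rep_res (hV := hU) h _ hx]

lemma zeroPart_sub (s s' : S.T U) (hx : x ∈ U) : φ.zeroPart hU (s - s') (φ.e x) =
    φ.zeroPart hU s (φ.e x) - φ.zeroPart hU s' (φ.e x) := by
  funext l
  unfold zeroPart
  rw [T.sub_deriv, rep_sub _ _ hx, map_sub]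
  rfl

/-- Setting `t = 0` commutes with derivatives in the convergent directions. There the connection
becomes a linear system for functions with values in a finite-dimensional space, the odd variables
being absorbed in the Grassmann algebra. Coefficients act on the right because components stand to
the left of the frame. -/
lemma zeroPart_cov (h : W ≤ U) (hU : (U : Set M) ⊆ φ.e.source) (i : Fin p) (s : S.T W)
    (hx : x ∈ W) : φ.zeroPart hW (nabla.cov W (φ.dT (.inl i) hW) s) (φ.e x) =
      pd i (φ.zeroPart hW s) (φ.e x) + matAct _ _ (φ.zeroGamma nabla hU i (φ.e x))
        (φ.zeroPart hW s (φ.e x)) := by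
  funext l
  have h1 : pd i (φ.zeroPart hW s) (φ.e x) l =
      pd i (fun z => φ.zeroPart hW s z l) (φ.e x) :=
    (holAt_zeroPart s hx).linear_pd (LinearMap.proj l : (Idx p k q → Grassmann N q) →ₗ[ℂ] _) i
  have h2 : ∀ j, φ.zeroPart hW (nabla.cov W (φ.dT (.inl i) hW) (φ.dT j hW)) (φ.e x) =
      φ.zeroGamma nabla hU i (φ.e x) j := fun j => by
    unfold zeroGamma
    rw [← zeroPart_restrict (hW := hW) h _ hx, nabla.cov_res]
    rfl
  rw [Pi.add_apply, h1]
  change _ = _ + ∑ j, φ.zeroPart hW s (φ.e x) j * φ.zeroGamma nabla hU i (φ.e x) j l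
  simp only [← h2]
  unfold zeroPart
  rw [rep_cov_dT _ _ _ hx, map_add, map_sum]
  simp only [map_mul]
  rfl

lemma holS_C_component {P : (Fin p → ℂ) → Idx p k q → Grassmann N q} {y : Fin p → ℂ}
    (hP : HolAt P y) (l : Idx p k q) :
    HolS (fun z => (MvPowerSeries.C (P z l) : ModelAlg N q k)) y :=
  HolS.of_C (hP.comp_linear (LinearMap.proj l : (Idx p k q → Grassmann N q) →ₗ[ℂ] _))

/-- A vector field with given components, constant in the formal directions. -/
lemma exists_zeroPart_eq (hW : (W : Set M) ⊆ φ.e.source)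
    {P : (Fin p → ℂ) → Idx p k q → Grassmann N q} (hP : ∀ x ∈ W, HolAt P (φ.e x)) :
    ∃ s : S.T W, ∀ x ∈ W, φ.zeroPart hW s (φ.e x) = P (φ.e x) := by
  refine ⟨∑ l, φ.ofRep hW (fun z => MvPowerSeries.C (P z l))
    (fun x hx => holS_C_component (hP x hx) l) • φ.dT l hW, fun x hx => ?_⟩
  funext l
  unfold zeroPart
  rw [sum_smul_dT_deriv, rep_ofRep _ hx, MvPowerSeries.constantCoeff_C]

/-- Along `t = 0` the equations in the convergent directions form an integrable holomorphic system,
and they are solved there with a given value at the point. They hold only modulo `t` for now. -/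
lemma exists_initial (flat : nabla.IsFlat) (hU : (U : Set M) ⊆ φ.e.source) (hx : x ∈ U)
    (h : Idx p k q → S.T U)
    (closed : ∀ i j, nabla.cov U (φ.dT i hU) (h j) =
      sgn (ipar i) (ipar j) • nabla.cov U (φ.dT j hU) (h i)) (w : Idx p k q → Grassmann N q) :
    ∃ (W : Opens M) (hWU : W ≤ U) (hW : (W : Set M) ⊆ φ.e.source) (s : S.T W), x ∈ W ∧
      (∀ i, ∀ x' ∈ W, φ.zeroPart hW (nabla.cov W (φ.dT (.inl i) hW) s -
        (h (.inl i)).restrict hWU) (φ.e x') = 0) ∧ φ.zeroPart hW s (φ.e x) = w := by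
  have hsgn : ∀ i j : Fin p, sgn (ipar (.inl i : Idx p k q)) (ipar (.inl j : Idx p k q)) = 1 :=
    fun _ _ => sgn_zero_left 0
  obtain ⟨P, hP, hP0, hPeq⟩ := exists_hol_solution (y := φ.e x)
    (A := fun i z => matAct _ _ (φ.zeroGamma nabla hU i z))
    (h := fun i z => φ.zeroPart hU (h (.inl i)) z)
    (fun i => (holAt_zeroGamma i hx).comp_linear (matAct _ _)) (fun i => holAt_zeroPart _ hx)
    (eventually_image hU hx fun x' hx' i j v => by
      -- Integrability of the coefficients follows by applying the flatness of `∇` to a vector field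
      -- with constant components `v`.
      obtain ⟨s, hs⟩ := exists_zeroPart_eq hU (P := fun _ => v) fun x _ => HolAt.const _
      have hs' : ∀ j, φ.zeroPart hU (nabla.cov U (φ.dT (.inl j) hU) s) =ᶠ[𝓝 (φ.e x')]
          fun z => matAct _ _ (φ.zeroGamma nabla hU j z) v := fun j =>
        eventually_image hU hx' fun x'' hx'' => by
          rw [zeroPart_cov le_rfl hU j s hx'', hs x'' hx'', pd_congr (F' := fun _ => v), pd_const,
            zero_add]
          exact eventually_image hU hx'' hs
      have key : ∀ i j, φ.zeroPart hU (nabla.cov U (φ.dT (.inl i) hU)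
          (nabla.cov U (φ.dT (.inl j) hU) s)) (φ.e x') =
          pd i (fun z => matAct _ _ (φ.zeroGamma nabla hU j z)) (φ.e x') v +
            matAct _ _ (φ.zeroGamma nabla hU i (φ.e x'))
              (matAct _ _ (φ.zeroGamma nabla hU j (φ.e x')) v) := by
        intro i j
        rw [zeroPart_cov le_rfl hU i _ hx', pd_congr i (hs' j), (hs' j).self_of_nhds]
        congr 1
        exact (((holAt_zeroGamma j hx').comp_linear (matAct _ _)).linear_pd
          (LinearMap.applyₗ v) i).symm
      have hflat := flat_dT (φ := φ) (hU := hU) flat (.inl i) (.inl j) s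
      rw [hsgn, one_smul] at hflat
      rw [← key, ← key, hflat])
    (eventually_image hU hx fun x' hx' i j => by
      have hc := closed (.inl i) (.inl j)
      rw [hsgn, one_smul] at hc
      rw [← zeroPart_cov le_rfl hU i _ hx', ← zeroPart_cov le_rfl hU j _ hx', hc]) w
  obtain ⟨W, hWU, hxW, hQ⟩ := exists_nhd hU hx (hPeq.and hP.eventually)
  have hW := subset_source hWU hU
  obtain ⟨s, hs⟩ := exists_zeroPart_eq hW fun x' hx' => (hQ x' hx').2
  refine ⟨W, hWU, hW, s, hxW, fun i x' hx' => ?_, by rw [hs x hxW, hP0]⟩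
  rw [zeroPart_sub _ _ hx', zeroPart_restrict (hU := hU) hWU _ hx', zeroPart_cov hWU hU i s hx',
    hs x' hx', pd_congr i (eventually_image hW hx' hs), (hQ x' hx').1 i, sub_self]

/-- A vector field which is flat in the formal directions and vanishes along `t = 0` is zero. -/
lemma eq_zero_of_formal {E : S.T U} (hE : ∀ j, nabla.cov U (φ.dT (.inr (.inl j)) hU) E = 0)
    (h0 : ∀ x ∈ U, φ.zeroPart hU E (φ.e x) = 0) : E = 0 := by
  classical
  refine T_ext hU fun l => rep_ext (hV := hU) fun x hx => ?_
  rw [T.zero_deriv, rep_zero hx]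
  have key : ∀ (n : ℕ) (m : Fin k →₀ ℕ), m.degree = n → ∀ l,
      MvPowerSeries.coeff m (φ.rep hU (E.deriv (φ.coord l hU)) (φ.e x)) = 0 := by
    intro n
    induction n using Nat.strong_induction_on with
    | _ n ih =>
      intro m hm l
      by_cases hm0 : m = 0
      · subst hm0
        exact congrFun (h0 x hx) l
      · obtain ⟨j, hj⟩ : ∃ j, m j ≠ 0 := by
          by_contra hcon
          push Not at hcon
          exact hm0 (Finsupp.ext hcon)
        have e : m = m - Finsupp.single j 1 + Finsupp.single j 1 :=
          (tsub_add_cancel_of_le (Finsupp.single_le_iff.2 (Nat.one_le_iff_ne_zero.2 hj))).symm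
        set m' := m - Finsupp.single j 1
        have hdeg : m'.degree + 1 = n := by rw [← hm, e, map_add, Finsupp.degree_single]
        -- In the coefficient at `m'` of the equation, the connection terms involve only
        -- coefficients of degree less than `n`, which vanish by induction. What remains is a
        -- nonzero multiple of the coefficient at `m`.
        have h1 := rep_cov_dT (nabla := nabla) (hU := hU) (.inr (.inl j)) l E hx
        rw [hE j, T.zero_deriv, rep_zero hx] at h1
        have h2 := congrArg (MvPowerSeries.coeff m') h1
        rw [map_zero, map_add, map_sum, Finset.sum_eq_zero, add_zero] at h2
        · have h3 : (0 : Grassmann N q) = ((m' j + 1 : ℕ) : ℂ) •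
              MvPowerSeries.coeff (m' + Finsupp.single j 1)
                (φ.rep hU (E.deriv (φ.coord l hU)) (φ.e x)) := h2
          rw [← e] at h3
          refine (smul_eq_zero.1 h3.symm).resolve_left ?_
          exact Nat.cast_ne_zero.2 (Nat.succ_ne_zero _)
        · intro a _
          rw [MvPowerSeries.coeff_mul]
          refine Finset.sum_eq_zero fun d hd => ?_
          have hd' := congrArg Finsupp.degree (Finset.HasAntidiagonal.mem_antidiagonal.1 hd)
          rw [map_add] at hd'
          have : MvPowerSeries.coeff d.1 (parPow N q k (ipar (.inr (.inl j) : Idx p k q))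
              (φ.rep hU (E.deriv (φ.coord a hU)) (φ.e x))) = 0 :=
            ih d.1.degree (by omega) d.1 rfl a
          rw [this, zero_mul]
  ext m
  rw [key _ m rfl l, map_zero]

/-! #### The existence theorem for flat connections -/

lemma ev_add (f g : S.O U) (hx : x ∈ U) : φ.ev hU x (f + g) = φ.ev hU x f + φ.ev hU x g := by
  unfold ev; rw [rep_add _ _ hx, map_add]

lemma ev_zero (hx : x ∈ U) : φ.ev hU x (0 : S.O U) = 0 := by
  unfold ev; rw [rep_zero hx, map_zero]

lemma ev_sum {J : Type*} (s : Finset J) (f : J → S.O U) (hx : x ∈ U) :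
    φ.ev hU x (∑ j ∈ s, f j) = ∑ j ∈ s, φ.ev hU x (f j) := by
  unfold ev; rw [rep_sum _ _ hx, map_sum]

lemma ev_mul (f g : S.O U) (hx : x ∈ U) : φ.ev hU x (f * g) = φ.ev hU x f * φ.ev hU x g := by
  unfold ev; rw [rep_mul _ _ hx, map_mul]

lemma ev_coord (j : Fin k ⊕ Fin q) (hx : x ∈ U) : φ.ev hU x (φ.coord (.inr j) hU) = 0 := by
  unfold ev; rw [rep_coord _ hx]
  rcases j with j | j
  · exact aug_X j
  · exact (aug_C _).trans (algebraMapInv_xi j)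

/-- The reduction to `ℂ` is invariant under the parity involution, so the value of an odd function
equals its own negative. -/
lemma ev_of_odd {f : S.O U} (hf : S.IsHom 1 f) (hx : x ∈ U) : φ.ev hU x f = 0 := by
  have h : φ.ev hU x (S.par U f) = φ.ev hU x f := by
    unfold ev; rw [rep_par _ hx, aug_parity]
  rw [hf.eq, show sgn 1 1 = -1 by decide, neg_one_zsmul] at h
  have h2 := ev_add (hU := hU) (-f) f hx
  rw [neg_add_cancel, ev_zero hx, h] at h2
  linear_combination (-1 / 2 : ℂ) * h2

lemma zmod_two_add_ne : ∀ a : ZMod 2, a + 0 ≠ a + 1 := by decide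

lemma zmod_two_add_of_ne : ∀ c d : ZMod 2, d ≠ c → c + d = 1 := by decide

/-- A covariant derivative along a field of parity `a` shifts parity by `a` and does not mix
components. A homogeneous solution can thus be extracted from any solution. -/
lemma cov_hp {a : ZMod 2} {X : S.T U} (hX : X.IsHom a) (b : ZMod 2) (s : S.T U) :
    nabla.cov U X (s.hp b) = (nabla.cov U X s).hp (a + b) := by
  conv_rhs => rw [← s.hp_add_hp, nabla.cov_add_right, T.hp_add]
  have h0 := nabla.cov_hom U a 0 X _ hX (T.isHom_hp 0 s)
  have h1 := nabla.cov_hom U a 1 X _ hX (T.isHom_hp 1 s)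
  obtain rfl | rfl := zmod_two_cases b
  · rw [h0.hp_self, h1.hp_of_ne (zmod_two_add_ne a), add_zero]
  · rw [h1.hp_self, h0.hp_of_ne (zmod_two_add_ne a).symm, zero_add]

/-- The closed one-forms for a flat connection are locally exact. -/
theorem exists_primitive (flat : nabla.IsFlat) (hU : (U : Set M) ⊆ φ.e.source) (hx : x ∈ U)
    (h : Idx p k q → S.T U) (b : ZMod 2) (hh : ∀ i, (h i).IsHom (ipar i + b))
    (closed : ∀ i j, nabla.cov U (φ.dT i hU) (h j) =
      sgn (ipar i) (ipar j) • nabla.cov U (φ.dT j hU) (h i))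
    (w : Idx p k q → ℂ) (hw : ∀ l, ipar l ≠ b → w l = 0) :
    ∃ (W : Opens M) (hWU : W ≤ U) (hW : (W : Set M) ⊆ φ.e.source) (s : S.T W), x ∈ W ∧ s.IsHom b ∧
      (∀ i, nabla.cov W (φ.dT i hW) s = (h i).restrict hWU) ∧
        ∀ l, φ.ev hW x (s.deriv (φ.coord l hW)) = w l := by
  classical
  -- The order matters: `s₀` solves the convergent directions along `t = 0`, the formal corrections
  -- then solve the formal directions exactly, and the odd corrections come last.
  obtain ⟨W, hWU, hW, s₀, hxW, hs₀, hs₀x⟩ := exists_initial flat hU hx h closed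
    fun l => algebraMap ℂ _ (w l)
  have closed' : ∀ i j, nabla.cov W (φ.dT i hW) ((h j).restrict hWU) =
      sgn (ipar i) (ipar j) • nabla.cov W (φ.dT j hW) ((h i).restrict hWU) := fun i j => by
    have := congrArg (T.restrict hWU) (closed i j)
    rwa [T.restrict_zsmul, nabla.cov_res, nabla.cov_res, restrict_dT (hV := hW),
      restrict_dT (hV := hW)] at this
  obtain ⟨r₁, hr₁, -⟩ := exists_correction (φ := φ) (hU := hW) flat _ closed' s₀
    (Finset.univ.map Function.Embedding.inl)
  set s₁ := s₀ + ∑ j ∈ Finset.univ.map Function.Embedding.inl, φ.coord (.inr j) hW • r₁ j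
    with hs₁
  -- The error in a convergent direction is flat in the formal directions, by flatness and
  -- closedness. It vanishes along `t = 0`, because the formal corrections are multiples of the
  -- `tⱼ`. So it is zero.
  have hx₁ : ∀ i, nabla.cov W (φ.dT (.inl i) hW) s₁ = (h (.inl i)).restrict hWU := by
    intro i
    refine sub_eq_zero.1 (eq_zero_of_formal (φ := φ) (hU := hW) (nabla := nabla) (fun j => ?_)
      fun x' hx' => ?_)
    · rw [nabla.cov_sub_right, flat_dT flat, hr₁ (.inl j) (by simp), closed' (.inl i), smul_smul,
        sgn_comm, sgn_mul_self, one_smul, sub_self]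
    · have e : nabla.cov W (φ.dT (.inl i) hW) s₁ - (h (.inl i)).restrict hWU =
          (nabla.cov W (φ.dT (.inl i) hW) s₀ - (h (.inl i)).restrict hWU) -
            ∑ j : Fin k, φ.coord (.inr (.inl j)) hW •
              (-nabla.cov W (φ.dT (.inl i) hW) (r₁ (.inl j))) := by
        rw [hs₁, nabla.cov_add_right, nabla.cov_sum_right, Finset.sum_map]
        simp only [smul_neg, Finset.sum_neg_distrib]
        have : ∀ j : Fin k, nabla.cov W (φ.dT (.inl i) hW) (φ.coord (.inr (.inl j)) hW •
            r₁ (.inl j)) = φ.coord (.inr (.inl j)) hW • nabla.cov W (φ.dT (.inl i) hW)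
              (r₁ (.inl j)) := fun j => by
          rw [nabla.cov_smul (isHom_dT _), deriv_dT_coord, if_neg (by simp), zero_smul, zero_add]
          rfl
        simp only [Function.Embedding.inl_apply, this]
        abel
      rw [e, zeroPart_sub _ _ hx', hs₀ i x' hx', zero_sub, neg_eq_zero]
      funext l
      unfold zeroPart
      rw [T.sum_deriv, rep_sum _ _ hx', map_sum]
      refine Finset.sum_eq_zero fun j _ => ?_
      rw [T.smul_deriv, rep_mul _ _ hx', map_mul, rep_coord _ hx']
      change MvPowerSeries.constantCoeff (MvPowerSeries.X j) * _ = 0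
      rw [MvPowerSeries.constantCoeff_X, zero_mul]
  obtain ⟨r₂, hr₂, hr₂'⟩ := exists_correction (φ := φ) (hU := hW) flat _ closed' s₁
    (Finset.univ.map Function.Embedding.inr)
  set s₂ := s₁ + ∑ j ∈ Finset.univ.map Function.Embedding.inr, φ.coord (.inr j) hW • r₂ j
    with hs₂
  have hall : ∀ i, nabla.cov W (φ.dT i hW) s₂ = (h i).restrict hWU := by
    rintro (i | j | j)
    · exact hr₂' _ (hx₁ i)
    · exact hr₂' _ (hr₁ (.inl j) (by simp))
    · exact hr₂ (.inr j) (by simp)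
  -- All corrections are multiples of formal or odd coordinates and do not change the value at the
  -- point.
  have hev : ∀ l, φ.ev hW x (s₂.deriv (φ.coord l hW)) = w l := by
    have hsum : ∀ (J : Finset (Fin k ⊕ Fin q)) (r : Fin k ⊕ Fin q → S.T W) l,
        φ.ev hW x ((∑ j ∈ J, φ.coord (.inr j) hW • r j).deriv (φ.coord l hW)) = 0 := by
      intro J r l
      rw [T.sum_deriv, ev_sum _ _ hxW]
      refine Finset.sum_eq_zero fun j _ => ?_
      rw [T.smul_deriv, ev_mul _ _ hxW, ev_coord _ hxW, zero_mul]
    intro l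
    rw [hs₂, hs₁, T.add_deriv, T.add_deriv, ev_add _ _ hxW, ev_add _ _ hxW, hsum, hsum, add_zero,
      add_zero]
    change ExteriorAlgebra.algebraMapInv (φ.zeroPart hW s₀ (φ.e x) l) = w l
    rw [hs₀x]
    exact ExteriorAlgebra.algebraMap_leftInverse _ _
  -- Passing to the component of parity `b` keeps the equations, whose right sides have matching
  -- parity. It keeps the initial values because `w` vanishes on coordinates of the other parity.
  refine ⟨W, hWU, hW, s₂.hp b, hxW, T.isHom_hp b s₂, fun i => ?_, fun l => ?_⟩
  · rw [cov_hp (isHom_dT i), hall i]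
    exact ((hh i).restrict hWU).hp_self
  · have hparity : ∀ c, φ.ev hW x ((s₂.hp c).deriv (φ.coord l hW)) =
        if ipar l = c then w l else 0 := by
      have hodd : ∀ c, ipar l ≠ c → φ.ev hW x ((s₂.hp c).deriv (φ.coord l hW)) = 0 := by
        intro c hc
        have h1 := (T.isHom_hp c s₂).deriv (isHom_coord (φ := φ) (hV := hW) l)
        rw [zmod_two_add_of_ne _ _ hc] at h1
        exact ev_of_odd h1 hxW
      intro c
      split_ifs with hc
      · rw [← hev l]
        conv_rhs => rw [← s₂.hp_add_hp, T.add_deriv, ev_add _ _ hxW]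
        obtain rfl | rfl := zmod_two_cases c
        · rw [hodd 1 (by rw [hc]; decide), add_zero]
        · rw [hodd 0 (by rw [hc]; decide), zero_add]
      · exact hodd c hc
    rw [hparity b]
    split_ifs with hc
    · rfl
    · exact (hw l hc).symm

end Chart

end SuperSpace

/-! ### Inverse matrices and flat frames -/

lemma analyticAt_det {E : Type*} [NormedAddCommGroup E] [NormedSpace ℂ E] {n : Type*} [Fintype n]
    [DecidableEq n] {A : E → Matrix n n ℂ} {y : E} (hA : ∀ i j, AnalyticAt ℂ (fun z => A z i j) y) :
    AnalyticAt ℂ (fun z => (A z).det) y := by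
  simp only [Matrix.det_apply]
  refine Finset.analyticAt_fun_sum _ fun σ _ => ?_
  have h := Finset.analyticAt_fun_prod Finset.univ fun i _ => hA (σ i) i
  obtain hs | hs := Int.units_eq_one_or (Equiv.Perm.sign σ)
  · simpa [hs] using h
  · simpa [hs] using h.fun_neg

lemma analyticAt_inv {E : Type*} [NormedAddCommGroup E] [NormedSpace ℂ E] {n : Type*} [Fintype n]
    [DecidableEq n] {A : E → Matrix n n ℂ} {y : E} (hA : ∀ i j, AnalyticAt ℂ (fun z => A z i j) y)
    (hy : (A y).det ≠ 0) (i j : n) : AnalyticAt ℂ (fun z => (A z)⁻¹ i j) y := by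
  simp only [Matrix.inv_def, Ring.inverse_eq_inv', Matrix.smul_apply, smul_eq_mul,
    Matrix.adjugate_apply]
  refine ((analyticAt_det hA).inv hy).mul (analyticAt_det fun a b => ?_)
  simp only [Matrix.updateRow_apply]
  split_ifs
  · exact analyticAt_const
  · exact hA a b

namespace SuperSpace

variable {N : ℕ} {M : Type u} [TopologicalSpace M] {S : SuperSpace.{u, v} N M} {U V W : Opens M}

namespace Chart

variable {p k q : ℕ} {φ : S.Chart p k q} {hU : (U : Set M) ⊆ φ.e.source}
  {hV : (V : Set M) ⊆ φ.e.source} {hW : (W : Set M) ⊆ φ.e.source} {x : M} {nabla : S.Connection}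

/-! #### Inverses of matrices of functions -/

section Inverse

variable {n : Type} [Fintype n]

lemma matrix_mul_mem_fil {a b : ℕ} {A B : Matrix n n (S.O U)} (hA : ∀ i j, A i j ∈ φ.fil hU a)
    (hB : ∀ i j, B i j ∈ φ.fil hU b) (i j : n) : (A * B) i j ∈ φ.fil hU (a + b) := by
  rw [Matrix.mul_apply]
  exact Ideal.sum_mem _ fun l _ => mul_mem_fil (hA i l) (hB l j)

variable [DecidableEq n]

lemma matrix_pow_mem_fil {A : Matrix n n (S.O U)} (hA : ∀ i j, A i j ∈ φ.fil hU 1) (m : ℕ) :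
    ∀ i j, (A ^ m) i j ∈ φ.fil hU m := by
  induction m with
  | zero => exact fun _ _ => mem_fil_zero _
  | succ m ih => rw [pow_succ]; exact matrix_mul_mem_fil ih hA

/-- The geometric series. -/
lemma exists_inverse_one_sub {B : Matrix n n (S.O U)} (hB : ∀ i j, B i j ∈ φ.fil hU 1) :
    ∃ G, (1 - B) * G = 1 ∧ G * (1 - B) = 1 := by
  choose g hg using fun i j => exists_lim fun m => matrix_pow_mem_fil hB m i j
  have hG : ∀ m i j, (Matrix.of g - ∑ l ∈ Finset.range m, B ^ l) i j ∈ φ.fil hU m := by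
    intro m i j
    rw [Matrix.sub_apply, Matrix.sum_apply]
    exact hg i j m
  have h0 : ∀ A : Matrix n n (S.O U), (∀ m i j, A i j ∈ φ.fil hU m) → A = 0 := fun A hA =>
    Matrix.ext fun i j => eq_zero_of_forall_mem_fil fun m => hA m i j
  refine ⟨Matrix.of g, sub_eq_zero.1 (h0 _ fun m i j => ?_), sub_eq_zero.1 (h0 _ fun m i j => ?_)⟩
  · have e : (1 - B) * Matrix.of g - 1 =
        (1 - B) * (Matrix.of g - ∑ l ∈ Finset.range m, B ^ l) - B ^ m := by
      rw [mul_sub, mul_neg_geom_sum]; abel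
    rw [e, Matrix.sub_apply]
    refine Ideal.sub_mem _ ?_ (matrix_pow_mem_fil hB m i j)
    simpa using matrix_mul_mem_fil (a := 0) (fun i j => mem_fil_zero _) (hG m) i j
  · have e : Matrix.of g * (1 - B) - 1 =
        (Matrix.of g - ∑ l ∈ Finset.range m, B ^ l) * (1 - B) - B ^ m := by
      rw [sub_mul, geom_sum_mul_neg]; abel
    rw [e, Matrix.sub_apply]
    refine Ideal.sub_mem _ ?_ (matrix_pow_mem_fil hB m i j)
    simpa using matrix_mul_mem_fil (b := 0) (hG m) (fun i j => mem_fil_zero _) i j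

lemma ev_one (hx : x ∈ U) : φ.ev hU x (1 : S.O U) = 1 := by
  unfold ev; rw [rep_one hx, map_one]

lemma ev_sub (f g : S.O U) (hx : x ∈ U) : φ.ev hU x (f - g) = φ.ev hU x f - φ.ev hU x g := by
  unfold ev; rw [rep_sub _ _ hx, map_sub]

lemma ev_res (h : W ≤ U) (f : S.O U) (hx : x ∈ W) : φ.ev hW x (S.res h f) = φ.ev hU x f := by
  unfold ev; rw [rep_res (hV := hU) h _ hx]

lemma mem_fil_one {f : S.O U} (h : ∀ x ∈ U, φ.ev hU x f = 0) : f ∈ φ.fil hU 1 := fun x hx =>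
  mem_mfil_one_of_aug (h x hx)

/-- A matrix of functions which is invertible at a point modulo formal and odd coordinates and odd
constants is invertible near this point. -/
lemma exists_inverse (hU : (U : Set M) ⊆ φ.e.source) (hx : x ∈ U) (E : Matrix n n (S.O U))
    (hE : ∀ i j, φ.ev hU x (E i j) = (1 : Matrix n n ℂ) i j) :
    ∃ (W : Opens M) (hWU : W ≤ U) (F : Matrix n n (S.O W)), x ∈ W ∧
      E.map (S.res hWU) * F = 1 ∧ F * E.map (S.res hWU) = 1 := by
  set ε : (Fin p → ℂ) → Matrix n n ℂ := fun z => Matrix.of fun i j => aug N q k (φ.rep hU (E i j) z)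
  have hε : ∀ x' ∈ U, ∀ i j, AnalyticAt ℂ (fun z => ε z i j) (φ.e x') := fun x' hx' i j =>
    holS_rep (hV := hU) (E i j) hx' 0 (ExteriorAlgebra.algebraMapInv : Grassmann N q →ₐ[ℂ] ℂ).toLinearMap
  have hε1 : ε (φ.e x) = 1 := Matrix.ext hE
  have hdet : ∀ᶠ z in 𝓝 (φ.e x), (ε z).det ≠ 0 := by
    refine (analyticAt_det (hε x hx)).continuousAt.eventually_ne ?_
    rw [hε1, Matrix.det_one]; exact one_ne_zero
  obtain ⟨W, hWU, hxW, hW'⟩ := exists_nhd hU hx hdet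
  have hW := subset_source hWU hU
  -- The inverse of the reduction to `ℂ` is lifted to functions without formal or odd parts. Then
  -- `E' * H` and `H * E'` differ from `1` by matrices at depth `1`, and geometric series invert
  -- them.
  set H : Matrix n n (S.O W) := Matrix.of fun i j =>
    φ.ofRep hW (fun z => MvPowerSeries.C (algebraMap ℂ _ ((ε z)⁻¹ i j))) fun x' hx' =>
      HolS.of_C ((AnalyticAt.holAt (analyticAt_inv (hε x' (hWU hx')) (hW' x' hx') i j)).comp_linear
        (Algebra.linearMap ℂ (Grassmann N q)))
  have hH : ∀ x' ∈ W, ∀ i j, φ.ev hW x' (H i j) = (ε (φ.e x'))⁻¹ i j := by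
    intro x' hx' i j
    unfold ev
    simp only [H, Matrix.of_apply]
    rw [rep_ofRep _ hx', aug_C]
    exact ExteriorAlgebra.algebraMap_leftInverse _ _
  set E' := E.map (S.res hWU)
  have hE' : ∀ x' ∈ W, ∀ i j, φ.ev hW x' (E' i j) = ε (φ.e x') i j := by
    intro x' hx' i j
    exact ev_res (hU := hU) hWU (E i j) hx'
  have hone : ∀ x' ∈ W, ∀ i j, φ.ev hW x' ((1 : Matrix n n (S.O W)) i j) =
      (1 : Matrix n n ℂ) i j := by
    intro x' hx' i j
    rw [Matrix.one_apply, Matrix.one_apply]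
    split_ifs
    · exact ev_one hx'
    · exact ev_zero hx'
  have h1 : ∀ i j, (1 - E' * H) i j ∈ φ.fil hW 1 := fun i j => mem_fil_one fun x' hx' => by
    rw [Matrix.sub_apply, Matrix.mul_apply, ev_sub _ _ hx', ev_sum _ _ hx', hone x' hx']
    simp only [ev_mul _ _ hx', hH x' hx', hE' x' hx']
    rw [← Matrix.mul_apply, Matrix.mul_nonsing_inv _ (hW' x' hx').isUnit, sub_self]
  have h2 : ∀ i j, (1 - H * E') i j ∈ φ.fil hW 1 := fun i j => mem_fil_one fun x' hx' => by
    rw [Matrix.sub_apply, Matrix.mul_apply, ev_sub _ _ hx', ev_sum _ _ hx', hone x' hx']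
    simp only [ev_mul _ _ hx', hH x' hx', hE' x' hx']
    rw [← Matrix.mul_apply, Matrix.nonsing_inv_mul _ (hW' x' hx').isUnit, sub_self]
  obtain ⟨G, hG, -⟩ := exists_inverse_one_sub h1
  obtain ⟨G', -, hG'⟩ := exists_inverse_one_sub h2
  rw [sub_sub_cancel, mul_assoc] at hG
  rw [sub_sub_cancel, ← mul_assoc] at hG'
  refine ⟨W, hWU, H * G, hxW, hG, ?_⟩
  rw [← left_inv_eq_right_inv hG' hG, hG']

end Inverse

/-! #### Flat frames -/

lemma hp_smul {a : ZMod 2} {X : S.T U} (hX : X.IsHom a) (f : S.O U) (c : ZMod 2) :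
    (f • X).hp c = S.homPart (c + a) f • X := by
  conv_lhs => rw [← S.homPart_add f, add_smul, T.hp_add]
  have h0 := T.IsHom.smul (S.isHom_homPart 0 f) hX
  have h1 := T.IsHom.smul (S.isHom_homPart 1 f) hX
  obtain rfl | rfl := zmod_two_cases a <;> obtain rfl | rfl := zmod_two_cases c
  · rw [h1.hp_of_ne (by decide), add_zero]; exact h0.hp_self
  · rw [h0.hp_of_ne (by decide), zero_add]; exact h1.hp_self
  · rw [h0.hp_of_ne (by decide), zero_add]; exact h1.hp_self
  · rw [h1.hp_of_ne (by decide), add_zero]; exact h0.hp_self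

variable (φ nabla) in
/-- A frame of flat vector fields in a chart. -/
structure FlatFrame (hW : (W : Set M) ⊆ φ.e.source) where
  e : Idx p k q → S.T W
  isHom : ∀ a, (e a).IsHom (ipar a)
  flat : ∀ i a, nabla.cov W (φ.dT i hW) (e a) = 0
  F : Idx p k q → Idx p k q → S.O W
  isHom_F : ∀ i a, S.IsHom (ipar i + ipar a) (F i a)
  dT_eq : ∀ i, φ.dT i hW = ∑ a, F i a • e a
  mul_eq : (Matrix.of fun a l => (e a).deriv (φ.coord l hW)) * Matrix.of F = 1

/-- Primitives of the zero form with the unit vectors as values at `x` give flat fields whose matrix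
of components reduces to the identity at `x`. That matrix is invertible near `x`. -/
lemma exists_flatFrame (flat : nabla.IsFlat) (hU : (U : Set M) ⊆ φ.e.source) (hx : x ∈ U) :
    ∃ (W : Opens M) (_ : W ≤ U) (hW : (W : Set M) ⊆ φ.e.source), x ∈ W ∧
      Nonempty (φ.FlatFrame nabla hW) := by
  have key := fun a : Idx p k q => exists_primitive (nabla := nabla) flat hU hx
    (fun _ => 0) (ipar a) (fun _ => T.isHom_zero _) (fun i j => by
      rw [nabla.cov_zero_right, nabla.cov_zero_right, smul_zero]) (Pi.single a 1)
    fun l hl => Pi.single_eq_of_ne (fun h => hl (by rw [h])) _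
  choose W₀ hW₀U hW₀ s hxW₀ hs hcov hev using key
  set W₁ : Opens M := U ⊓ Finset.univ.inf W₀
  have hle : ∀ a, W₁ ≤ W₀ a := fun a => inf_le_right.trans (Finset.inf_le (Finset.mem_univ a))
  have hW₁U : W₁ ≤ U := inf_le_left
  have hW₁ := subset_source hW₁U hU
  have hxW₁ : x ∈ W₁ := by
    refine ⟨hx, ?_⟩
    rw [Opens.coe_finset_inf]
    simpa using hxW₀
  have hres : ∀ {W : Opens M} (h : W ≤ W₁) (hW : (W : Set M) ⊆ φ.e.source) a l,
      S.res h (((s a).restrict (hle a)).deriv (φ.coord l hW₁)) =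
        ((s a).restrict (h.trans (hle a))).deriv (φ.coord l hW) := fun h hW a l => by
    rw [T.res_deriv, res_coord (hW := hW)]
    rfl
  obtain ⟨W, hWW₁, F, hxW, hEF, hFE⟩ := exists_inverse hW₁ hxW₁
    (Matrix.of fun a l => ((s a).restrict (hle a)).deriv (φ.coord l hW₁)) (fun a l => by
      rw [Matrix.of_apply, ← res_coord (hV := hW₀ a) l (hle a), ← T.res_deriv,
        ev_res (hU := hW₀ a) (hle a) _ hxW₁, hev, Matrix.one_apply, Pi.single_apply]
      simp only [eq_comm])
  have hW := subset_source hWW₁ hW₁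
  set e : Idx p k q → S.T W := fun a => (s a).restrict (hWW₁.trans (hle a))
  have he : ∀ a, (e a).IsHom (ipar a) := fun a => (hs a).restrict _
  set E : Matrix (Idx p k q) (Idx p k q) (S.O W) := Matrix.of fun a l => (e a).deriv (φ.coord l hW)
  have hE : (Matrix.of fun a l => ((s a).restrict (hle a)).deriv (φ.coord l hW₁)).map
      (S.res hWW₁) = E := Matrix.ext fun a l => hres hWW₁ hW a l
  rw [hE] at hEF hFE
  have hdT : ∀ i, φ.dT i hW = ∑ a, F i a • e a := by
    intro i
    refine T_ext hW fun l => ?_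
    rw [T.sum_deriv, deriv_dT_coord]
    simp only [T.smul_deriv]
    change _ = ∑ a, F i a * E a l
    rw [← Matrix.mul_apply, hFE, Matrix.one_apply]
    simp only [eq_comm]
  -- The entries of the inverse matrix need not be known to be homogeneous. Taking the component of
  -- parity `ipar i` of the expansion replaces them by homogeneous ones, which still form a left
  -- inverse and hence coincide with the inverse.
  have hdT' : ∀ i, φ.dT i hW = ∑ a, S.homPart (ipar i + ipar a) (F i a) • e a := by
    intro i
    have hsum : ∀ (J : Finset (Idx p k q)),
        (∑ a ∈ J, F i a • e a).hp (ipar i) =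
          ∑ a ∈ J, S.homPart (ipar i + ipar a) (F i a) • e a := by
      intro J
      induction J using Finset.induction_on with
      | empty => exact (T.isHom_zero (ipar i)).hp_self
      | insert a J ha ih =>
        rw [Finset.sum_insert ha, Finset.sum_insert ha, T.hp_add, ih, hp_smul (he a)]
    rw [← hsum, ← hdT]
    exact (isHom_dT i).hp_self.symm
  refine ⟨W, hWW₁.trans hW₁U, hW, hxW, ⟨⟨e, he, fun i a => ?_,
    fun i a => S.homPart (ipar i + ipar a) (F i a), fun i a => S.isHom_homPart _ _, hdT', ?_⟩⟩⟩
  · have := congrArg (T.restrict (hWW₁.trans (hle a))) (hcov a i)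
    rw [nabla.cov_res, restrict_dT (hV := hW)] at this
    exact this
  · have h1 : (Matrix.of fun i a => S.homPart (ipar i + ipar a) (F i a)) * E = 1 := by
      refine Matrix.ext fun i l => ?_
      have := congrArg (fun X : S.T W => X.deriv (φ.coord l hW)) (hdT' i)
      simp only [T.sum_deriv, T.smul_deriv, deriv_dT_coord] at this
      rw [Matrix.one_apply]
      simp only [eq_comm (a := i)]
      exact this.symm
    rw [left_inv_eq_right_inv h1 hEF]
    exact hEF

namespace FlatFrame

/-- The restriction of a flat frame. -/
def restrict (B : φ.FlatFrame nabla hW) (h : V ≤ W) (hV : (V : Set M) ⊆ φ.e.source) :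
    φ.FlatFrame nabla hV where
  e a := (B.e a).restrict h
  isHom a := (B.isHom a).restrict h
  flat i a := by
    have := congrArg (T.restrict h) (B.flat i a)
    rwa [nabla.cov_res, restrict_dT (hV := hV)] at this
  F i a := S.res h (B.F i a)
  isHom_F i a := (B.isHom_F i a).res h
  dT_eq i := by
    have := congrArg (T.restrict h) (B.dT_eq i)
    rw [restrict_dT (hV := hV), T.restrict_sum] at this
    simpa only [T.restrict_smul] using this
  mul_eq := by
    refine Matrix.ext fun a b => ?_
    have := congrArg (S.res h) (congrFun (congrFun B.mul_eq a) b)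
    rw [Matrix.mul_apply, map_sum] at this
    rw [Matrix.mul_apply]
    simp only [Matrix.of_apply, map_mul, T.res_deriv, res_coord (hW := hV)] at this ⊢
    rw [this, Matrix.one_apply, Matrix.one_apply]
    split_ifs <;> simp

variable (B : φ.FlatFrame nabla hW)

lemma indep {c : Idx p k q → S.O W} (hc : ∑ a, c a • B.e a = 0) : c = 0 := by
  have h1 : Matrix.vecMul c (Matrix.of fun a l => (B.e a).deriv (φ.coord l hW)) = 0 := by
    funext l
    have := congrArg (fun X : S.T W => X.deriv (φ.coord l hW)) hc
    simp only [T.sum_deriv, T.smul_deriv, T.zero_deriv] at this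
    exact this
  rw [← Matrix.vecMul_one c, ← B.mul_eq, ← Matrix.vecMul_vecMul, h1, Matrix.zero_vecMul]

lemma cov_eq_zero (X : S.T W) (a : Idx p k q) : nabla.cov W X (B.e a) = 0 := by
  rw [eq_sum_deriv_coord hW X, nabla.cov_sum_left]
  refine Finset.sum_eq_zero fun i _ => ?_
  rw [nabla.cov_smul_left, B.flat, smul_zero]

/-- The components of a vector field in a flat frame. -/
def comp (X : S.T W) (a : Idx p k q) : S.O W := ∑ i, X.deriv (φ.coord i hW) * B.F i a

lemma eq_sum_comp (X : S.T W) : X = ∑ a, B.comp X a • B.e a := by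
  conv_lhs => rw [eq_sum_deriv_coord hW X]
  simp only [B.dT_eq, Finset.smul_sum, smul_smul, comp, Finset.sum_smul]
  exact Finset.sum_comm

lemma isHom_comp {c : ZMod 2} {X : S.T W} (hX : X.IsHom c) (a : Idx p k q) :
    S.IsHom (c + ipar a) (B.comp X a) := by
  have h : ∀ J : Finset (Idx p k q),
      S.IsHom (c + ipar a) (∑ i ∈ J, X.deriv (φ.coord i hW) * B.F i a) := by
    intro J
    induction J using Finset.induction_on with
    | empty => exact isHom_zero _
    | insert i J hi ih =>
      rw [Finset.sum_insert hi]
      refine IsHom.add ?_ ih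
      have := (hX.deriv (isHom_coord (φ := φ) (hV := hW) i)).mul (B.isHom_F i a)
      rwa [add_assoc, ← add_assoc (ipar i), ← add_assoc, ← add_assoc, ipar_add_self] at this
  exact h _

end FlatFrame

end Chart

end SuperSpace

/-! ### Algebra of a multiplication and a covariant derivative -/

section SuperAlgebra

lemma sgn_zero_right (a : ZMod 2) : sgn a 0 = 1 := by rw [sgn_comm, sgn_zero_left]

lemma sgn_eq_or : ∀ a b, sgn a b = 1 ∨ sgn a b = -1 := by decide

lemma sgn_one_one : sgn 1 1 = -1 := by decide

variable {E : Type*} [AddCommGroup E] {H : ZMod 2 → E → Prop} {m n : E →+ E →+ E}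

/-- The covariant derivative `(∇_X m)(Y, Z)` of a multiplication `m`. -/
def covMul (m n : E →+ E →+ E) (a b : ZMod 2) (X Y Z : E) : E :=
  n X (m Y Z) - m (n X Y) Z - sgn a b • m Y (n X Z)

/-- The derivative of associativity. -/
lemma covMul_assoc (assoc : ∀ X Y Z, m (m X Y) Z = m X (m Y Z)) {v a b : ZMod 2} {V A B : E} (C : E) :
    covMul m n v (a + b) V (m A B) C + m (covMul m n v a V A B) C =
      covMul m n v a V A (m B C) + sgn v a • m A (covMul m n v b V B C) := by
  unfold covMul
  simp only [map_sub, map_zsmul, AddMonoidHom.sub_apply, AddMonoidHom.coe_smul, Pi.smul_apply,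
    assoc, smul_sub, smul_smul, sgn_add_right]
  abel

lemma covMul_mem (hm : ∀ a b X Y, H a X → H b Y → H (a + b) (m X Y))
    (hn : ∀ a b X Y, H a X → H b Y → H (a + b) (n X Y))
    (hsub : ∀ a X Y, H a X → H a Y → H a (X - Y)) (hz : ∀ a X (z : ℤ), H a X → H a (z • X))
    {a b c : ZMod 2} {X Y Z : E} (hX : H a X) (hY : H b Y) (hZ : H c Z) :
    H (a + b + c) (covMul m n a b X Y Z) := by
  refine hsub _ _ _ (hsub _ _ _ ?_ (hm _ _ _ _ (hn _ _ _ _ hX hY) hZ)) (hz _ _ _ ?_)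
  · rw [add_assoc]; exact hn _ _ _ _ hX (hm _ _ _ _ hY hZ)
  · rw [add_comm a b, add_assoc]; exact hm _ _ _ _ hY (hn _ _ _ _ hX hZ)

/-- The key identity for the derivative of a supercommutative associative multiplication. -/
lemma covMul_mul (hm : ∀ a b X Y, H a X → H b Y → H (a + b) (m X Y))
    (hn : ∀ a b X Y, H a X → H b Y → H (a + b) (n X Y))
    (hsub : ∀ a X Y, H a X → H a Y → H a (X - Y)) (hz : ∀ a X (z : ℤ), H a X → H a (z • X))
    (comm : ∀ a b X Y, H a X → H b Y → m X Y = sgn a b • m Y X)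
    (assoc : ∀ X Y Z, m (m X Y) Z = m X (m Y Z))
    (symm : ∀ a b c X Y Z, H a X → H b Y → H c Z →
      covMul m n a b X Y Z = sgn a b • covMul m n b a Y X Z)
    {a b c d : ZMod 2} {X Y Z W : E} (hX : H a X) (hY : H b Y) (hZ : H c Z) (hW : H d W) :
    covMul m n (a + b) c (m X Y) Z W - sgn (a + b) (c + d) • covMul m n (c + d) a (m Z W) X Y +
      sgn (a + b) c • m (covMul m n c a Z X Y) W + sgn (a + b) (c + d) • m Z (covMul m n d a W X Y) -
      m X (covMul m n b c Y Z W) - sgn a b • m Y (covMul m n a c X Z W) = 0 := by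
  -- The product `X ∘ Y ∘ W` is differentiated along `Z`, and `Z ∘ W ∘ Y` along `X`. By symmetry and
  -- supercommutativity both identities contain the derivative with arguments `X`, `Z`, `W ∘ Y`;
  -- eliminating it leaves the claim.
  have h1 := covMul_assoc (n := n) (v := c) (a := a) (b := b) (V := Z) (A := X) (B := Y) assoc W
  have h2 := covMul_assoc (n := n) (v := a) (a := c) (b := d) (V := X) (A := Z) (B := W) assoc Y
  have e1 := symm (a + b) c d _ Z W (hm _ _ _ _ hX hY) hZ hW
  have e2 := symm (c + d) a b _ X Y (hm _ _ _ _ hZ hW) hX hY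
  have e3 : covMul m n c a Z X (m Y W) = (sgn c a * sgn b d) • covMul m n a c X Z (m W Y) := by
    rw [symm c a (b + d) Z X _ hZ hX (hm _ _ _ _ hY hW), comm b d Y W hY hW, mul_smul]
    congr 1
    unfold covMul
    simp only [map_zsmul, smul_sub, smul_comm (sgn a c) (sgn b d)]
  have e4 := symm c b d Z Y W hZ hY hW
  have e5 := symm d a b W X Y hW hX hY
  have e6 := comm (a + c + d) b _ Y (covMul_mem hm hn hsub hz hX hZ hW) hY
  rw [e3, e4] at h1
  rw [e6] at h2
  rw [e1, e2, e5]
  simp only [map_zsmul] at h1 h2 ⊢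
  generalize covMul m n c (a + b) Z (m X Y) W = t1 at *
  generalize covMul m n a (c + d) X (m Z W) Y = t2 at *
  generalize m (covMul m n c a Z X Y) W = t3 at *
  generalize m Z (covMul m n a d X W Y) = t4 at *
  generalize m X (covMul m n b c Y Z W) = t5 at *
  generalize m Y (covMul m n a c X Z W) = t6 at *
  generalize covMul m n a c X Z (m W Y) = t7 at *
  rw [← eq_sub_iff_add_eq] at h1 h2
  rw [h1, h2]
  -- What remains is bookkeeping of signs, settled by the sixteen choices of parities.
  simp only [sgn_add_left, sgn_add_right]
  clear h1 h2 e1 e2 e3 e4 e5 e6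
  clear symm comm hX hY hZ hW
  obtain rfl | rfl := zmod_two_cases a <;> obtain rfl | rfl := zmod_two_cases b <;>
    obtain rfl | rfl := zmod_two_cases c <;> obtain rfl | rfl := zmod_two_cases d <;>
    simp only [sgn_zero_left, sgn_zero_right, sgn_one_one, one_smul, neg_smul, smul_sub, smul_add,
      smul_neg, mul_one, mul_neg, neg_neg] <;> abel

set_option maxHeartbeats 1000000 in
/-- The Hertling–Manin identity. -/
lemma hertlingManin_of_symm (hm : ∀ a b X Y, H a X → H b Y → H (a + b) (m X Y))
    (hn : ∀ a b X Y, H a X → H b Y → H (a + b) (n X Y))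
    (hsub : ∀ a X Y, H a X → H a Y → H a (X - Y)) (hz : ∀ a X (z : ℤ), H a X → H a (z • X))
    (comm : ∀ a b X Y, H a X → H b Y → m X Y = sgn a b • m Y X)
    (assoc : ∀ X Y Z, m (m X Y) Z = m X (m Y Z))
    (symm : ∀ a b c X Y Z, H a X → H b Y → H c Z →
      covMul m n a b X Y Z = sgn a b • covMul m n b a Y X Z)
    {br : E → E → E} (tors : ∀ a b X Y, H a X → H b Y → n X Y - sgn a b • n Y X = br X Y)
    {a b c d : ZMod 2} {X Y Z W : E} (hX : H a X) (hY : H b Y) (hZ : H c Z) (hW : H d W) :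
    br (m X Y) (m Z W) - m (br (m X Y) Z) W - sgn (a + b) c • m Z (br (m X Y) W) =
      m X (br Y (m Z W) - m (br Y Z) W - sgn b c • m Z (br Y W)) +
        sgn a b • m Y (br X (m Z W) - m (br X Z) W - sgn a c • m Z (br X W)) := by
  have key := covMul_mul hm hn hsub hz comm assoc symm hX hY hZ hW
  have hXY := hm _ _ _ _ hX hY
  have hZW := hm _ _ _ _ hZ hW
  rw [← tors _ _ _ _ hXY hZW, ← tors _ _ _ _ hXY hZ, ← tors _ _ _ _ hXY hW,
    ← tors _ _ _ _ hY hZW, ← tors _ _ _ _ hY hZ, ← tors _ _ _ _ hY hW,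
    ← tors _ _ _ _ hX hZW, ← tors _ _ _ _ hX hZ, ← tors _ _ _ _ hX hW]
  -- After brackets are replaced by covariant derivatives, the two sides differ by `covMul_mul` up
  -- to reordering of factors. The identities `c1` to `c4` give the remaining products a normal
  -- order.
  have c1 := comm _ _ _ _ (hn _ _ _ _ hZW hX) hY
  have swap : ∀ a b A B C, H a A → H b B → m A (m B C) = sgn a b • m B (m A C) := by
    intro a b A B C hA hB
    rw [← assoc, comm a b A B hA hB]
    simp only [map_zsmul, AddMonoidHom.coe_smul, Pi.smul_apply, assoc]
  have c2 : m (n Z X) (m Y W) = sgn (c + a) b • m Y (m (n Z X) W) :=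
    swap _ _ _ _ _ (hn _ _ _ _ hZ hX) hY
  have c3 : m Z (m (n W X) Y) = (sgn (d + a) b * sgn c b) • m Y (m Z (n W X)) := by
    rw [comm _ _ _ _ (hn _ _ _ _ hW hX) hY, map_zsmul, swap c b Z Y _ hZ hY, mul_smul]
  have c4 : m Z (m X (n W Y)) = sgn c a • m X (m Z (n W Y)) := swap c a Z X _ hZ hX
  unfold covMul at key
  simp only [map_sub, map_zsmul, AddMonoidHom.sub_apply, AddMonoidHom.coe_smul, Pi.smul_apply,
    assoc, c1, c2, c3, c4] at key ⊢
  rw [← sub_eq_zero]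
  refine Eq.trans ?_ key
  clear key c1 c2 c3 c4 swap symm comm tors hX hY hZ hW hXY hZW
  simp only [sgn_add_left, sgn_add_right]
  obtain rfl | rfl := zmod_two_cases a <;> obtain rfl | rfl := zmod_two_cases b <;>
    obtain rfl | rfl := zmod_two_cases c <;> obtain rfl | rfl := zmod_two_cases d <;>
    simp only [sgn_zero_left, sgn_zero_right, sgn_one_one, one_smul, neg_smul, smul_sub,
      smul_neg, mul_one, mul_neg, neg_neg] <;> abel

end SuperAlgebra

/-! ### Symmetry of the covariant derivative of a multiplication -/

namespace SuperSpace

variable {N : ℕ} {M : Type u} [TopologicalSpace M] {S : SuperSpace.{u, v} N M} {U V W : Opens M}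

namespace TangentMul

variable (m : S.TangentMul)

/-- A multiplication as a biadditive map. -/
def mulHom (U : Opens M) : S.T U →+ S.T U →+ S.T U :=
  AddMonoidHom.mk' (fun X => AddMonoidHom.mk' (m.mul U X) (m.mul_add U X))
    fun X X' => AddMonoidHom.ext fun Y => m.add_mul U X X' Y

lemma mul_smul_parP {a : ZMod 2} {X : S.T U} (hX : X.IsHom a) (f : S.O U) (Y : S.T U) :
    m.mul U X (f • Y) = parP a f • m.mul U X Y := by
  refine O_induction_hom (P := fun f => m.mul U X (f • Y) = parP a f • m.mul U X Y) f
    (fun c g hg => ?_) fun f g hf hg => ?_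
  · rw [m.mul_smul U a c X g Y hX hg, parP_of_isHom hg, smul_assoc]
  · rw [add_smul, m.mul_add, hf, hg, parP_add, add_smul]

lemma mul_sum {J : Type*} (s : Finset J) (X : S.T U) (Y : J → S.T U) :
    m.mul U X (∑ j ∈ s, Y j) = ∑ j ∈ s, m.mul U X (Y j) := map_sum (m.mulHom U X) Y s

lemma sum_mul {J : Type*} (s : Finset J) (X : J → S.T U) (Y : S.T U) :
    m.mul U (∑ j ∈ s, X j) Y = ∑ j ∈ s, m.mul U (X j) Y := by
  have h := congrArg (fun F : S.T U →+ S.T U => F Y) (map_sum (m.mulHom U) X s)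
  simp only [AddMonoidHom.finsetSum_apply] at h
  exact h

lemma mul_zero (X : S.T U) : m.mul U X 0 = 0 := map_zero (m.mulHom U X)

lemma zero_mul (Y : S.T U) : m.mul U 0 Y = 0 :=
  congrArg (fun F : S.T U →+ S.T U => F Y) (map_zero (m.mulHom U))

lemma mul_zsmul (n : ℤ) (X Y : S.T U) : m.mul U X (n • Y) = n • m.mul U X Y :=
  map_zsmul (m.mulHom U X) n Y

lemma sub_mul (X X' Y : S.T U) : m.mul U (X - X') Y = m.mul U X Y - m.mul U X' Y :=
  congrArg (fun F : S.T U →+ S.T U => F Y) (map_sub (m.mulHom U) X X')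

lemma zsmul_mul (n : ℤ) (X Y : S.T U) : m.mul U (n • X) Y = n • m.mul U X Y := by
  have h := congrArg (fun F : S.T U →+ S.T U => F Y) (map_zsmul (m.mulHom U) n X)
  simp only [AddMonoidHom.coe_smul, Pi.smul_apply] at h
  exact h

/-- The failure of symmetry of the covariant derivative `(∇_X ∘)(Y, Z)` in `X` and `Y`. -/
def defect (nabla : S.Connection) (a b : ZMod 2) (X Y Z : S.T U) : S.T U :=
  covMul (m.mulHom U) (nabla.covHom U) a b X Y Z -
    sgn a b • covMul (m.mulHom U) (nabla.covHom U) b a Y X Z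

/-- The covariant derivative of the multiplication is supersymmetric. -/
def IsSymm (nabla : S.Connection) : Prop :=
  ∀ (U : Opens M) (a b c : ZMod 2) (X Y Z : S.T U), X.IsHom a → Y.IsHom b → Z.IsHom c →
    m.defect nabla a b X Y Z = 0

variable {m} {nabla : S.Connection}

/-- Up to its last term this is the part of the curvature of the pencil that is linear in the
parameter. For a torsionless connection the last term contains the bracket of `X` and `Y`. -/
lemma defect_eq (a b : ZMod 2) (X Y Z : S.T U) : m.defect nabla a b X Y Z =
    nabla.cov U X (m.mul U Y Z) + m.mul U X (nabla.cov U Y Z) -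
      sgn a b • (nabla.cov U Y (m.mul U X Z) + m.mul U Y (nabla.cov U X Z)) -
      m.mul U (nabla.cov U X Y - sgn a b • nabla.cov U Y X) Z := by
  have e : sgn b a = sgn a b := sgn_comm b a
  unfold defect covMul
  change nabla.cov U X (m.mul U Y Z) - m.mul U (nabla.cov U X Y) Z -
      sgn a b • m.mul U Y (nabla.cov U X Z) - sgn a b • (nabla.cov U Y (m.mul U X Z) -
        m.mul U (nabla.cov U Y X) Z - sgn b a • m.mul U X (nabla.cov U Y Z)) = _
  rw [sub_mul, zsmul_mul, e]
  obtain h | h := sgn_eq_or a b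
  all_goals
    rw [h]
    simp only [one_smul, neg_smul]
    abel

lemma defect_add_left (a b : ZMod 2) (X X' Y Z : S.T U) :
    m.defect nabla a b (X + X') Y Z = m.defect nabla a b X Y Z + m.defect nabla a b X' Y Z := by
  unfold defect covMul
  simp only [map_add, AddMonoidHom.add_apply, smul_add, smul_sub]
  abel

lemma defect_add_right (a b : ZMod 2) (X Y Z Z' : S.T U) :
    m.defect nabla a b X Y (Z + Z') = m.defect nabla a b X Y Z + m.defect nabla a b X Y Z' := by
  unfold defect covMul
  simp only [map_add, smul_add, smul_sub]
  abel

lemma defect_swap (a b : ZMod 2) (X Y Z : S.T U) :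
    m.defect nabla a b X Y Z = -(sgn a b • m.defect nabla b a Y X Z) := by
  unfold defect
  rw [smul_sub, smul_smul, sgn_comm b a, sgn_mul_self, one_smul, neg_sub]

lemma defect_zero_right (a b : ZMod 2) (X Y : S.T U) : m.defect nabla a b X Y 0 = 0 := by
  have h := defect_add_right (m := m) (nabla := nabla) a b X Y 0 0
  rwa [add_zero, left_eq_add] at h

lemma defect_zero_left (a b : ZMod 2) (Y Z : S.T U) : m.defect nabla a b 0 Y Z = 0 := by
  have h := defect_add_left (m := m) (nabla := nabla) a b 0 0 Y Z
  rwa [add_zero, left_eq_add] at h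

lemma defect_sum_left {J : Type*} (s : Finset J) (a b : ZMod 2) (X : J → S.T U) (Y Z : S.T U) :
    m.defect nabla a b (∑ j ∈ s, X j) Y Z = ∑ j ∈ s, m.defect nabla a b (X j) Y Z := by
  classical
  induction s using Finset.induction_on with
  | empty => exact defect_zero_left _ _ _ _
  | insert j s hj ih => rw [Finset.sum_insert hj, Finset.sum_insert hj, defect_add_left, ih]

lemma defect_sum_right {J : Type*} (s : Finset J) (a b : ZMod 2) (X Y : S.T U) (Z : J → S.T U) :
    m.defect nabla a b X Y (∑ j ∈ s, Z j) = ∑ j ∈ s, m.defect nabla a b X Y (Z j) := by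
  classical
  induction s using Finset.induction_on with
  | empty => exact defect_zero_right _ _ _ _
  | insert j s hj ih => rw [Finset.sum_insert hj, Finset.sum_insert hj, defect_add_right, ih]

/-- The defect is a tensor: the derivative `Y f` enters through `∇_Y (f X ∘ Z)` and through `∇_Y (f
X)`, with opposite signs. -/
lemma defect_smul_left {a b c : ZMod 2} {X Y : S.T U} (hY : Y.IsHom b) {f : S.O U}
    (hf : S.IsHom c f) (Z : S.T U) :
    m.defect nabla (c + a) b (f • X) Y Z = f • m.defect nabla a b X Y Z := by
  rw [defect_eq, defect_eq]
  rw [nabla.cov_smul_left, m.smul_mul, nabla.cov_smul_left, m.smul_mul,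
    nabla.cov_leibniz U b c Y f _ hY hf, nabla.cov_leibniz U b c Y f _ hY hf, nabla.cov_smul_left,
    m.mul_smul U b c Y f _ hY hf]
  simp only [sub_mul, zsmul_mul, m.add_mul, m.smul_mul, sgn_add_left, smul_add, smul_sub,
    smul_smul, ← smul_assoc]
  simp only [smul_comm f, smul_assoc, sgn_comm b c]
  obtain h1 | h1 := sgn_eq_or c b
  all_goals
    rw [h1]
    simp only [neg_smul, mul_one, mul_neg, neg_mul, one_mul, neg_neg]
    abel

/-- The derivative `X f` enters through `∇_X (Y ∘ f Z)` and through `Y ∘ ∇_X (f Z)`, with opposite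
signs, and likewise `Y f`. So it suffices to know the defect on a frame. -/
lemma defect_smul_right {a b c : ZMod 2} {X Y : S.T U} (hX : X.IsHom a) (hY : Y.IsHom b)
    {f : S.O U} (hf : S.IsHom c f) (Z : S.T U) :
    m.defect nabla a b X Y (f • Z) = sgn (a + b) c • (f • m.defect nabla a b X Y Z) := by
  have hXY : (nabla.cov U X Y - sgn a b • nabla.cov U Y X).IsHom (a + b) := by
    refine (nabla.cov_hom U a b X Y hX hY).sub (T.IsHom.zsmul _ ?_)
    rw [add_comm]; exact nabla.cov_hom U b a Y X hY hX
  rw [defect_eq, defect_eq, m.mul_smul U b c Y f Z hY hf, m.mul_smul U a c X f Z hX hf,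
    nabla.cov_zsmul_right, nabla.cov_zsmul_right, nabla.cov_leibniz U a c X f _ hX hf,
    nabla.cov_leibniz U b c Y f _ hY hf, nabla.cov_leibniz U a c X f _ hX hf,
    nabla.cov_leibniz U b c Y f _ hY hf, m.mul_add, m.mul_add, mul_zsmul, mul_zsmul,
    m.mul_smul U b c Y f _ hY hf, m.mul_smul U a c X f _ hX hf,
    m.mul_smul U a (b + c) X _ Z hX (hY.deriv hf), m.mul_smul U b (a + c) Y _ Z hY (hX.deriv hf),
    m.mul_smul U (a + b) c _ f Z hXY hf]
  simp only [sgn_add_left, sgn_add_right, smul_add, smul_sub, smul_comm f]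
  rw [sgn_comm b a]
  obtain h1 | h1 := sgn_eq_or a b <;> obtain h2 | h2 := sgn_eq_or a c <;>
  obtain h3 | h3 := sgn_eq_or b c <;> rw [h1, h2, h3] <;>
    simp only [one_smul, neg_smul, mul_one, mul_neg, neg_neg, smul_neg] <;> abel

end TangentMul

/-! ### Flat vector fields -/

section FlatFields

variable {nabla : S.Connection} {m : S.TangentMul}

lemma Connection.IsFlatField.hp {X : S.T U} (hX : nabla.IsFlatField X) (b : ZMod 2) :
    nabla.IsFlatField (X.hp b) := fun V h Z => by
  refine Z.induction_hom (P := fun Z => nabla.cov V Z ((X.hp b).restrict h) = 0) ?_ ?_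
  · intro a Y hY
    rw [← T.hp_restrict, Chart.cov_hp hY, hX V h Y]
    exact (T.isHom_zero _).hp_self
  · intro Y Z hY hZ
    rw [nabla.cov_add_left, hY, hZ, add_zero]

lemma Connection.IsFlatField.cov_eq_zero {X : S.T U} (hX : nabla.IsFlatField X) (Z : S.T U) :
    nabla.cov U Z X = 0 := hX U le_rfl Z

/-- In the torsion identity the term `∇_C Y` vanishes. For flat `X` and `Y` the potential condition
becomes `X ∘ Y = ∇_X ∇_Y C`. -/
lemma Connection.IsFlatField.bracket_eq (tors : nabla.IsTorsionless) {Y : S.T U}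
    (hY : nabla.IsFlatField Y) (C : S.T U) : bracket Y C = nabla.cov U Y C := by
  have key : ∀ b, bracket (Y.hp b) C = nabla.cov U (Y.hp b) C := by
    intro b
    refine C.induction_hom (P := fun C => bracket (Y.hp b) C = nabla.cov U (Y.hp b) C) ?_ ?_
    · intro a Z hZ
      rw [← tors U b a _ _ (T.isHom_hp b Y) hZ, (hY.hp b).cov_eq_zero, smul_zero, sub_zero]
    · intro Z Z' hZ hZ'
      rw [bracket_add_right, hZ, hZ', nabla.cov_add_right]
  rw [← Y.hp_add_hp, bracket_add_left, key, key, nabla.cov_add_left]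

/-- For a flat connection, the multiplication defined by a potential has a symmetric derivative. -/
lemma defect_eq_zero_of_flat (tors : nabla.IsTorsionless) (flat : nabla.IsFlat) {C : S.T U}
    (hC : ∀ X Y : S.T U, nabla.IsFlatField X → nabla.IsFlatField Y →
      m.mul U X Y = bracket X (bracket Y C)) {a b : ZMod 2} {X Y Z : S.T U}
    (hX : X.IsHom a) (hY : Y.IsHom b) (fX : nabla.IsFlatField X) (fY : nabla.IsFlatField Y)
    (fZ : nabla.IsFlatField Z) : m.defect nabla a b X Y Z = 0 := by
  have hbr : bracket X Y = 0 := by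
    rw [fX.bracket_eq tors, fY.cov_eq_zero]
  -- Here `Y ∘ Z = ∇_Y ∇_Z C`, so what is left of the defect is the curvature applied to `∇_Z C`,
  -- and `[X, Y] = 0`.
  rw [TangentMul.defect_eq, hC Y Z fY fZ, hC X Z fX fZ, fZ.bracket_eq tors, fX.bracket_eq tors,
    fY.bracket_eq tors, fZ.cov_eq_zero, fZ.cov_eq_zero, fY.cov_eq_zero, fX.cov_eq_zero, m.mul_zero,
    m.mul_zero, smul_zero, sub_zero, m.zero_mul, add_zero, add_zero, sub_zero,
    flat U a b X Y _ hX hY, hbr, nabla.cov_zero_left]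

end FlatFields

namespace Chart

variable {p k q : ℕ} {φ : S.Chart p k q} {hU : (U : Set M) ⊆ φ.e.source}
  {hV : (V : Set M) ⊆ φ.e.source} {hW : (W : Set M) ⊆ φ.e.source} {x : M} {nabla : S.Connection}
  {m : S.TangentMul}

lemma FlatFrame.isFlatField (B : φ.FlatFrame nabla hW) (a : Idx p k q) :
    nabla.IsFlatField (B.e a) := fun _ h Z =>
  (B.restrict h (subset_source h hW)).cov_eq_zero Z a

/-- Symmetry of the derivative of a multiplication can be checked on a flat frame. -/
lemma FlatFrame.defect_eq_zero (B : φ.FlatFrame nabla hW)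
    (h : ∀ a b c, m.defect nabla (ipar a) (ipar b) (B.e a) (B.e b) (B.e c) = 0) {a b c : ZMod 2}
    {X Y Z : S.T W} (hX : X.IsHom a) (hY : Y.IsHom b) (hZ : Z.IsHom c) :
    m.defect nabla a b X Y Z = 0 := by
  have h1 : ∀ i j, m.defect nabla (ipar i) (ipar j) (B.e i) (B.e j) Z = 0 := by
    intro i j
    rw [B.eq_sum_comp Z, TangentMul.defect_sum_right]
    refine Finset.sum_eq_zero fun l _ => ?_
    rw [TangentMul.defect_smul_right (B.isHom i) (B.isHom j) (B.isHom_comp hZ l), h, smul_zero,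
      smul_zero]
  have h2 : ∀ j, m.defect nabla a (ipar j) X (B.e j) Z = 0 := by
    intro j
    rw [B.eq_sum_comp X, TangentMul.defect_sum_left]
    refine Finset.sum_eq_zero fun l _ => ?_
    have := TangentMul.defect_smul_left (m := m) (nabla := nabla) (a := ipar l) (X := B.e l)
      (B.isHom j) (B.isHom_comp hX l) Z
    rw [ipar_add_self] at this
    rw [this, h1, smul_zero]
  rw [TangentMul.defect_swap, B.eq_sum_comp Y, TangentMul.defect_sum_left, Finset.sum_eq_zero,
    smul_zero, neg_zero]
  intro l _
  have := TangentMul.defect_smul_left (m := m) (nabla := nabla) (a := ipar l) (X := B.e l)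
    hX (B.isHom_comp hY l) Z
  rw [ipar_add_self] at this
  rw [this, TangentMul.defect_swap, h2, smul_zero, neg_zero, smul_zero]

end Chart

lemma TangentMul.defect_restrict {m : S.TangentMul} {nabla : S.Connection} (h : V ≤ U)
    (a b : ZMod 2) (X Y Z : S.T U) : (m.defect nabla a b X Y Z).restrict h =
      m.defect nabla a b (X.restrict h) (Y.restrict h) (Z.restrict h) := by
  simp only [defect_eq, T.restrict_sub, T.restrict_add, T.restrict_zsmul, nabla.cov_res, m.mul_res]

/-- A multiplication with a local potential for a flat torsionless connection has a symmetric
covariant derivative. -/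
theorem isSymm_of_isCompatible (hS : S.IsSupermanifold) {m : S.TangentMul} {nabla : S.Connection}
    (tors : nabla.IsTorsionless) (flat : nabla.IsFlat) (hc : m.IsCompatible nabla) :
    m.IsSymm nabla := by
  intro U a b c X Y Z hX hY hZ
  refine T.eq_of_locally fun x hx => ?_
  obtain ⟨p, k, q, φ, hxφ⟩ := hS x
  obtain ⟨U₀, hxU₀, C, hC⟩ := hc x
  set V : Opens M := U ⊓ U₀ ⊓ ⟨φ.e.source, φ.e.open_source⟩
  have hV : (V : Set M) ⊆ φ.e.source := fun _ hy => hy.2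
  obtain ⟨W, hWV, hW, hxW, ⟨B⟩⟩ := Chart.exists_flatFrame (φ := φ) flat hV
    (show x ∈ V from ⟨⟨hx, hxU₀⟩, hxφ⟩)
  have hWU : W ≤ U := hWV.trans (inf_le_left.trans inf_le_left)
  have hWU₀ : W ≤ U₀ := hWV.trans (inf_le_left.trans inf_le_right)
  refine ⟨W, hWU, hxW, ?_⟩
  rw [TangentMul.defect_restrict, T.restrict_zero]
  refine B.defect_eq_zero (fun i j l => ?_) (hX.restrict hWU) (hY.restrict hWU) (hZ.restrict hWU)
  exact defect_eq_zero_of_flat tors flat (hC W hWU₀) (B.isHom i) (B.isHom j) (B.isFlatField i)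
    (B.isFlatField j) (B.isFlatField l)

end SuperSpace

lemma isEvenConstant_zero {N : ℕ} : IsEvenConstant (0 : Constants N) := map_zero _

lemma isEvenConstant_algebraMap {N : ℕ} (c : ℂ) : IsEvenConstant (algebraMap ℂ (Constants N) c) :=
  AlgHom.commutes _ c

lemma IsEvenConstant.add {N : ℕ} {c d : Constants N} (hc : IsEvenConstant c) (hd : IsEvenConstant d) :
    IsEvenConstant (c + d) := by
  rw [IsEvenConstant, map_add, hc, hd]

/-! ### Local potentials of a multiplication with symmetric derivative -/

namespace SuperSpace

variable {N : ℕ} {M : Type u} [TopologicalSpace M] {S : SuperSpace.{u, v} N M} {U V W : Opens M}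

namespace Chart

variable {p k q : ℕ} {φ : S.Chart p k q} {hU : (U : Set M) ⊆ φ.e.source}
  {hV : (V : Set M) ⊆ φ.e.source} {hW : (W : Set M) ⊆ φ.e.source} {x : M} {nabla : S.Connection}
  {m : S.TangentMul}

lemma cov_dT_comm (tors : nabla.IsTorsionless) (i j : Idx p k q) :
    nabla.cov U (φ.dT i hU) (φ.dT j hU) =
      sgn (ipar i) (ipar j) • nabla.cov U (φ.dT j hU) (φ.dT i hU) := by
  have h := tors U _ _ _ _ (isHom_dT (φ := φ) (hU := hU) i) (isHom_dT (φ := φ) (hU := hU) j)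
  rwa [bracket_dT, sub_eq_zero] at h

lemma cov_eq_mul_of_dT {b e : S.T U}
    (h : ∀ i, nabla.cov U (φ.dT i hU) b = m.mul U (φ.dT i hU) e) (X : S.T U) :
    nabla.cov U X b = m.mul U X e := by
  rw [eq_sum_deriv_coord hU X, nabla.cov_sum_left, m.sum_mul]
  refine Finset.sum_congr rfl fun i _ => ?_
  rw [nabla.cov_smul_left, h, m.smul_mul]

/-- Local primitives of the flat fields with respect to the multiplication. -/
lemma FlatFrame.exists_primitives (tors : nabla.IsTorsionless) (flat : nabla.IsFlat)
    (symm : m.IsSymm nabla) (B : φ.FlatFrame nabla hW) (hx : x ∈ W) :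
    ∃ (V : Opens M) (h : V ≤ W) (b : Idx p k q → S.T V), x ∈ V ∧ (∀ a, (b a).IsHom (ipar a)) ∧
      ∀ (X : S.T V) a, nabla.cov V X (b a) = m.mul V X ((B.e a).restrict h) := by
  have key := fun a => exists_primitive (nabla := nabla) flat hW hx
    (fun i => m.mul W (φ.dT i hW) (B.e a)) (ipar a)
    (fun i => m.mul_hom W _ _ _ _ (isHom_dT i) (B.isHom a)) (fun i j => by
      -- Evaluated on two coordinate fields and the flat field `B.e a`, the vanishing of the defect
      -- is exactly closedness of the form `X ↦ X ∘ B.e a`.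
      have h := symm W _ _ _ _ _ _ (isHom_dT (φ := φ) (hU := hW) i)
        (isHom_dT (φ := φ) (hU := hW) j) (B.isHom a)
      rw [TangentMul.defect_eq, B.flat, B.flat, m.mul_zero, m.mul_zero, cov_dT_comm tors i j,
        sub_self, m.zero_mul, add_zero, add_zero, sub_zero, sub_eq_zero] at h
      exact h) 0 (fun _ _ => rfl)
  choose V₀ hV₀W hV₀ b hxV₀ hb hcov _ using key
  set V : Opens M := W ⊓ Finset.univ.inf V₀
  have hle : ∀ a, V ≤ V₀ a := fun a => inf_le_right.trans (Finset.inf_le (Finset.mem_univ a))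
  have hVW : V ≤ W := inf_le_left
  have hV := subset_source hVW hW
  refine ⟨V, hVW, fun a => (b a).restrict (hle a), ⟨hx, ?_⟩, fun a => (hb a).restrict _,
    fun X a => cov_eq_mul_of_dT (φ := φ) (hU := hV) (fun i => ?_) X⟩
  · rw [Opens.coe_finset_inf]
    simpa using hxV₀
  · have h := congrArg (T.restrict (hle a)) (hcov a i)
    rw [nabla.cov_res, restrict_dT (hV := hV), T.restrict_restrict, m.mul_res,
      restrict_dT (hV := hV)] at h
    exact h

/-- The derivative of the coefficients of a flat frame. -/
lemma FlatFrame.dO_F (tors : nabla.IsTorsionless) (B : φ.FlatFrame nabla hW) (i j a : Idx p k q) :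
    φ.dO i hW (B.F j a) = sgn (ipar i) (ipar j) • φ.dO j hW (B.F i a) := by
  have h1 : ∀ i j, nabla.cov W (φ.dT i hW) (φ.dT j hW) = ∑ a, φ.dO i hW (B.F j a) • B.e a := by
    intro i j
    conv_lhs => rw [B.dT_eq j, nabla.cov_sum_right]
    refine Finset.sum_congr rfl fun a _ => ?_
    rw [nabla.cov_smul (isHom_dT i), B.flat, smul_zero, add_zero, deriv_dT]
  have h2 := cov_dT_comm (φ := φ) (hU := hW) tors i j
  rw [h1, h1, Finset.smul_sum, ← sub_eq_zero, ← Finset.sum_sub_distrib] at h2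
  have h3 := B.indep (c := fun a => φ.dO i hW (B.F j a) -
    sgn (ipar i) (ipar j) • φ.dO j hW (B.F i a)) (by simpa only [sub_smul, smul_assoc] using h2)
  exact sub_eq_zero.1 (congrFun h3 a)

end Chart

/-- A supercommutative multiplication with a symmetric covariant derivative has local
potentials. -/
theorem isCompatible_of_isSymm (hS : S.IsSupermanifold) {m : S.TangentMul} {nabla : S.Connection}
    (tors : nabla.IsTorsionless) (flat : nabla.IsFlat) (comm : m.IsSupercommutative)
    (symm : m.IsSymm nabla) : m.IsCompatible nabla := by
  intro x
  obtain ⟨p, k, q, φ, hxφ⟩ := hS x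
  obtain ⟨W₀, -, hW₀, hxW₀, ⟨B₀⟩⟩ := Chart.exists_flatFrame (φ := φ)
    (U := ⟨φ.e.source, φ.e.open_source⟩) flat subset_rfl hxφ
  obtain ⟨W, hWW₀, b, hxW, hb, hcov⟩ := B₀.exists_primitives tors flat symm hxW₀
  have hW := Chart.subset_source hWW₀ hW₀
  set B := B₀.restrict hWW₀ hW
  -- These are the components on coordinate fields of the form that takes the value `b a` on `B.e
  -- a`. A primitive `C` of it satisfies `∇_X ∇_Y C = X ∘ Y` whenever `Y` belongs to the frame.
  set h : Idx p k q → S.T W := fun i => ∑ a, B.F i a • b a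
  have hcovh : ∀ i j, nabla.cov W (φ.dT i hW) (h j) =
      ∑ a, φ.dO i hW (B.F j a) • b a + m.mul W (φ.dT i hW) (φ.dT j hW) := by
    intro i j
    conv_rhs => rw [B.dT_eq j, m.mul_sum, ← Finset.sum_add_distrib]
    rw [nabla.cov_sum_right]
    refine Finset.sum_congr rfl fun a _ => ?_
    rw [nabla.cov_smul (Chart.isHom_dT i), hcov, m.mul_smul_parP (Chart.isHom_dT i)]
    rfl
  obtain ⟨W', hW'W, hW', C, hxW', -, hC, -⟩ := Chart.exists_primitive (nabla := nabla) flat hW hxW h 0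
    (fun i => T.IsHom.sum _ fun a _ => by
      have := T.IsHom.smul (B.isHom_F i a) (hb a)
      rwa [Chart.ipar_add_self, ← add_zero (ipar i)] at this)
    -- Closedness has two parts: the derivatives of the frame coefficients are supersymmetric
    -- because the torsion vanishes (`FlatFrame.dO_F`), and the products because `∘` is
    -- supercommutative.
    (fun i j => by
      rw [hcovh, hcovh, smul_add, Finset.smul_sum,
        comm W _ _ _ _ (Chart.isHom_dT (φ := φ) (hU := hW) i) (Chart.isHom_dT (φ := φ) (hU := hW) j)]
      congr 1
      refine Finset.sum_congr rfl fun a _ => ?_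
      rw [B.dO_F tors i j a, smul_assoc]) 0 (fun _ _ => rfl)
  refine ⟨W', hxW', C, fun V hVW' X Y fX fY => ?_⟩
  have hVW := hVW'.trans hW'W
  have hV := Chart.subset_source hVW hW
  set BV := B.restrict hVW hV
  rw [fY.bracket_eq tors, fX.bracket_eq tors]
  have hYC : nabla.cov V Y (C.restrict hVW') = ∑ a, BV.comp Y a • (b a).restrict hVW := by
    conv_lhs => rw [Chart.eq_sum_deriv_coord hV Y, nabla.cov_sum_left]
    simp only [Chart.FlatFrame.comp, Finset.sum_smul]
    rw [Finset.sum_comm]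
    refine Finset.sum_congr rfl fun i _ => ?_
    have h1 := congrArg (T.restrict hVW') (hC i)
    rw [nabla.cov_res, Chart.restrict_dT (hV := hV), T.restrict_restrict, T.restrict_sum] at h1
    rw [nabla.cov_smul_left, h1, Finset.smul_sum]
    refine Finset.sum_congr rfl fun a _ => ?_
    rw [T.restrict_smul, smul_smul]
    rfl
  refine X.induction_hom (P := fun X => m.mul V X Y = nabla.cov V X (nabla.cov V Y (C.restrict hVW')))
    (fun c Z hZ => ?_) fun Z Z' hZ hZ' => by rw [m.add_mul, nabla.cov_add_left, hZ, hZ']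
  -- A flat field has components in a flat frame that every vector field kills. They pass through
  -- covariant derivatives and reduce a general flat `Y` to the frame.
  have hconst : (fun a => Z.deriv (BV.comp Y a)) = 0 := by
    refine BV.indep ?_
    have h1 := fY.cov_eq_zero Z
    rw [BV.eq_sum_comp Y, nabla.cov_sum_right] at h1
    rw [← h1]
    refine Finset.sum_congr rfl fun a _ => ?_
    rw [nabla.cov_smul hZ, BV.cov_eq_zero, smul_zero, add_zero]
  rw [hYC, nabla.cov_sum_right]
  conv_lhs => rw [BV.eq_sum_comp Y, m.mul_sum]
  refine Finset.sum_congr rfl fun a _ => ?_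
  have h2 : nabla.cov V Z ((b a).restrict hVW) = m.mul V Z (BV.e a) := by
    refine Chart.cov_eq_mul_of_dT (φ := φ) (hU := hV) (fun i => ?_) Z
    have h3 := congrArg (T.restrict hVW) (hcov (φ.dT i hW) a)
    rw [nabla.cov_res, Chart.restrict_dT (hV := hV), m.mul_res, Chart.restrict_dT (hV := hV)] at h3
    exact h3
  rw [nabla.cov_smul hZ, show Z.deriv (BV.comp Y a) = 0 from congrFun hconst a, zero_smul, zero_add,
    m.mul_smul_parP hZ, h2]

/-! ### F-manifolds with compatible flat structure and pencils of connections -/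

lemma isFManifold_of_isSymm {m : S.TangentMul} {nabla : S.Connection} (tors : nabla.IsTorsionless)
    (comm : m.IsSupercommutative) (assoc : m.IsAssociative) (symm : m.IsSymm nabla) :
    m.IsFManifold where
  supercomm := comm
  assoc := assoc
  hertlingManin U _ _ _ _ _ _ _ _ hX hY hZ hW :=
    hertlingManin_of_symm (H := fun a (X : S.T U) => X.IsHom a) (m := m.mulHom U)
      (n := nabla.covHom U) (m.mul_hom U) (nabla.cov_hom U) (fun _ _ _ hX hY => hX.sub hY)
      (fun _ _ z hX => hX.zsmul z) (comm U) (assoc U)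
      (fun a b c X Y Z hX hY hZ => sub_eq_zero.1 (symm U a b c X Y Z hX hY hZ))
      (br := bracket) (tors U) hX hY hZ hW

/-- The identity of Hertling and Manin disappears from the right side, being implied by the rest,
and the potential is traded for the symmetry of the covariant derivative. -/
theorem isFManifoldWithFlatStructure_iff (hS : S.IsSupermanifold) (m : S.TangentMul)
    (nabla : S.Connection) : IsFManifoldWithFlatStructure m nabla ↔ nabla.IsTorsionless ∧
      nabla.IsFlat ∧ m.IsSupercommutative ∧ m.IsAssociative ∧ m.IsSymm nabla :=
  ⟨fun h => ⟨h.torsionless, h.flat, h.isFManifold.supercomm, h.isFManifold.assoc,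
    isSymm_of_isCompatible hS h.torsionless h.flat h.compatible⟩,
  fun ⟨tors, flat, comm, assoc, symm⟩ => ⟨isFManifold_of_isSymm tors comm assoc symm, tors, flat,
    isCompatible_of_isSymm hS tors flat comm symm⟩⟩

section Pencil

variable {nabla : S.Connection} {A : S.HiggsField}

lemma pencil_cov (c : Constants N) (hc : IsEvenConstant c) (X Y : S.T U) :
    (nabla.pencil A c hc).cov U X Y = nabla.cov U X Y + S.const U c • A.circ.mul U X Y := rfl

lemma Connection.ext {nabla nabla' : S.Connection}
    (h : ∀ U X Y, nabla.cov U X Y = nabla'.cov U X Y) : nabla = nabla' := by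
  have h' : nabla.cov = nabla'.cov := funext fun U => funext fun X => funext fun Y => h U X Y
  cases nabla
  cases nabla'
  congr

/-- Any member of the pencil may serve as its base point. -/
lemma pencil_pencil (c d : Constants N) (hc : IsEvenConstant c) (hd : IsEvenConstant d) :
    (nabla.pencil A c hc).pencil A d hd = nabla.pencil A (c + d) (hc.add hd) :=
  Connection.ext fun U X Y => by
    rw [pencil_cov, pencil_cov, pencil_cov, map_add, add_smul, add_assoc]

lemma pencil_zero : nabla.pencil A 0 isEvenConstant_zero = nabla := Connection.ext fun U X Y => by
  rw [pencil_cov, map_zero, zero_smul, add_zero]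

lemma cov_const_smul {a : ZMod 2} {X : S.T U} (hX : X.IsHom a) {c : Constants N}
    (hc : IsEvenConstant c) (Y : S.T U) :
    nabla.cov U X (S.const U c • Y) = S.const U c • nabla.cov U X Y := by
  rw [nabla.cov_leibniz U a 0 X _ Y hX (isHom_const hc U),
    show X.deriv (S.const U c) = 0 from hX.const U le_rfl c, zero_smul, zero_add, sgn_zero_right,
    one_smul]

lemma mul_const_smul {m : S.TangentMul} {a : ZMod 2} {X : S.T U} (hX : X.IsHom a) {c : Constants N}
    (hc : IsEvenConstant c) (Y : S.T U) :
    m.mul U X (S.const U c • Y) = S.const U c • m.mul U X Y := by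
  rw [m.mul_smul U a 0 X _ Y hX (isHom_const hc U), sgn_zero_right, one_smul]

/-- The curvature of a pencil of connections. -/
lemma pencil_curvature {a b : ZMod 2} {X Y : S.T U} (hX : X.IsHom a) (hY : Y.IsHom b)
    {c : Constants N} (hc : IsEvenConstant c) (Z : S.T U) :
    (nabla.pencil A c hc).cov U X ((nabla.pencil A c hc).cov U Y Z) -
        sgn a b • (nabla.pencil A c hc).cov U Y ((nabla.pencil A c hc).cov U X Z) =
      (nabla.cov U X (nabla.cov U Y Z) - sgn a b • nabla.cov U Y (nabla.cov U X Z)) +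
        S.const U c • (A.circ.defect nabla a b X Y Z +
          A.circ.mul U (nabla.cov U X Y - sgn a b • nabla.cov U Y X) Z) +
        S.const U c • S.const U c • (A.circ.mul U X (A.circ.mul U Y Z) -
          sgn a b • A.circ.mul U Y (A.circ.mul U X Z)) := by
  simp only [pencil_cov, nabla.cov_add_right, A.circ.mul_add, cov_const_smul hX hc,
    cov_const_smul hY hc, mul_const_smul hX hc, mul_const_smul hY hc, TangentMul.defect_eq,
    sub_add_cancel, smul_add, smul_sub, smul_comm (S.const U c) (sgn a b)]
  abel

/-- Move `Z` to the front of `(X ∘ Y) ∘ Z`, exchange it with `X` by hypothesis, and move it behind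
`Y` by supercommutativity; the signs cancel. -/
lemma assoc_of_swap {m : S.TangentMul} (comm : m.IsSupercommutative)
    (swap : ∀ (U : Opens M) (a b : ZMod 2) (X Y Z : S.T U), X.IsHom a → Y.IsHom b →
      m.mul U X (m.mul U Y Z) = sgn a b • m.mul U Y (m.mul U X Z)) : m.IsAssociative := by
  intro U X Y Z
  refine X.induction_hom (P := fun X => m.mul U (m.mul U X Y) Z = m.mul U X (m.mul U Y Z)) ?_ ?_
  · intro a X hX
    refine Y.induction_hom (P := fun Y => m.mul U (m.mul U X Y) Z = m.mul U X (m.mul U Y Z)) ?_ ?_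
    · intro b Y hY
      refine Z.induction_hom
        (P := fun Z => m.mul U (m.mul U X Y) Z = m.mul U X (m.mul U Y Z)) ?_ ?_
      · intro c Z hZ
        rw [comm U (a + b) c _ Z (m.mul_hom U a b X Y hX hY) hZ, swap U c a Z X Y hZ hX,
          comm U c b Z Y hZ hY, m.mul_zsmul, smul_smul, smul_smul, sgn_add_left, sgn_comm c a,
          sgn_comm c b, mul_right_comm _ (sgn b c), mul_right_comm _ (sgn b c), sgn_mul_self, one_mul,
          sgn_mul_self, one_smul]
      · intro Z Z' hZ hZ'
        rw [m.mul_add, m.mul_add, m.mul_add, hZ, hZ']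
    · intro Y Y' hY hY'
      rw [m.mul_add, m.add_mul, m.add_mul, m.mul_add, hY, hY']
  · intro X X' hX hX'
    rw [m.add_mul, m.add_mul, m.add_mul, hX, hX']

lemma swap_of_assoc {m : S.TangentMul} (comm : m.IsSupercommutative) (assoc : m.IsAssociative)
    {a b : ZMod 2} {X Y : S.T U} (hX : X.IsHom a) (hY : Y.IsHom b) (Z : S.T U) :
    m.mul U X (m.mul U Y Z) = sgn a b • m.mul U Y (m.mul U X Z) := by
  rw [← assoc U X Y Z, comm U a b X Y hX hY, m.zsmul_mul, assoc U Y X Z]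

/-- Torsion and curvature of the pencil are polynomials of degree at most `1` and `2` in the
parameter. Their coefficients can be recovered from the values `0`, `1` and `-1`, so complex
parameters already determine everything. -/
theorem forall_pencil_iff : (∀ (c : Constants N) (hc : IsEvenConstant c),
    (nabla.pencil A c hc).IsTorsionless ∧ (nabla.pencil A c hc).IsFlat) ↔
      nabla.IsTorsionless ∧ nabla.IsFlat ∧ A.circ.IsSupercommutative ∧ A.circ.IsAssociative ∧
        A.circ.IsSymm nabla := by
  constructor
  · intro h
    have h0 := h 0 isEvenConstant_zero
    rw [pencil_zero] at h0
    obtain ⟨tors, flat⟩ := h0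
    have e1 : ∀ U : Opens M, S.const U (algebraMap ℂ _ 1) = 1 := fun U => by
      rw [map_one, map_one]
    have e2 : ∀ U : Opens M, S.const U (algebraMap ℂ _ (-1)) = -1 := fun U => by
      rw [map_neg, map_one, map_neg, map_one]
    have h1 := h _ (isEvenConstant_algebraMap 1)
    have h2 := h _ (isEvenConstant_algebraMap (-1))
    have comm : A.circ.IsSupercommutative := by
      intro U a b X Y hX hY
      have t := h1.1 U a b X Y hX hY
      rw [pencil_cov, pencil_cov, e1, one_smul, one_smul, ← tors U a b X Y hX hY, smul_add] at t
      rw [← sub_eq_zero]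
      have t' := sub_eq_zero.2 t
      rw [← t']
      abel
    have both : ∀ (U : Opens M) (a b : ZMod 2) (X Y Z : S.T U), X.IsHom a → Y.IsHom b →
        A.circ.mul U X (A.circ.mul U Y Z) = sgn a b • A.circ.mul U Y (A.circ.mul U X Z) ∧
          A.circ.defect nabla a b X Y Z = 0 := by
      intro U a b X Y Z hX hY
      have f1 := h1.2 U a b X Y Z hX hY
      have f2 := h2.2 U a b X Y Z hX hY
      rw [pencil_curvature hX hY, pencil_cov, flat U a b X Y Z hX hY, tors U a b X Y hX hY] at f1 f2
      simp only [e1, one_smul] at f1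
      simp only [e2, neg_smul, one_smul, neg_neg] at f2
      set Q := A.circ.mul U X (A.circ.mul U Y Z) - sgn a b • A.circ.mul U Y (A.circ.mul U X Z)
      set D := A.circ.defect nabla a b X Y Z
      have g1 : D + Q = 0 := by
        have := sub_eq_zero.2 f1
        rw [← this]; abel
      have g2 : -D + Q = 0 := by
        have := sub_eq_zero.2 f2
        rw [← this]; abel
      -- Adding the curvature equations at `1` and `-1` gives `2 Q = 0`, and `2` is invertible.
      have g3 : Q = 0 := T.eq_zero_of_eq_neg <| by
        rw [eq_neg_iff_add_eq_zero]
        have : (D + Q) + (-D + Q) = 0 := by rw [g1, g2, add_zero]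
        rw [← this]; abel
      exact ⟨sub_eq_zero.1 g3, by rwa [g3, add_zero] at g1⟩
    exact ⟨tors, flat, comm,
      assoc_of_swap comm fun U a b X Y Z hX hY => (both U a b X Y Z hX hY).1,
      fun U a b _ X Y Z hX hY _ => (both U a b X Y Z hX hY).2⟩
  · rintro ⟨tors, flat, comm, assoc, symm⟩ c hc
    have symm' : ∀ (U : Opens M) (a b : ZMod 2) (X Y Z : S.T U), X.IsHom a → Y.IsHom b →
        A.circ.defect nabla a b X Y Z = 0 := fun U a b X Y Z hX hY =>
      Z.induction_hom (P := fun Z => A.circ.defect nabla a b X Y Z = 0)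
        (fun _ Z hZ => symm U a b _ X Y Z hX hY hZ) fun Z Z' hZ hZ' => by
          rw [TangentMul.defect_add_right, hZ, hZ', add_zero]
    refine ⟨fun U a b X Y hX hY => ?_, fun U a b X Y Z hX hY => ?_⟩
    · rw [pencil_cov, pencil_cov, comm U a b X Y hX hY, ← tors U a b X Y hX hY, smul_add,
        smul_comm (S.const U c) (sgn a b)]
      abel
    · rw [pencil_curvature hX hY, flat U a b X Y Z hX hY, symm' U a b X Y Z hX hY,
        tors U a b X Y hX hY, swap_of_assoc comm assoc hX hY, sub_self, smul_zero, smul_zero,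
        add_zero, zero_add, pencil_cov]

end Pencil

end SuperSpace

end SuperGeom

end

theorem corollary2p7 {N : ℕ} {M : Type u} [TopologicalSpace M]
    (S : SuperGeom.SuperSpace.{u, v} N M) (hS : S.IsSupermanifold)
    (nabla₀ : S.Connection) (A : S.HiggsField) :
    (SuperGeom.SuperSpace.IsFManifoldWithFlatStructure A.circ nabla₀ ↔
      ∀ (lam : SuperGeom.Constants N) (hlam : SuperGeom.IsEvenConstant lam),
        (nabla₀.pencil A lam hlam).IsTorsionless ∧ (nabla₀.pencil A lam hlam).IsFlat) ∧
    (SuperGeom.SuperSpace.IsFManifoldWithFlatStructure A.circ nabla₀ →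
      ∀ (lam : SuperGeom.Constants N) (hlam : SuperGeom.IsEvenConstant lam),
        SuperGeom.SuperSpace.IsFManifoldWithFlatStructure A.circ (nabla₀.pencil A lam hlam)) := by
  -- The equivalence is stated for an arbitrary base connection so that it applies both to `nabla₀`
  -- and to the other members of the pencil.
  have key : ∀ nabla : S.Connection,
      SuperGeom.SuperSpace.IsFManifoldWithFlatStructure A.circ nabla ↔
        ∀ (lam : SuperGeom.Constants N) (hlam : SuperGeom.IsEvenConstant lam),
          (nabla.pencil A lam hlam).IsTorsionless ∧ (nabla.pencil A lam hlam).IsFlat :=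
    fun nabla => (SuperGeom.SuperSpace.isFManifoldWithFlatStructure_iff hS A.circ nabla).trans
      SuperGeom.SuperSpace.forall_pencil_iff.symm
  refine ⟨key nabla₀, fun h lam hlam => (key _).2 fun mu hmu => ?_⟩
  -- The member at `mu` of the pencil based at parameter `lam` is the member at `lam + mu` of the
  -- original pencil.
  rw [SuperGeom.SuperSpace.pencil_pencil]
  exact (key nabla₀).1 h _ _
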